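/- Let $\zeta = e^{2\pi i/5}$, let $\Lambda\subset\mathbb C^2$ be the lattice generated by $(1,1)$, $(\zeta,\zeta^2)$, $(\zeta^2,\zeta^4)$, $(\zeta^3,\zeta)$, and let $\mathsf T=\mathbb C^2/\Lambda$. The isometries $r(z,w)=(\zeta z,\zeta^2 w)$ and $s(z,w)=(-\bar z,-\bar w)$ preserve $\Lambda$ and generate a dihedral group $D_{10}$ of order $10$ acting on $\mathsf T$. Let $\mathsf O=\mathsf T/D_{10}$ be the quotient flat orbifold, with the PL structure inherited from $\mathbb C^2=\mathbb R^4$: a map from an open subset of $\mathsf O$ to $\mathbb R^n$ is PL if its lift to $\mathbb C^2$ is. For $t=1,\dots,5$ let $P_t\in\mathsf O$ be the image of $\frac{t-1}{5}\,(4+3\zeta+2\zeta^2+\zeta^3,\ 4+3\zeta^2+2\zeta^4+\zeta)$. Let $T\subset\mathsf O$ be the singular set, i.e. the set of points with nontrivial isotropy group. Then: 1. The underlying space of $\mathsf O$ is PL-homeomorphic to $S^4$ (the boundary of the standard $5$-simplex). 2. $T$ is the image of $(i\mathbb R)^2\subset\mathbb C^2$ and is homeomorphic to the torus $S^1\times S^1$;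 the points $P_1,\dots,P_5$ are distinct and belong to $T$. 3. $T$ is locally flat at every point $x\in T\setminus\{P_1,\dots,P_5\}$, in the PL sense: there is a PL homeomorphism from a neighbourhood of $x$ in $\mathsf O$ to a neighbourhood of $0$ in $\mathbb R^4$ that sends $x$ to $0$ and $T$ to $\mathbb R^2\times\{0\}$. 4. At each $P_t$, $T$ is locally a cone over the figure-eight knot: there is a PL homeomorphism from a neighbourhood of $P_t$ in $\mathsf O$ to a neighbourhood of $0$ in $\mathbb R^4=\mathbb R^3\times\mathbb R$ that sends $P_t$ to $0$ and $T$ to the cone $\{(\lambda p,\lambda) : \lambda\ge 0,\ p\in K\}$, where $K\subset\mathbb R^3$ is a polygonal figure-eight knot. Moreover $T$ is not locally flat at $P_t$, not even topologically. -/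

import Mathlib

open scoped Topology ComplexConjugate

noncomputable section

namespace FlatOrbifold

/-! ### The lattice, the flat torus `ℂ² / Λ`, the dihedral group and the quotient orbifold -/

/-- The primitive fifth root of unity `ζ = exp (2πi/5)`. -/
def zeta : ℂ := Complex.exp (2 * Real.pi * Complex.I / 5)

theorem zeta_pow_five : zeta ^ 5 = 1 := by
  rw [zeta, ← Complex.exp_nat_mul, Complex.exp_eq_one_iff]
  exact ⟨1, by push_cast; ring⟩

theorem zeta_ne_zero : zeta ≠ 0 := Complex.exp_ne_zero _

theorem zeta_sum : 1 + zeta + zeta ^ 2 + zeta ^ 3 + zeta ^ 4 = 0 := by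
  have h : IsPrimitiveRoot zeta 5 := by
    have := Complex.isPrimitiveRoot_exp 5 (by norm_num)
    simpa [zeta] using this
  have := h.geom_sum_eq_zero (by norm_num)
  simpa [Finset.sum_range_succ] using this

theorem conj_zeta : conj zeta = zeta ^ 4 := by
  have h1 : conj zeta * zeta = 1 := by
    rw [mul_comm, Complex.mul_conj, Complex.normSq_eq_norm_sq]
    have : ‖zeta‖ = 1 := by
      rw [zeta, show (2 * Real.pi * Complex.I / 5 : ℂ) = ((2 * Real.pi / 5 : ℝ) : ℂ) * Complex.I by
        push_cast; ring]
      exact Complex.norm_exp_ofReal_mul_I _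
    simp [this]
  have h2 := zeta_pow_five
  exact mul_right_cancel₀ zeta_ne_zero (by rw [h1, ← h2]; ring)

/-- The lattice `Λ ⊂ ℂ²` generated by `(1,1), (ζ,ζ²), (ζ²,ζ⁴), (ζ³,ζ)`. -/
def lattice : AddSubgroup (ℂ × ℂ) :=
  AddSubgroup.closure
    {(1, 1), (zeta, zeta ^ 2), (zeta ^ 2, zeta ^ 4), (zeta ^ 3, zeta)}

/-- The isometry `r (z, w) = (ζ z, ζ² w)` of `ℂ²`. -/
def rot : (ℂ × ℂ) ≃+ (ℂ × ℂ) where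
  toFun p := (zeta * p.1, zeta ^ 2 * p.2)
  invFun p := (zeta ^ 4 * p.1, zeta ^ 3 * p.2)
  left_inv p := by
    ext1
    · linear_combination p.1 * zeta_pow_five
    · linear_combination p.2 * zeta_pow_five
  right_inv p := by
    ext1
    · linear_combination p.1 * zeta_pow_five
    · linear_combination p.2 * zeta_pow_five
  map_add' p q := by
    ext1
    · simp [mul_add]
    · simp [mul_add]

/-- The isometry `s (z, w) = (-z̄, -w̄)` of `ℂ²`. -/
def refl : (ℂ × ℂ) ≃+ (ℂ × ℂ) where
  toFun p := (-conj p.1, -conj p.2)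
  invFun p := (-conj p.1, -conj p.2)
  left_inv p := by simp
  right_inv p := by simp
  map_add' p q := by
    ext1
    · simp [add_comm]
    · simp [add_comm]

theorem lattice_mem_pow (k : ℕ) (hk : k < 5) : (zeta ^ k, zeta ^ (2 * k)) ∈ lattice := by
  have h5 := zeta_pow_five
  have hs := zeta_sum
  have e0 : ((1, 1) : ℂ × ℂ) ∈ lattice := AddSubgroup.subset_closure (by simp)
  have e1 : (zeta, zeta ^ 2) ∈ lattice := AddSubgroup.subset_closure (by simp)
  have e2 : (zeta ^ 2, zeta ^ 4) ∈ lattice := AddSubgroup.subset_closure (by simp)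
  have e3 : (zeta ^ 3, zeta) ∈ lattice := AddSubgroup.subset_closure (by simp)
  interval_cases k
  · simpa using e0
  · simpa using e1
  · simpa using e2
  · convert e3 using 2
    linear_combination zeta * h5
  · convert lattice.neg_mem (lattice.add_mem (lattice.add_mem e0 e1) (lattice.add_mem e2 e3)) using 1
    ext1
    · simp only [Prod.fst_neg, Prod.fst_add]
      linear_combination hs
    · simp only [Prod.snd_neg, Prod.snd_add]
      linear_combination hs + zeta ^ 3 * h5

/-- An additive automorphism of `ℂ²` that maps the generators into `Λ` maps `Λ` into itself. -/
theorem map_lattice_le (e : (ℂ × ℂ) ≃+ (ℂ × ℂ))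
    (he : ∀ k : ℕ, k < 5 → e (zeta ^ k, zeta ^ (2 * k)) ∈ lattice) :
    lattice.map (e : (ℂ × ℂ) →+ (ℂ × ℂ)) ≤ lattice := by
  have h5 := zeta_pow_five
  rw [AddSubgroup.map_le_iff_le_comap]
  conv_lhs => rw [lattice]
  rw [AddSubgroup.closure_le]
  rintro p (rfl | rfl | rfl | rfl)
  · simpa using he 0 (by norm_num)
  · simpa using he 1 (by norm_num)
  · simpa using he 2 (by norm_num)
  · have := he 3 (by norm_num)
    rwa [show zeta ^ (2 * 3) = zeta by linear_combination zeta * h5] at this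

theorem rot_map_lattice : lattice.map (rot : (ℂ × ℂ) →+ (ℂ × ℂ)) = lattice := by
  have h5 := zeta_pow_five
  apply le_antisymm
  · refine map_lattice_le rot fun k hk => ?_
    rcases Nat.lt_or_ge k 4 with h | h
    · convert lattice_mem_pow (k + 1) (by omega) using 1
      ext1
      · simp only [rot, AddEquiv.coe_mk, Equiv.coe_fn_mk]; ring
      · simp only [rot, AddEquiv.coe_mk, Equiv.coe_fn_mk]; ring
    · obtain rfl : k = 4 := by omega
      convert lattice_mem_pow 0 (by omega) using 1
      ext1
      · simp only [rot, AddEquiv.coe_mk, Equiv.coe_fn_mk]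
        linear_combination h5
      · simp only [rot, AddEquiv.coe_mk, Equiv.coe_fn_mk]
        linear_combination (zeta ^ 5 + 1) * h5
  · have h : lattice.map (rot.symm : (ℂ × ℂ) →+ (ℂ × ℂ)) ≤ lattice := by
      refine map_lattice_le rot.symm fun k hk => ?_
      rcases Nat.eq_zero_or_pos k with rfl | h
      · convert lattice_mem_pow 4 (by omega) using 1
        ext1
        · simp [rot]
        · simp only [rot, AddEquiv.symm_mk, AddEquiv.coe_mk, Equiv.coe_fn_symm_mk]
          linear_combination -zeta ^ 3 * h5
      · obtain ⟨j, rfl⟩ : ∃ j, k = j + 1 := ⟨k - 1, by omega⟩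
        convert lattice_mem_pow j (by omega) using 1
        ext1
        · simp only [rot, AddEquiv.symm_mk, AddEquiv.coe_mk, Equiv.coe_fn_symm_mk]
          linear_combination zeta ^ j * h5
        · simp only [rot, AddEquiv.symm_mk, AddEquiv.coe_mk, Equiv.coe_fn_symm_mk]
          linear_combination zeta ^ (2 * j) * h5
    intro p hp
    exact ⟨rot.symm p, h ⟨p, hp, rfl⟩, by simp⟩

theorem refl_map_lattice : lattice.map (refl : (ℂ × ℂ) →+ (ℂ × ℂ)) = lattice := by
  have h5 := zeta_pow_five
  have h : lattice.map (refl : (ℂ × ℂ) →+ (ℂ × ℂ)) ≤ lattice := by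
    refine map_lattice_le refl fun k hk => ?_
    have hc : refl (zeta ^ k, zeta ^ (2 * k)) = -(zeta ^ (4 * k), zeta ^ (4 * (2 * k))) := by
      ext1
      · simp [refl, conj_zeta, pow_mul]
      · simp [refl, conj_zeta, pow_mul]
    rw [hc]
    apply lattice.neg_mem
    rcases Nat.eq_zero_or_pos k with rfl | h
    · simpa using lattice_mem_pow 0 (by omega)
    · convert lattice_mem_pow (5 - k) (by omega) using 2
      · interval_cases k
        · rfl
        · norm_num; linear_combination zeta ^ 3 * h5
        · norm_num; linear_combination (zeta ^ 7 + zeta ^ 2) * h5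
        · norm_num; linear_combination (zeta ^ 11 + zeta ^ 6 + zeta) * h5
      · interval_cases k
        · rfl
        · norm_num; linear_combination (zeta ^ 11 + zeta ^ 6) * h5
        · norm_num; linear_combination (zeta ^ 19 + zeta ^ 14 + zeta ^ 9 + zeta ^ 4) * h5
        · norm_num
          linear_combination
            (zeta ^ 27 + zeta ^ 22 + zeta ^ 17 + zeta ^ 12 + zeta ^ 7 + zeta ^ 2) * h5
  refine le_antisymm h fun p hp => ⟨refl p, h ⟨p, hp, rfl⟩, ?_⟩
  simp [refl]

/-- The torus `𝖳 = ℂ² / Λ`. -/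
abbrev Torus4 : Type := (ℂ × ℂ) ⧸ lattice

/-- The isometry of `𝖳` induced by `r`. -/
def rotT : Equiv.Perm Torus4 :=
  (QuotientAddGroup.congr lattice lattice rot rot_map_lattice).toEquiv

/-- The isometry of `𝖳` induced by `s`. -/
def reflT : Equiv.Perm Torus4 :=
  (QuotientAddGroup.congr lattice lattice refl refl_map_lattice).toEquiv

/-- The dihedral group `D₁₀` of isometries of `𝖳` generated by `r` and `s`. -/
def D10 : Subgroup (Equiv.Perm Torus4) := Subgroup.closure {rotT, reflT}

/-- The underlying space of the orbifold `𝖮 = 𝖳 / D₁₀`, with the quotient topology. -/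
abbrev Orb : Type := MulAction.orbitRel.Quotient D10 Torus4

/-- The projection `𝖳 → 𝖮`. -/
def torusProj (p : Torus4) : Orb := Quotient.mk _ p

/-- The projection `ℂ² → 𝖮`. -/
def proj (v : ℂ × ℂ) : Orb := torusProj (QuotientAddGroup.mk v)

/-- The singular set of the orbifold `𝖮`: the points with nontrivial isotropy group. -/
def singularSet : Set Orb :=
  {x | ∃ p : Torus4, torusProj p = x ∧ MulAction.stabilizer D10 p ≠ ⊥}

/-- The image in `𝖮` of the Lagrangian torus `(iℝ)² / (Λ ∩ (iℝ)²)`. -/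
def lagrangianTorus : Set Orb := proj '' {v | v.1.re = 0 ∧ v.2.re = 0}

/-- The points `P₁, …, P₅` of `𝖮` (indexed by `0, …, 4`): the images of
`(t/5) (4 + 3ζ + 2ζ² + ζ³, 4 + 3ζ² + 2ζ⁴ + ζ)`. -/
def conePoint (t : Fin 5) : Orb :=
  proj ((t : ℂ) / 5 * (4 + 3 * zeta + 2 * zeta ^ 2 + zeta ^ 3),
    (t : ℂ) / 5 * (4 + 3 * zeta ^ 2 + 2 * zeta ^ 4 + zeta))

/-! ### Piecewise-linear maps -/

/-- `f` is piecewise linear on `X`: every point of `X` has a neighbourhood in `X` which is a finite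
union of compact convex polytopes contained in `X`, on each of which `f` is affine.
(In particular `X` is a polyhedron and `f` is continuous on `X`.) -/
def IsPLOn {E F : Type*} [AddCommGroup E] [Module ℝ E] [TopologicalSpace E]
    [AddCommGroup F] [Module ℝ F] (f : E → F) (X : Set E) : Prop :=
  ∀ x ∈ X, ∃ 𝒞 : Finset (Finset E),
    (∀ s ∈ 𝒞, convexHull ℝ (s : Set E) ⊆ X ∧
      ∃ A : E →ᵃ[ℝ] F, Set.EqOn f A (convexHull ℝ (s : Set E))) ∧
    (⋃ s ∈ 𝒞, convexHull ℝ (s : Set E)) ∈ 𝓝[X] x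

/-- A map `f` on an open subset `U` of `𝖮` is piecewise linear for the PL structure that `𝖮`
inherits from `ℂ² = ℝ⁴` (on which the group generated by `Λ`, `r`, `s` acts by affine maps) if it
lifts to a piecewise-linear map on the preimage of `U` in `ℂ²`. -/
def IsPLOnOrb {F : Type*} [AddCommGroup F] [Module ℝ F] (f : Orb → F) (U : Set Orb) : Prop :=
  IsPLOn (fun v => f (proj v)) (proj ⁻¹' U)

/-- The standard PL 4-sphere: the boundary of the standard 5-simplex in `ℝ⁶`. -/
def plSphere4 : Set (Fin 6 → ℝ) := {x | x ∈ stdSimplex ℝ (Fin 6) ∧ ∃ i, x i = 0}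

/-! ### Local models -/

/-- Near `x` the pair `(𝖮, S)` is homeomorphic to the pair `(ℝ⁴, C)` near `0`. -/
def IsLocallyModelledOn (S : Set Orb) (x : Orb) (C : Set (Fin 4 → ℝ)) : Prop :=
  ∃ e : OpenPartialHomeomorph Orb (Fin 4 → ℝ),
    x ∈ e.source ∧ e x = 0 ∧ ∀ y ∈ e.source, y ∈ S ↔ e y ∈ C

/-- Near `x` the pair `(𝖮, S)` is PL-homeomorphic to the pair `(ℝ⁴, C)` near `0`. -/
def IsPLLocallyModelledOn (S : Set Orb) (x : Orb) (C : Set (Fin 4 → ℝ)) : Prop :=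
  ∃ e : OpenPartialHomeomorph Orb (Fin 4 → ℝ), IsPLOnOrb e e.source ∧
    x ∈ e.source ∧ e x = 0 ∧ ∀ y ∈ e.source, y ∈ S ↔ e y ∈ C

/-- The coordinate plane `ℝ² × {0}` in `ℝ⁴`. -/
def coordPlane : Set (Fin 4 → ℝ) := {v | v 2 = 0 ∧ v 3 = 0}

/-- The vertices of a closed heptagon in `ℝ³`. -/
def figureEightVertex : Fin 7 → (Fin 3 → ℝ) :=
  ![![-1, -2, 0], ![-1, 1, -1], ![1, 1, 1], ![2, 2, -1], ![-2, 1, 0], ![3, -1, 0], ![2, 3, 1]]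

/-- The figure-eight knot, as a closed heptagon in `ℝ³`. Its projection to the first two
coordinates (with the third one as height) is the standard alternating diagram with four crossings
`a = (-1, 3/5)`, `b = (4/5, 1)`, `c = (22/17, 31/17)`, `d = (8/31, 3/31)`. Starting at the first
vertex, one goes under `a`, over `b`, under `c`, over `a`, under `d`, over `c`, under `b`,
over `d`. (Indices are modulo `7`.) -/
def figureEight : Set (Fin 3 → ℝ) :=
  ⋃ i : Fin 7, segment ℝ (figureEightVertex i) (figureEightVertex (i + 1))

/-- The cone with apex `0` in `ℝ⁴ = ℝ³ × ℝ` over `K × {1}`, for `K ⊆ ℝ³`. If `K` is a polygonal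
knot then `K × {1}` is a knot of the same type in the boundary of a box `[-N, N]³ × [-1, 1]`
with `N` large, a PL 3-sphere around `0`. -/
def coneOver (K : Set (Fin 3 → ℝ)) : Set (Fin 4 → ℝ) :=
  {v | ∃ t : ℝ, 0 ≤ t ∧ ∃ p ∈ K, v = ![t * p 0, t * p 1, t * p 2, t]}

end FlatOrbifold

end

/-! Coordinates. Let `x` be the mean-zero function on `ℤ/5` whose discrete Fourier transform has
coefficients `(z, w)`, and let `d k = x (k + 1) - x k`. This identifies `ℂ²` with the sum-zero
vectors of `ℝ⁵` (`confMap`, `confInv`). There `Λ` is the set of integral sum-zero vectors, the root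
lattice of type `A₄` (`mem_lattice_iff`), while `r` and `s` permute the entries as symmetries of a
pentagon. So a point of the torus is a configuration of five labelled points on `ℝ/ℤ` with sum zero,
and `proj` forgets the labelling up to pentagon symmetry (`proj_eq_iff_dihEquiv`).

Triangulation. The alcoves of the affine Weyl group of `A₄` cut the torus into 120 four-simplices,
one for each labelling of `e 0 ≤ ... ≤ e 4 ≤ e 0 + 1`; the barycentric coordinates in an alcove are
the five gaps. Twelve alcoves remain modulo the dihedral group. Their faces are glued according to
which points coincide, and the barycentric subdivision of the result is a simplicial complex
`orbFacets` with 92 vertices. Barycentric coordinates `orbCoord` embed the orbifold piecewise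
linearly onto the realization of this complex (`range_orbCoord`, `orbCoord_injective`,
`plNear_orbCoord`), and the singular set becomes a full subcomplex
(`proj_mem_singularSet_iff_coord`).

Sphere. A generalized bistellar flip is an explicit PL homeomorphism `flipMap` between realizations.
A checked list of flips carries `orbFacets` to the boundary of a 5-simplex (`transforms_orbFlips`).

Singular set. A configuration with nontrivial isotropy is, after a relabelling, symmetric under one
fixed reflection, hence has the form `(a, b, -2a-2b, b, a)`; the pair `(a, b)` modulo `ℤ` is a
homeomorphism with the torus. Isotropy containing a rotation makes all five points coincide, which
happens only at the cone points. Elsewhere the isotropy is a single reflection, acting as `-1` on a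
plane, and an explicit PL quotient map of that plane (`foldMap`) gives local flatness.

Knot. The link of the vertex `0` is a triangulated 3-sphere containing the singular set as a closed
edge path. Flips reduce this pair to a small one (`transforms_linkFlips`, `transforms_linkKnot`). A
simplicial fan in `ℝ⁴` whose two-dimensional cones include the cone over the heptagon reduces to the
same small pair (`transforms_sphereFlips`, `transforms_fanKnot`). The composite is a chart at the
first cone point; translations by fixed points of the dihedral group move it to the others.

Non-flatness. If the pair were flat at a cone point, a punctured neighbourhood in the regular part
would be the image of a convex set with commuting deck transformations. Its lift to the torus has a
commutative setwise stabilizer in `D10` (`exists_lift_range`). But a small invariant neighbourhood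
minus finitely many planes is connected and regular, so that stabilizer would be all of `D10`, which
is not commutative (`false_of_isPreconnected`). -/

namespace FlatOrbifold

/-! ### Polyhedra and polytopes -/

section PL

variable {E F G : Type*} [AddCommGroup E] [Module ℝ E] [AddCommGroup F] [Module ℝ F]
  [AddCommGroup G] [Module ℝ G]

/-- A finite intersection of closed half-spaces. -/
def IsPolyhedron (P : Set E) : Prop :=
  ∃ S : Set (E →ᵃ[ℝ] ℝ), S.Finite ∧ P = {x | ∀ l ∈ S, 0 ≤ l x}

theorem isPolyhedron_halfspace (l : E →ᵃ[ℝ] ℝ) : IsPolyhedron {x | 0 ≤ l x} :=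
  ⟨{l}, Set.finite_singleton l, by simp⟩

theorem IsPolyhedron.univ : IsPolyhedron (Set.univ : Set E) :=
  ⟨∅, Set.finite_empty, by simp⟩

theorem IsPolyhedron.inter {P Q : Set E} (hP : IsPolyhedron P) (hQ : IsPolyhedron Q) :
    IsPolyhedron (P ∩ Q) := by
  obtain ⟨S, hS, rfl⟩ := hP
  obtain ⟨T, hT, rfl⟩ := hQ
  refine ⟨S ∪ T, hS.union hT, ?_⟩
  ext x
  constructor
  · rintro ⟨h1, h2⟩ l (h | h)
    · exact h1 l h
    · exact h2 l h
  · exact fun h => ⟨fun l hl => h l (Or.inl hl), fun l hl => h l (Or.inr hl)⟩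

theorem IsPolyhedron.iInter {ι : Type*} [Finite ι] {P : ι → Set E}
    (h : ∀ i, IsPolyhedron (P i)) : IsPolyhedron (⋂ i, P i) := by
  choose S hS hP using h
  refine ⟨⋃ i, S i, Set.finite_iUnion hS, ?_⟩
  ext x
  simp only [hP, Set.mem_iInter, Set.mem_ofPred_eq, Set.mem_iUnion]
  exact ⟨fun h l ⟨i, hi⟩ => h i l hi, fun h i l hl => h l ⟨i, hl⟩⟩

theorem IsPolyhedron.preimage {P : Set F} (hP : IsPolyhedron P) (A : E →ᵃ[ℝ] F) :
    IsPolyhedron (A ⁻¹' P) := by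
  obtain ⟨S, hS, rfl⟩ := hP
  refine ⟨(fun l => l.comp A) '' S, hS.image _, ?_⟩
  ext x
  simp

theorem isPolyhedron_le (l m : E →ᵃ[ℝ] ℝ) : IsPolyhedron {x | l x ≤ m x} := by
  convert isPolyhedron_halfspace (m - l) using 2
  simp

/-- The point `c` is where the segment from `y` to `z` meets the hyperplane `l = 0`. Central
projection from `y` sends segments to segments, so the `z` projecting into a convex set form a
convex set. The relation is kept free of denominators. -/
theorem convex_projective {l : E →ᵃ[ℝ] ℝ} {C : Set E} (hC : Convex ℝ C) (y : E) (hy : 0 ≤ l y) :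
    Convex ℝ {z | l z < 0 ∧ ∃ c ∈ C, (l y - l z) • c = l y • z - l z • y} := by
  rintro z ⟨hz, c, hc, h⟩ z' ⟨hz', c', hc', h'⟩ a b ha hb hab
  have hl : l (a • z + b • z') = a * l z + b * l z' := by
    rw [Convex.combo_affine_apply hab]; simp
  have hneg : a * l z + b * l z' < 0 := by
    rcases ha.eq_or_lt with rfl | ha
    · obtain rfl : b = 1 := by linarith
      linarith
    · nlinarith
  refine ⟨by rw [hl]; exact hneg, ?_⟩
  set D := l y - (a * l z + b * l z') with hD
  have hD0 : 0 < D := by linarith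
  refine ⟨(a * (l y - l z) / D) • c + (b * (l y - l z') / D) • c', ?_, ?_⟩
  · refine hC hc hc' (div_nonneg (mul_nonneg ha (by linarith)) hD0.le)
      (div_nonneg (mul_nonneg hb (by linarith)) hD0.le) ?_
    rw [← add_div, div_eq_one_iff_eq hD0.ne', hD]
    linear_combination l y * hab
  · rw [hl, ← hD, smul_add, smul_smul, smul_smul, mul_div_cancel₀ _ hD0.ne',
      mul_div_cancel₀ _ hD0.ne', mul_smul, mul_smul, h, h']
    match_scalars <;> ring_nf

/-- The new vertices are the old ones on the nonnegative side, together with the crossing points of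
segments joining the two sides. -/
theorem exists_convexHull_inter_halfspace {s : Set E} (hs : s.Finite) (l : E →ᵃ[ℝ] ℝ) :
    ∃ t : Set E, t.Finite ∧ convexHull ℝ s ∩ {x | 0 ≤ l x} = convexHull ℝ t := by
  set p := {x ∈ s | 0 ≤ l x} with hp
  set n := {x ∈ s | l x < 0} with hn
  have hpf : p.Finite := hs.subset (Set.sep_subset _ _)
  have hnf : n.Finite := hs.subset (Set.sep_subset _ _)
  set q : E → E → E := fun y z => (l y - l z)⁻¹ • (l y • z - l z • y) with hq
  set t := p ∪ Set.image2 q p n with ht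
  have hlconv : Convex ℝ {x | 0 ≤ l x} := by
    have := (convex_Ici (𝕜 := ℝ) (0 : ℝ)).affine_preimage l
    exact this
  refine ⟨t, hpf.union (hpf.image2 _ hnf), Set.Subset.antisymm ?_ ?_⟩
  · have hsu : s = p ∪ n := by
      ext x
      simp only [hp, hn, Set.mem_union, Set.mem_ofPred_eq, ← and_or_left]
      exact ⟨fun h => ⟨h, le_or_gt 0 (l x)⟩, fun h => h.1⟩
    rintro x ⟨hx, hlx⟩
    change 0 ≤ l x at hlx
    rcases Set.eq_empty_or_nonempty p with hpe | hpne
    · exfalso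
      have hneg : Convex ℝ {x | l x < 0} := (convex_Iio (𝕜 := ℝ) (0 : ℝ)).affine_preimage l
      have : x ∈ {x | l x < 0} := convexHull_min (fun y hy => by
        rw [hsu, hpe, Set.empty_union] at hy; exact hy.2) hneg hx
      exact absurd this (not_lt.2 hlx)
    rcases Set.eq_empty_or_nonempty n with hne | hnne
    · rw [hsu, hne, Set.union_empty] at hx
      exact convexHull_mono Set.subset_union_left hx
    rw [hsu, convexHull_union hpne hnne, mem_convexJoin] at hx
    obtain ⟨y, hy, z, hz, a, b, ha, hb, hab, rfl⟩ := hx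
    have hC : Convex ℝ (convexHull ℝ t) := convex_convexHull ℝ t
    have hyC : y ∈ convexHull ℝ t := convexHull_mono Set.subset_union_left hy
    have hly : 0 ≤ l y := convexHull_min (fun y hy => And.right hy) hlconv hy
    have hneg : Convex ℝ {x | l x < 0} := (convex_Iio (𝕜 := ℝ) (0 : ℝ)).affine_preimage l
    have hlz : l z < 0 := convexHull_min (fun y hy => And.right hy) hneg hz
    -- One endpoint at a time: the nonnegative endpoint is a vertex, while the negative one ranges
    -- over the hull of `n`.
    have key : ∀ y' ∈ p, ∃ c ∈ convexHull ℝ t, (l y' - l z) • c = l y' • z - l z • y' := by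
      intro y' hy'
      have : z ∈ {z | l z < 0 ∧ ∃ c ∈ convexHull ℝ t, (l y' - l z) • c = l y' • z - l z • y'} := by
        refine convexHull_min ?_ (convex_projective hC y' hy'.2) hz
        intro z' hz'
        refine ⟨hz'.2, q y' z', subset_convexHull ℝ _ (Or.inr ⟨y', hy', z', hz', rfl⟩), ?_⟩
        rw [hq, smul_smul, mul_inv_cancel₀, one_smul]
        have := hz'.2; have := hy'.2; linarith
      exact this.2
    -- Next the nonnegative endpoint ranges over the hull of `p`; this is the same projective
    -- convexity with the roles exchanged.
    have key2 : ∃ c ∈ convexHull ℝ t, (l y - l z) • c = l y • z - l z • y := by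
      have hconv : Convex ℝ {y | 0 ≤ l y ∧
          ∃ c ∈ convexHull ℝ t, (l y - l z) • c = l y • z - l z • y} := by
        rintro u ⟨hu, c, hc, h⟩ u' ⟨hu', c', hc', h'⟩ α β hα hβ hαβ
        have hl : l (α • u + β • u') = α * l u + β * l u' := by
          rw [Convex.combo_affine_apply hαβ]; simp
        refine ⟨by rw [hl]; positivity, ?_⟩
        set D := α * l u + β * l u' - l z with hD
        have hD0 : 0 < D := by
          have : 0 ≤ α * l u + β * l u' := by positivity
          linarith
        refine ⟨(α * (l u - l z) / D) • c + (β * (l u' - l z) / D) • c', ?_, ?_⟩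
        · refine hC hc hc' (div_nonneg (mul_nonneg hα (by linarith)) hD0.le)
            (div_nonneg (mul_nonneg hβ (by linarith)) hD0.le) ?_
          rw [← add_div, div_eq_one_iff_eq hD0.ne', hD]
          linear_combination -l z * hαβ
        · rw [hl, ← hD, smul_add, smul_smul, smul_smul, mul_div_cancel₀ _ hD0.ne',
            mul_div_cancel₀ _ hD0.ne', mul_smul, mul_smul, h, h']
          match_scalars <;> ring_nf
      have : y ∈ {y | 0 ≤ l y ∧ ∃ c ∈ convexHull ℝ t, (l y - l z) • c = l y • z - l z • y} :=
        convexHull_min (fun (y' : E) (hy' : y' ∈ p) =>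
          (⟨hy'.2, key y' hy'⟩ : 0 ≤ l y' ∧ _)) hconv hy
      exact this.2
    obtain ⟨c, hc, h⟩ := key2
    rw [Convex.combo_affine_apply hab] at hlx
    simp only [smul_eq_mul] at hlx
    -- If `y` lies on the hyperplane then `0 ≤ b * l z` with `l z < 0` leaves only `b = 0`.
    -- Otherwise the point lies on the segment from `y` to the crossing point `c`.
    rcases hly.eq_or_lt with hly0 | hly0
    · have hb0 : b = 0 := by
        rw [← hly0] at hlx
        by_contra hb0
        have : 0 < b := lt_of_le_of_ne hb (Ne.symm hb0)
        nlinarith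
      obtain rfl : a = 1 := by linarith
      simpa [hb0] using hyC
    have hc' : l y • z = (l y - l z) • c + l z • y := by rw [h]; abel
    have hz' : z = ((l y)⁻¹ * (l y - l z)) • c + ((l y)⁻¹ * l z) • y := by
      rw [mul_smul, mul_smul, ← smul_add, ← hc', smul_smul, inv_mul_cancel₀ hly0.ne', one_smul]
    have hx : a • y + b • z = (a + b * ((l y)⁻¹ * l z)) • y
        + (b * ((l y)⁻¹ * (l y - l z))) • c := by
      conv_lhs => rw [hz']
      match_scalars <;> ring
    rw [hx]
    refine hC hyC hc ?_ ?_ ?_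
    · have : a + b * ((l y)⁻¹ * l z) = (l y)⁻¹ * (a * l y + b * l z) := by field_simp
      rw [this]; positivity
    · have : 0 ≤ l y - l z := by linarith
      positivity
    · field_simp
      linear_combination l y * hab
  · refine convexHull_min ?_ ((convex_convexHull ℝ s).inter hlconv)
    rintro x (hx | ⟨y, hy, z, hz, rfl⟩)
    · exact ⟨subset_convexHull ℝ s hx.1, hx.2⟩
    · have hpos : 0 < l y - l z := by have := hy.2; have := hz.2; linarith
      have hab : -l z / (l y - l z) + l y / (l y - l z) = 1 := by field_simp; ring
      have hz2 := hz.2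
      have hy2 := hy.2
      have hqe : q y z = (-l z / (l y - l z)) • y + (l y / (l y - l z)) • z := by
        rw [hq]; match_scalars <;> field_simp
      have h1 : 0 ≤ -l z / (l y - l z) := div_nonneg (by linarith) hpos.le
      have h2 : 0 ≤ l y / (l y - l z) := div_nonneg hy2 hpos.le
      refine ⟨?_, ?_⟩
      · rw [hqe]
        exact convex_convexHull ℝ s (subset_convexHull ℝ s hy.1) (subset_convexHull ℝ s hz.1)
          h1 h2 hab
      · change 0 ≤ l (q y z)
        rw [hqe, Convex.combo_affine_apply hab, smul_eq_mul, smul_eq_mul]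
        apply le_of_eq
        field_simp; ring

theorem exists_convexHull_inter_polyhedron {s : Set E} (hs : s.Finite) {P : Set E}
    (hP : IsPolyhedron P) : ∃ t : Finset E, convexHull ℝ s ∩ P = convexHull ℝ (t : Set E) := by
  obtain ⟨S, hS, rfl⟩ := hP
  induction S, hS using Set.Finite.induction_on with
  | empty => exact ⟨hs.toFinset, by simp⟩
  | @insert l S _ _ ih =>
    obtain ⟨t, ht⟩ := ih
    obtain ⟨u, hu, h⟩ := exists_convexHull_inter_halfspace t.finite_toSet l
    refine ⟨hu.toFinset, ?_⟩
    rw [Set.Finite.coe_toFinset, ← h, ← ht]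
    ext x
    simp only [Set.mem_insert_iff, forall_eq_or_imp, Set.mem_inter_iff, Set.mem_ofPred_eq]
    tauto

/-! ### Piecewise linear maps via finite covers by polyhedra -/

/-- `f` is affine on each member of a finite family of polyhedra covering `E`. -/
def IsPL (f : E → F) : Prop :=
  ∃ C : Set (Set E × (E →ᵃ[ℝ] F)), C.Finite ∧
    (∀ c ∈ C, IsPolyhedron c.1 ∧ Set.EqOn f c.2 c.1) ∧ ∀ x, ∃ c ∈ C, x ∈ c.1

/-- `f` is affine on each member of a finite family of polyhedra covering a neighbourhood
of `x`. -/
def PLNear [TopologicalSpace E] (f : E → F) (x : E) : Prop :=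
  ∃ C : Set (Set E × (E →ᵃ[ℝ] F)), C.Finite ∧
    (∀ c ∈ C, IsPolyhedron c.1 ∧ Set.EqOn f c.2 c.1) ∧ ∀ᶠ y in 𝓝 x, ∃ c ∈ C, y ∈ c.1

theorem isPL_affine (A : E →ᵃ[ℝ] F) : IsPL A :=
  ⟨{(Set.univ, A)}, Set.finite_singleton _, by
    rintro c rfl; exact ⟨IsPolyhedron.univ, fun _ _ => rfl⟩, fun x => ⟨_, rfl, trivial⟩⟩

theorem isPL_linear (A : E →ₗ[ℝ] F) : IsPL A := isPL_affine A.toAffineMap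

theorem IsPL.plNear [TopologicalSpace E] {f : E → F} (h : IsPL f) (x : E) : PLNear f x := by
  obtain ⟨C, hC, h1, h2⟩ := h
  exact ⟨C, hC, h1, Filter.Eventually.of_forall h2⟩

/-- The common refinement works without continuity of `f`, because the polyhedra of `g` cover all of
`F`. Hence the intermediate spaces, such as `ℕ → ℝ`, need no topology. -/
theorem IsPL.comp_plNear [TopologicalSpace E] {g : F → G} {f : E → F} {x : E}
    (hg : IsPL g) (hf : PLNear f x) : PLNear (g ∘ f) x := by
  obtain ⟨C, hC, h1, h2⟩ := hf
  obtain ⟨D, hD, h3, h4⟩ := hg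
  refine ⟨Set.image2 (fun c d => (c.1 ∩ c.2 ⁻¹' d.1, d.2.comp c.2)) C D, hC.image2 _ hD, ?_, ?_⟩
  · rintro _ ⟨c, hc, d, hd, rfl⟩
    refine ⟨(h1 c hc).1.inter ((h3 d hd).1.preimage _), ?_⟩
    rintro y ⟨hy1, hy2⟩
    simp only [Function.comp_apply, AffineMap.coe_comp]
    rw [(h1 c hc).2 hy1]
    exact (h3 d hd).2 hy2
  · filter_upwards [h2] with y hy
    obtain ⟨c, hc, hyc⟩ := hy
    obtain ⟨d, hd, hyd⟩ := h4 (f y)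
    exact ⟨_, ⟨c, hc, d, hd, rfl⟩, hyc, by rw [Set.mem_preimage, ← (h1 c hc).2 hyc]; exact hyd⟩

theorem IsPL.comp {g : F → G} {f : E → F} (hg : IsPL g) (hf : IsPL f) : IsPL (g ∘ f) := by
  -- In the indiscrete topology the only neighbourhood of a point is the whole space, so
  -- "eventually" means "everywhere".
  let _ : TopologicalSpace E := ⊤
  obtain ⟨C, hC, h1, h2⟩ := hg.comp_plNear (hf.plNear 0)
  refine ⟨C, hC, h1, fun x => ?_⟩
  rw [nhds_top, Filter.eventually_top] at h2
  exact h2 x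

theorem PLNear.comp_affineEquiv [TopologicalSpace E] [TopologicalSpace F] {f : F → G} {x : E}
    (A : E →ᵃ[ℝ] F) (hA : ContinuousAt A x) (hf : PLNear f (A x)) : PLNear (f ∘ A) x := by
  obtain ⟨C, hC, h1, h2⟩ := hf
  refine ⟨(fun c => (A ⁻¹' c.1, c.2.comp A)) '' C, hC.image _, ?_, ?_⟩
  · rintro _ ⟨c, hc, rfl⟩
    exact ⟨(h1 c hc).1.preimage A, fun y hy => (h1 c hc).2 hy⟩
  · filter_upwards [hA.eventually h2] with y hy
    obtain ⟨c, hc, hyc⟩ := hy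
    exact ⟨_, ⟨c, hc, rfl⟩, hyc⟩

end PL

section PLTop

variable {E F : Type*} [NormedAddCommGroup E] [NormedSpace ℝ E] [FiniteDimensional ℝ E]

theorem IsPolyhedron.isClosed {P : Set E} (hP : IsPolyhedron P) : IsClosed P := by
  obtain ⟨S, -, rfl⟩ := hP
  simp only [Set.ofPred_forall]
  exact isClosed_biInter fun l _ =>
    isClosed_le continuous_const (AffineMap.continuous_of_finiteDimensional l)

/-- Polyhedra are closed, so the finitely many pieces missing `x` can be ignored nearby; on each
remaining piece `f` is an affine map with the correct value at `x`. -/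
theorem PLNear.continuousAt [AddCommGroup F] [Module ℝ F] [TopologicalSpace F]
    [IsTopologicalAddGroup F] [ContinuousSMul ℝ F] {f : E → F} {x : E} (hf : PLNear f x) :
    ContinuousAt f x := by
  obtain ⟨C, hC, h1, h2⟩ := hf
  intro U hU
  have : ∀ c ∈ C, ∀ᶠ y in 𝓝 x, y ∈ c.1 → f y ∈ U := by
    intro c hc
    by_cases hx : x ∈ c.1
    · have hcont : Continuous c.2 := by
        rw [← AffineMap.continuous_linear_iff]
        exact LinearMap.continuous_of_finiteDimensional _
      have hU' : U ∈ 𝓝 (c.2 x) := by rwa [← (h1 c hc).2 hx]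
      filter_upwards [hcont.continuousAt hU'] with y hy hyc
      rw [(h1 c hc).2 hyc]
      exact hy
    · filter_upwards [(h1 c hc).1.isClosed.isOpen_compl.mem_nhds hx] with y hy hyc
      exact absurd hyc hy
  rw [← Filter.eventually_all_finite hC] at this
  change ∀ᶠ y in 𝓝 x, f y ∈ U
  filter_upwards [this, h2] with y hy1 ⟨c, hc, hyc⟩
  exact hy1 c hc hyc

theorem isPLOn_of_plNear [AddCommGroup F] [Module ℝ F] {f : E → F} {X : Set E} (hX : IsOpen X)
    (hf : ∀ x ∈ X, PLNear f x) : IsPLOn f X := by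
  classical
  intro x hx
  obtain ⟨C, hC, h1, h2⟩ := hf x hx
  -- A small simplex around `x` inside `X` cuts the unbounded polyhedra down to polytopes.
  obtain ⟨b, hb, hbX⟩ := exists_mem_interior_convexHull_affineBasis (hX.mem_nhds hx)
  have hfin : (Set.range b).Finite := Set.finite_range b
  choose! t ht using fun (c : Set E × (E →ᵃ[ℝ] F)) (hc : c ∈ C) =>
    exists_convexHull_inter_polyhedron hfin (h1 c hc).1
  refine ⟨hC.toFinset.image t, ?_, ?_⟩
  · intro s hs
    simp only [Finset.mem_image, Set.Finite.mem_toFinset] at hs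
    obtain ⟨c, hc, rfl⟩ := hs
    rw [← ht c hc]
    exact ⟨Set.inter_subset_left.trans hbX, c.2, fun y hy => (h1 c hc).2 hy.2⟩
  · apply mem_nhdsWithin_of_mem_nhds
    filter_upwards [h2, mem_interior_iff_mem_nhds.1 hb] with y ⟨c, hc, hyc⟩ hyb
    refine Set.mem_iUnion₂.2 ⟨t c, ?_, ?_⟩
    · exact Finset.mem_image_of_mem _ (hC.mem_toFinset.2 hc)
    · exact (ht c hc).le ⟨hyb, hyc⟩

end PLTop

/-! ### Cones over simplicial complexes and flips

The faces of a simplicial complex with vertices in `ℕ` are encoded by the binary digits of natural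
numbers. -/

/-- The cone over the geometric realization of the complex with the given facets. -/
def simplicialCone (K : List ℕ) : Set (ℕ → ℝ) :=
  {x | (∀ i, 0 ≤ x i) ∧ ∃ f ∈ K, ∀ i, x i ≠ 0 → f.testBit i = true}

/-- The vector with the given weights at the given indices. -/
def wvec (s : List (ℕ × ℕ)) : ℕ → ℝ :=
  (s.map fun p => Pi.single p.1 (p.2 : ℝ)).sum

/-- The largest `m` such that `m • wvec s` can be subtracted from a nonnegative vector. -/
noncomputable def wmin : List (ℕ × ℕ) → (ℕ → ℝ) → ℝ
  | [], _ => 0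
  | [p], x => x p.1 / p.2
  | p :: q :: l, x => min (x p.1 / p.2) (wmin (q :: l) x)

/-- The piecewise linear map which exchanges the join of the simplex `s` and the boundary of `t`
with the join of the boundary of `s` and `t`. -/
noncomputable def flipMap (s t : List (ℕ × ℕ)) (x : ℕ → ℝ) : ℕ → ℝ :=
  x + wmin s x • (wvec t - wvec s)

/-- The indices are distinct and the weights positive. -/
def Admissible (s t : List (ℕ × ℕ)) : Prop :=
  s ≠ [] ∧ t ≠ [] ∧ ((s ++ t).map Prod.fst).Nodup ∧ ∀ p ∈ s ++ t, 0 < p.2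

theorem Admissible.symm {s t : List (ℕ × ℕ)} (h : Admissible s t) : Admissible t s := by
  obtain ⟨h1, h2, h3, h4⟩ := h
  refine ⟨h2, h1, ?_, fun p hp => h4 p ?_⟩
  · rw [List.map_append] at h3 ⊢
    exact List.nodup_append_comm.1 h3
  · simp only [List.mem_append] at hp ⊢
    exact hp.symm

theorem wmin_le {s : List (ℕ × ℕ)} {p : ℕ × ℕ} (hp : p ∈ s) (x : ℕ → ℝ) :
    wmin s x ≤ x p.1 / p.2 := by
  induction s with
  | nil => simp at hp
  | cons q l ih =>
    cases l with
    | nil =>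
      obtain rfl : p = q := by simpa using hp
      exact le_rfl
    | cons r l =>
      rcases List.mem_cons.1 hp with rfl | hp
      · exact min_le_left _ _
      · exact (min_le_right _ _).trans (ih hp)

theorem exists_wmin {s : List (ℕ × ℕ)} (hs : s ≠ []) (x : ℕ → ℝ) :
    ∃ p ∈ s, wmin s x = x p.1 / p.2 := by
  induction s with
  | nil => simp at hs
  | cons q l ih =>
    cases l with
    | nil => exact ⟨q, by simp, rfl⟩
    | cons r l =>
      obtain ⟨p, hp, h⟩ := ih (by simp)
      rcases min_choice (x q.1 / q.2) (wmin (r :: l) x) with h' | h'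
      · exact ⟨q, by simp, h'⟩
      · exact ⟨p, by simp [hp], h'.trans h⟩

theorem wmin_eq {s : List (ℕ × ℕ)} (hs : s ≠ []) {x : ℕ → ℝ} {c : ℝ}
    (h1 : ∃ p ∈ s, x p.1 / p.2 = c) (h2 : ∀ p ∈ s, c ≤ x p.1 / p.2) : wmin s x = c := by
  obtain ⟨p, hp, h⟩ := exists_wmin hs x
  obtain ⟨q, hq, h'⟩ := h1
  exact le_antisymm (h' ▸ wmin_le hq x) (h ▸ h2 p hp)

theorem continuous_wmin (s : List (ℕ × ℕ)) : Continuous (wmin s) := by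
  induction s with
  | nil => exact continuous_const
  | cons q l ih =>
    cases l with
    | nil => exact (continuous_apply _).div_const _
    | cons r l => exact ((continuous_apply _).div_const _).min ih

theorem continuous_flipMap (s t : List (ℕ × ℕ)) : Continuous (flipMap s t) :=
  continuous_id.add ((continuous_wmin s).smul continuous_const)

/-- The linear pieces are the regions in which a given vertex of `s` attains the minimum. -/
theorem isPL_flipMap (s t : List (ℕ × ℕ)) : IsPL (flipMap s t) := by
  -- For empty `s` the default value `wmin [] = 0` makes the flip the identity.
  rcases eq_or_ne s [] with rfl | hs
  · convert isPL_linear (LinearMap.id : (ℕ → ℝ) →ₗ[ℝ] (ℕ → ℝ)) using 1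
    funext x
    simp [flipMap, wmin]
  let l : ℕ × ℕ → (ℕ → ℝ) →ₗ[ℝ] ℝ := fun p => (p.2 : ℝ)⁻¹ • LinearMap.proj p.1
  have hl : ∀ p x, l p x = x p.1 / p.2 := fun p x => by simp [l]; ring
  have hfin : Finite {p // p ∈ s} := (List.finite_toSet s)
  refine ⟨(fun p => ({x | ∀ q ∈ s, l p x ≤ l q x},
    (LinearMap.id + (l p).smulRight (wvec t - wvec s)).toAffineMap)) '' {p | p ∈ s},
    (List.finite_toSet s).image _, ?_, ?_⟩
  · rintro _ ⟨p, hp, rfl⟩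
    refine ⟨?_, ?_⟩
    · have := IsPolyhedron.iInter (ι := {q // q ∈ s})
        (fun q => isPolyhedron_le (l p).toAffineMap (l q.1).toAffineMap)
      convert this using 1
      ext x
      simp
    · intro x hx
      have : wmin s x = l p x :=
        wmin_eq hs ⟨p, hp, (hl p x).symm⟩ fun q hq => by rw [← hl q]; exact hx q hq
      simp [flipMap, this]
  · intro x
    obtain ⟨p, hp, h⟩ := exists_wmin hs x
    refine ⟨_, ⟨p, hp, rfl⟩, fun q hq => ?_⟩
    rw [hl, hl, ← h]
    exact wmin_le hq x

theorem wvec_apply_of_notMem {s : List (ℕ × ℕ)} {i : ℕ} (h : i ∉ s.map Prod.fst) :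
    wvec s i = 0 := by
  induction s with
  | nil => simp [wvec]
  | cons p l ih =>
    simp only [List.map_cons, List.mem_cons, not_or] at h
    have := ih h.2
    simp only [wvec] at this
    simp [wvec, this, h.1]

theorem wvec_apply_of_mem {s : List (ℕ × ℕ)} (hs : (s.map Prod.fst).Nodup) {p : ℕ × ℕ}
    (h : p ∈ s) : wvec s p.1 = p.2 := by
  induction s with
  | nil => simp at h
  | cons q l ih =>
    simp only [List.map_cons, List.nodup_cons] at hs
    rcases List.mem_cons.1 h with rfl | h
    · have := wvec_apply_of_notMem hs.1
      simp only [wvec] at this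
      simp [wvec, this]
    · have h1 := ih hs.2 h
      have h2 : p.1 ≠ q.1 := fun h2 => hs.1 (h2 ▸ List.mem_map_of_mem h)
      simp only [wvec] at h1
      simp [wvec, h1, h2]

section Flip

variable {s t : List (ℕ × ℕ)} (h : Admissible s t) (x : ℕ → ℝ)
include h

theorem flipMap_apply_left {p : ℕ × ℕ} (hp : p ∈ s) :
    flipMap s t x p.1 = x p.1 - wmin s x * p.2 := by
  obtain ⟨-, -, h3, -⟩ := h
  rw [List.map_append, List.nodup_append] at h3
  have h1 : p.1 ∉ t.map Prod.fst := fun h1 =>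
    h3.2.2 _ (List.mem_map_of_mem hp) _ h1 rfl
  simp only [flipMap, Pi.add_apply, Pi.smul_apply, Pi.sub_apply, wvec_apply_of_notMem h1,
    wvec_apply_of_mem h3.1 hp, smul_eq_mul]
  ring

theorem flipMap_apply_right {p : ℕ × ℕ} (hp : p ∈ t) :
    flipMap s t x p.1 = x p.1 + wmin s x * p.2 := by
  obtain ⟨-, -, h3, -⟩ := h
  rw [List.map_append, List.nodup_append] at h3
  have h1 : p.1 ∉ s.map Prod.fst := fun h1 =>
    h3.2.2 _ h1 _ (List.mem_map_of_mem hp) rfl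
  simp only [flipMap, Pi.add_apply, Pi.smul_apply, Pi.sub_apply, wvec_apply_of_notMem h1,
    wvec_apply_of_mem h3.2.1 hp, smul_eq_mul]
  ring

omit h in
theorem flipMap_apply_of_notMem {i : ℕ} (h1 : i ∉ s.map Prod.fst) (h2 : i ∉ t.map Prod.fst) :
    flipMap s t x i = x i := by
  simp [flipMap, wvec_apply_of_notMem h1, wvec_apply_of_notMem h2]

variable (hx : ∀ i, 0 ≤ x i)
include hx

omit h in
theorem wmin_nonneg : 0 ≤ wmin s x := by
  rcases eq_or_ne s [] with rfl | hs
  · exact le_rfl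
  · obtain ⟨p, -, h⟩ := exists_wmin hs x
    rw [h]
    exact div_nonneg (hx _) (Nat.cast_nonneg _)

theorem flipMap_nonneg (i : ℕ) : 0 ≤ flipMap s t x i := by
  have hm := wmin_nonneg (s := s) x hx
  by_cases h1 : i ∈ s.map Prod.fst
  · obtain ⟨p, hp, rfl⟩ := List.mem_map.1 h1
    rw [flipMap_apply_left h x hp]
    have hp2 : (0 : ℝ) < p.2 := Nat.cast_pos.2 (h.2.2.2 p (by simp [hp]))
    have := (le_div_iff₀ hp2).1 (wmin_le hp x)
    linarith
  by_cases h2 : i ∈ t.map Prod.fst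
  · obtain ⟨p, hp, rfl⟩ := List.mem_map.1 h2
    rw [flipMap_apply_right h x hp]
    have := hx p.1
    positivity
  · rw [flipMap_apply_of_notMem x h1 h2]
    exact hx i

/-- The vertex of `s` attaining the minimum is used up by the flip, so nothing more can be
subtracted. -/
theorem wmin_left_flipMap : wmin s (flipMap s t x) = 0 := by
  obtain ⟨p, hp, hm⟩ := exists_wmin h.1 x
  refine wmin_eq h.1 ⟨p, hp, ?_⟩ fun q _ =>
    div_nonneg (flipMap_nonneg h x hx _) (Nat.cast_nonneg _)
  have hp2 : (0 : ℝ) < p.2 := Nat.cast_pos.2 (h.2.2.2 p (by simp [hp]))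
  rw [flipMap_apply_left h x hp, hm]
  field_simp
  ring

theorem exists_flipMap_eq_zero : ∃ p ∈ s, flipMap s t x p.1 = 0 := by
  obtain ⟨p, hp, hm⟩ := exists_wmin h.1 (flipMap s t x)
  refine ⟨p, hp, ?_⟩
  have hp2 : (0 : ℝ) < p.2 := Nat.cast_pos.2 (h.2.2.2 p (by simp [hp]))
  rw [wmin_left_flipMap h x hx, eq_comm, div_eq_zero_iff] at hm
  exact hm.resolve_right hp2.ne'

variable (h0 : ∃ p ∈ t, x p.1 = 0)
include h0

/-- A vertex of `t` with coordinate zero makes the minimum over `t` zero before the flip, and every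
ratio over `t` grows by the same amount. The reverse flip therefore subtracts exactly what was
added. -/
theorem wmin_right_flipMap : wmin t (flipMap s t x) = wmin s x := by
  obtain ⟨p, hp, hp0⟩ := h0
  have key : ∀ q ∈ t, flipMap s t x q.1 / q.2 = x q.1 / q.2 + wmin s x := by
    intro q hq
    have hq2 : (0 : ℝ) < q.2 := Nat.cast_pos.2 (h.2.2.2 q (by simp [hq]))
    rw [flipMap_apply_right h x hq]
    field_simp
  refine wmin_eq h.2.1 ⟨p, hp, by rw [key p hp, hp0]; simp⟩ fun q hq => ?_
  rw [key q hq]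
  have : 0 ≤ x q.1 / q.2 := div_nonneg (hx _) (Nat.cast_nonneg _)
  linarith

theorem flipMap_flipMap : flipMap t s (flipMap s t x) = x := by
  have := wmin_right_flipMap h x hx h0
  rw [flipMap, this, flipMap, add_assoc, ← smul_add]
  simp

end Flip

/-! ### The combinatorial effect of a flip -/

/-- The face with the given vertices. -/
def mask (s : List (ℕ × ℕ)) : ℕ := s.foldr (fun p m => Nat.lor m (Nat.shiftLeft 1 p.1)) 0

/-- `s` is a face of `f`. -/
def isFace (s f : ℕ) : Bool := Nat.beq (Nat.land s f) s

/-- The face `f` without the vertex `i` (if `i` is a vertex of `f`). -/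
def delVertex (f i : ℕ) : ℕ := Nat.xor f (Nat.shiftLeft 1 i)

/-- Membership in a list of natural numbers. -/
def memNat (n : ℕ) (K : List ℕ) : Bool := K.any (Nat.beq n)

/-- A Boolean test for `Admissible`. -/
def admissible (s t : List (ℕ × ℕ)) : Bool :=
  !s.isEmpty && !t.isEmpty && decide ((s ++ t).map Prod.fst).Nodup &&
    (s ++ t).all fun p => Nat.blt 0 p.2

/-- The star of `s` in `K` is the join of `s`, the boundary of `t` and some complex, and `t` is not
a face of `K`. -/
def canFlip (K : List ℕ) (s t : List (ℕ × ℕ)) : Bool :=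
  (K.all fun f => !isFace (mask t) f) &&
  let S := K.filter (isFace (mask s))
  S.all fun f => t.all fun j => memNat (delVertex (Nat.lor f (mask t)) j.1) S

/-- The result of the flip. -/
def flipComplex (K : List ℕ) (s t : List (ℕ × ℕ)) : List ℕ :=
  let S := (K.filter (isFace (mask s))).filter fun f => t.head?.all fun j => !f.testBit j.1
  (S.flatMap fun f => s.map fun i => delVertex (Nat.lor f (mask t)) i.1) ++
    K.filter fun f => !isFace (mask s) f

theorem testBit_mask {s : List (ℕ × ℕ)} {i : ℕ} :
    (mask s).testBit i = true ↔ ∃ p ∈ s, p.1 = i := by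
  induction s with
  | nil => simp [mask]
  | cons p l ih =>
    have : mask (p :: l) = mask l ||| 1 <<< p.1 := rfl
    simp only [this, Nat.testBit_or, Bool.or_eq_true, ih, List.mem_cons, exists_eq_or_imp,
      Nat.one_shiftLeft, Nat.testBit_two_pow, decide_eq_true_eq]
    exact or_comm

theorem isFace_iff {s f : ℕ} :
    isFace s f = true ↔ ∀ i, s.testBit i = true → f.testBit i = true := by
  have : isFace s f = true ↔ s &&& f = s := by
    rw [isFace, Nat.beq_eq]; rfl
  rw [this]
  constructor
  · intro h i hi
    rw [← h, Nat.testBit_and, Bool.and_eq_true] at hi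
    exact hi.2
  · intro h
    apply Nat.eq_of_testBit_eq
    intro i
    rw [Nat.testBit_and]
    cases hs : s.testBit i
    · rfl
    · simp [h i hs]

theorem isFace_mask_iff {s : List (ℕ × ℕ)} {f : ℕ} :
    isFace (mask s) f = true ↔ ∀ p ∈ s, f.testBit p.1 = true := by
  rw [isFace_iff]
  constructor
  · exact fun h p hp => h _ (testBit_mask.2 ⟨p, hp, rfl⟩)
  · rintro h i hi
    obtain ⟨p, hp, rfl⟩ := testBit_mask.1 hi
    exact h p hp

theorem testBit_delVertex {f i k : ℕ} (hf : f.testBit i = true) :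
    (delVertex f i).testBit k = true ↔ f.testBit k = true ∧ k ≠ i := by
  have : delVertex f i = f ^^^ 1 <<< i := rfl
  rw [this, Nat.testBit_xor, Nat.one_shiftLeft, Nat.testBit_two_pow]
  by_cases h : i = k
  · subst h; simp [hf]
  · simp [h, Ne.symm h]

theorem testBit_lor {f g i : ℕ} :
    (Nat.lor f g).testBit i = true ↔ f.testBit i = true ∨ g.testBit i = true := by
  have : Nat.lor f g = f ||| g := rfl
  rw [this, Nat.testBit_or, Bool.or_eq_true]

theorem memNat_iff {n : ℕ} {K : List ℕ} : memNat n K = true ↔ n ∈ K := by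
  simp [memNat, List.any_eq_true, Nat.beq_eq]

theorem admissible_iff {s t : List (ℕ × ℕ)} : admissible s t = true ↔ Admissible s t := by
  simp only [admissible, Admissible, Bool.and_eq_true, decide_eq_true_eq, List.all_eq_true,
    Nat.blt_eq, Bool.not_eq_true', List.isEmpty_eq_false_iff, and_assoc]

theorem canFlip_iff {K : List ℕ} {s t : List (ℕ × ℕ)} : canFlip K s t = true ↔
    (∀ f ∈ K, ∃ p ∈ t, f.testBit p.1 = false) ∧
    ∀ f ∈ K, isFace (mask s) f = true → ∀ j ∈ t,
      delVertex (Nat.lor f (mask t)) j.1 ∈ K.filter (isFace (mask s)) := by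
  simp only [canFlip, Bool.and_eq_true, List.all_eq_true, memNat_iff, Bool.not_eq_true',
    Bool.eq_false_iff, ne_eq, isFace_mask_iff, not_forall, exists_prop, List.mem_filter, and_imp]

/-- Points in the star of `s` lose a vertex of `s` and may gain all of `t`; all other points have
`wmin s x = 0` and stay fixed. Since `t` is not a face of `K`, the reverse flip undoes the move. -/
theorem mem_simplicialCone_flip {K : List ℕ} {s t : List (ℕ × ℕ)} (ha : Admissible s t)
    (hc : canFlip K s t = true) {x : ℕ → ℝ} (hx : x ∈ simplicialCone K) :
    flipMap s t x ∈ simplicialCone (flipComplex K s t) ∧ flipMap t s (flipMap s t x) = x := by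
  obtain ⟨hx0, f, hf, hxf⟩ := hx
  obtain ⟨h1, h2⟩ := canFlip_iff.1 hc
  have h0 : ∃ p ∈ t, x p.1 = 0 := by
    obtain ⟨p, hp, hpf⟩ := h1 f hf
    refine ⟨p, hp, ?_⟩
    by_contra h
    rw [hxf _ h] at hpf
    exact absurd hpf (by simp)
  refine ⟨⟨flipMap_nonneg ha x hx0, ?_⟩, flipMap_flipMap ha x hx0 h0⟩
  by_cases hfs : isFace (mask s) f = true
  · obtain ⟨p, hp, hp0⟩ := exists_flipMap_eq_zero ha x hx0
    obtain ⟨j, t', rfl⟩ : ∃ j t', t = j :: t' := List.exists_cons_of_ne_nil ha.2.1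
    have hsf := isFace_mask_iff.1 hfs
    have hjb : (Nat.lor f (mask (j :: t'))).testBit j.1 = true :=
      testBit_lor.2 (Or.inr (testBit_mask.2 ⟨j, by simp, rfl⟩))
    have hg := h2 f hf hfs j (by simp)
    -- `flipComplex` uses only the star facets avoiding the first vertex of `t`. So `f` is replaced
    -- by such a facet `g` with the same union with `t`, which is all that matters for the new
    -- facet.
    set g := delVertex (Nat.lor f (mask (j :: t'))) j.1 with hgdef
    have hgF : ∀ i, (Nat.lor g (mask (j :: t'))).testBit i = true ↔
        (Nat.lor f (mask (j :: t'))).testBit i = true := by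
      intro i
      rw [testBit_lor, hgdef, testBit_delVertex hjb, testBit_lor]
      by_cases hi : i = j.1
      · subst hi
        have : (mask (j :: t')).testBit j.1 = true := testBit_mask.2 ⟨j, by simp, rfl⟩
        simp [this]
      · simp [hi]
    refine ⟨delVertex (Nat.lor g (mask (j :: t'))) p.1, ?_, ?_⟩
    · refine List.mem_append.2 (Or.inl (List.mem_flatMap.2 ⟨g, ?_, List.mem_map.2 ⟨p, hp, rfl⟩⟩))
      refine List.mem_filter.2 ⟨hg, ?_⟩
      simp only [List.head?_cons, Option.all_some, Bool.not_eq_true']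
      rw [Bool.eq_false_iff, ne_eq, hgdef, testBit_delVertex hjb]
      simp
    · intro i hi
      have hpb : (Nat.lor g (mask (j :: t'))).testBit p.1 = true := by
        rw [hgF, testBit_lor]; exact Or.inl (hsf p hp)
      rw [testBit_delVertex hpb, hgF, testBit_lor]
      refine ⟨?_, fun h => hi (h ▸ hp0)⟩
      by_cases hi1 : i ∈ s.map Prod.fst
      · obtain ⟨q, hq, rfl⟩ := List.mem_map.1 hi1
        exact Or.inl (hsf q hq)
      by_cases hi2 : i ∈ (j :: t').map Prod.fst
      · obtain ⟨q, hq, rfl⟩ := List.mem_map.1 hi2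
        exact Or.inr (testBit_mask.2 ⟨q, hq, rfl⟩)
      rw [flipMap_apply_of_notMem x hi1 hi2] at hi
      exact Or.inl (hxf i hi)
  · have hm : wmin s x = 0 := by
      rw [isFace_mask_iff] at hfs
      push Not at hfs
      obtain ⟨p, hp, hpf⟩ := hfs
      have hxp : x p.1 = 0 := by
        by_contra h
        exact hpf (hxf _ h)
      refine wmin_eq ha.1 ⟨p, hp, by simp [hxp]⟩ fun q _ =>
        div_nonneg (hx0 _) (Nat.cast_nonneg _)
    have hfl : flipMap s t x = x := by simp [flipMap, hm]
    rw [hfl]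
    exact ⟨f, List.mem_append.2 (Or.inr (List.mem_filter.2 ⟨hf, by simpa using hfs⟩)), hxf⟩

/-- A new facet is either an old one not containing `s`, where the reverse flip is the identity, or
`f ∪ t` minus a vertex of `s`. In the second case a vertex `j` of `t` is used up, and `canFlip`
guarantees that `f ∪ t` minus `j` is a facet of `K`. -/
theorem mem_simplicialCone_of_flip {K : List ℕ} {s t : List (ℕ × ℕ)} (ha : Admissible s t)
    (hc : canFlip K s t = true) {y : ℕ → ℝ} (hy : y ∈ simplicialCone (flipComplex K s t)) :
    flipMap t s y ∈ simplicialCone K ∧ flipMap s t (flipMap t s y) = y := by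
  obtain ⟨hy0, g, hg, hyg⟩ := hy
  obtain ⟨h1, h2⟩ := canFlip_iff.1 hc
  have hcase : (g ∈ K ∧ ∃ i ∈ s, g.testBit i.1 = false) ∨ ∃ f ∈ K, isFace (mask s) f = true ∧
      ∃ i ∈ s, g = delVertex (Nat.lor f (mask t)) i.1 := by
    rcases List.mem_append.1 hg with hg | hg
    · obtain ⟨f, hf, hg⟩ := List.mem_flatMap.1 hg
      obtain ⟨i, hi, rfl⟩ := List.mem_map.1 hg
      obtain ⟨hf, -⟩ := List.mem_filter.1 hf
      obtain ⟨hf, hsf⟩ := List.mem_filter.1 hf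
      exact Or.inr ⟨f, hf, hsf, i, hi, rfl⟩
    · obtain ⟨hg, hsg⟩ := List.mem_filter.1 hg
      have hsg' : ¬ isFace (mask s) g = true := by simpa using hsg
      rw [isFace_mask_iff] at hsg'
      push Not at hsg'
      obtain ⟨i, hi, h⟩ := hsg'
      exact Or.inl ⟨hg, i, hi, by simpa using h⟩
  have hlor : ∀ f, isFace (mask s) f = true → ∀ i ∈ s, (Nat.lor f (mask t)).testBit i.1 = true :=
    fun f hf i hi => testBit_lor.2 (Or.inl (isFace_mask_iff.1 hf i hi))
  have h0 : ∃ p ∈ s, y p.1 = 0 := by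
    rcases hcase with ⟨-, i, hi, hgi⟩ | ⟨f, hf, hsf, i, hi, rfl⟩
    · refine ⟨i, hi, ?_⟩
      by_contra h
      rw [hyg _ h] at hgi
      exact absurd hgi (by simp)
    · refine ⟨i, hi, ?_⟩
      by_contra h
      exact ((testBit_delVertex (hlor f hsf i hi)).1 (hyg _ h)).2 rfl
  refine ⟨⟨flipMap_nonneg ha.symm y hy0, ?_⟩, flipMap_flipMap ha.symm y hy0 h0⟩
  have hsupp : ∀ i, flipMap t s y i ≠ 0 → y i ≠ 0 ∨ i ∈ s.map Prod.fst ∨ i ∈ t.map Prod.fst := by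
    intro i hi
    by_contra hcon
    push Not at hcon
    rw [flipMap_apply_of_notMem y hcon.2.2 hcon.2.1] at hi
    exact hi hcon.1
  rcases hcase with ⟨hgK, -⟩ | ⟨f, hf, hsf, i, hi, rfl⟩
  · have hm : wmin t y = 0 := by
      obtain ⟨p, hp, hpg⟩ := h1 g hgK
      have hyp : y p.1 = 0 := by
        by_contra h
        rw [hyg _ h] at hpg
        exact absurd hpg (by simp)
      exact wmin_eq ha.2.1 ⟨p, hp, by simp [hyp]⟩ fun q _ =>
        div_nonneg (hy0 _) (Nat.cast_nonneg _)
    have hfl : flipMap t s y = y := by simp [flipMap, hm]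
    rw [hfl]
    exact ⟨g, hgK, hyg⟩
  · obtain ⟨j, hj, hj0⟩ := exists_flipMap_eq_zero ha.symm y hy0
    refine ⟨_, List.mem_of_mem_filter (h2 f hf hsf j hj), ?_⟩
    intro k hk
    have hjb : (Nat.lor f (mask t)).testBit j.1 = true :=
      testBit_lor.2 (Or.inr (testBit_mask.2 ⟨j, hj, rfl⟩))
    rw [testBit_delVertex hjb]
    refine ⟨?_, fun h => hk (h ▸ hj0)⟩
    rcases hsupp k hk with hk | hk | hk
    · exact ((testBit_delVertex (hlor f hsf i hi)).1 (hyg _ hk)).1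
    · obtain ⟨q, hq, rfl⟩ := List.mem_map.1 hk
      exact hlor f hsf q hq
    · obtain ⟨q, hq, rfl⟩ := List.mem_map.1 hk
      exact testBit_lor.2 (Or.inr (testBit_mask.2 ⟨q, hq, rfl⟩))

/-! ### Sequences of flips -/

/-- Every facet of `K` is a face of a facet of `K'`. -/
def isSubcomplex (K K' : List ℕ) : Bool := K.all fun f => K'.any fun g => isFace f g

/-- A sequence of flips is possible, and transforms `K` to `K'`. -/
def transforms : List (List (ℕ × ℕ) × List (ℕ × ℕ)) → List ℕ → List ℕ → Bool
  | [], K, K' => isSubcomplex K K' && isSubcomplex K' K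
  | m :: l, K, K' => canFlip K m.1 m.2 && transforms l (flipComplex K m.1 m.2) K'

/-- The composition of a sequence of flips. -/
noncomputable def flipSeq : List (List (ℕ × ℕ) × List (ℕ × ℕ)) → (ℕ → ℝ) → (ℕ → ℝ)
  | [], x => x
  | m :: l, x => flipSeq l (flipMap m.1 m.2 x)

/-- The inverse of the composition of a sequence of flips. -/
noncomputable def unflipSeq : List (List (ℕ × ℕ) × List (ℕ × ℕ)) → (ℕ → ℝ) → (ℕ → ℝ)
  | [], x => x
  | m :: l, x => flipMap m.2 m.1 (unflipSeq l x)

theorem simplicialCone_mono {K K' : List ℕ} (h : isSubcomplex K K' = true) :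
    simplicialCone K ⊆ simplicialCone K' := by
  rintro x ⟨hx, f, hf, hxf⟩
  simp only [isSubcomplex, List.all_eq_true, List.any_eq_true] at h
  obtain ⟨g, hg, hfg⟩ := h f hf
  exact ⟨hx, g, hg, fun i hi => isFace_iff.1 hfg i (hxf i hi)⟩

theorem continuous_flipSeq (l : List (List (ℕ × ℕ) × List (ℕ × ℕ))) :
    Continuous (flipSeq l) := by
  induction l with
  | nil => exact continuous_id
  | cons m l ih => exact ih.comp (continuous_flipMap _ _)

theorem continuous_unflipSeq (l : List (List (ℕ × ℕ) × List (ℕ × ℕ))) :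
    Continuous (unflipSeq l) := by
  induction l with
  | nil => exact continuous_id
  | cons m l ih => exact (continuous_flipMap _ _).comp ih

theorem isPL_flipSeq (l : List (List (ℕ × ℕ) × List (ℕ × ℕ))) : IsPL (flipSeq l) := by
  induction l with
  | nil => exact isPL_linear LinearMap.id
  | cons m l ih => exact ih.comp (isPL_flipMap _ _)

theorem isPL_unflipSeq (l : List (List (ℕ × ℕ) × List (ℕ × ℕ))) : IsPL (unflipSeq l) := by
  induction l with
  | nil => exact isPL_linear LinearMap.id
  | cons m l ih => exact (isPL_flipMap _ _).comp ih

/-- Each flip moves a point by a multiple of `wvec m.2 - wvec m.1`, which `A` kills. This serves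
twice: for the coordinate sum, and for the projection of the fan to `ℝ⁴`. -/
theorem map_flipSeq {F : Type*} [AddCommGroup F] [Module ℝ F] (A : (ℕ → ℝ) →ₗ[ℝ] F)
    {l : List (List (ℕ × ℕ) × List (ℕ × ℕ))} (h : ∀ m ∈ l, A (wvec m.1) = A (wvec m.2))
    (x : ℕ → ℝ) : A (flipSeq l x) = A x := by
  induction l generalizing x with
  | nil => rfl
  | cons m l ih =>
    rw [flipSeq, ih (fun m hm => h m (by simp [hm])), flipMap, map_add, map_smul, map_sub,
      h m (by simp)]
    simp

theorem map_unflipSeq {F : Type*} [AddCommGroup F] [Module ℝ F] (A : (ℕ → ℝ) →ₗ[ℝ] F)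
    {l : List (List (ℕ × ℕ) × List (ℕ × ℕ))} (h : ∀ m ∈ l, A (wvec m.1) = A (wvec m.2))
    (x : ℕ → ℝ) : A (unflipSeq l x) = A x := by
  induction l with
  | nil => rfl
  | cons m l ih =>
    rw [unflipSeq, flipMap, map_add, map_smul, map_sub, h m (by simp),
      ih (fun m hm => h m (by simp [hm]))]
    simp

theorem flipSeq_mem {l : List (List (ℕ × ℕ) × List (ℕ × ℕ))}
    (ha : (l.all fun m => admissible m.1 m.2) = true) {K K' : List ℕ}
    (ht : transforms l K K' = true) {x : ℕ → ℝ} (hx : x ∈ simplicialCone K) :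
    flipSeq l x ∈ simplicialCone K' ∧ unflipSeq l (flipSeq l x) = x := by
  induction l generalizing K x with
  | nil =>
    simp only [transforms, Bool.and_eq_true] at ht
    exact ⟨simplicialCone_mono ht.1 hx, rfl⟩
  | cons m l ih =>
    simp only [transforms, Bool.and_eq_true] at ht
    simp only [List.all_cons, Bool.and_eq_true, admissible_iff] at ha
    obtain ⟨h1, h2⟩ := mem_simplicialCone_flip ha.1 ht.1 hx
    obtain ⟨h3, h4⟩ := ih ha.2 ht.2 h1
    exact ⟨h3, by rw [unflipSeq, flipSeq, h4, h2]⟩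

theorem unflipSeq_mem {l : List (List (ℕ × ℕ) × List (ℕ × ℕ))}
    (ha : (l.all fun m => admissible m.1 m.2) = true) {K K' : List ℕ}
    (ht : transforms l K K' = true) {y : ℕ → ℝ} (hy : y ∈ simplicialCone K') :
    unflipSeq l y ∈ simplicialCone K ∧ flipSeq l (unflipSeq l y) = y := by
  induction l generalizing K with
  | nil =>
    simp only [transforms, Bool.and_eq_true] at ht
    exact ⟨simplicialCone_mono ht.2 hy, rfl⟩
  | cons m l ih =>
    simp only [transforms, Bool.and_eq_true] at ht
    simp only [List.all_cons, Bool.and_eq_true, admissible_iff] at ha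
    obtain ⟨h3, h4⟩ := ih ha.2 ht.2
    obtain ⟨h1, h2⟩ := mem_simplicialCone_of_flip ha.1 ht.1 h3
    exact ⟨h1, by rw [unflipSeq, flipSeq, h2, h4]⟩

/-! ### The combinatorial triangulation of the orbifold -/

/-- The cyclic block of `i` modulo `5`, when the cyclic order `0, …, 4` is cut before each element
of `I`: the last element of `I` which precedes `i` cyclically. -/
def blk (I i : ℕ) : ℕ :=
  bif I.testBit i then i else bif I.testBit ((i + 4) % 5) then (i + 4) % 5 else
  bif I.testBit ((i + 3) % 5) then (i + 3) % 5 else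
  bif I.testBit ((i + 2) % 5) then (i + 2) % 5 else (i + 1) % 5

/-- The ten symmetries of the pentagon `ℤ / 5`. -/
def dih (m k : ℕ) : ℕ := ((bif Nat.blt m 5 then k else 4 * k) + m) % 5

/-- The function `k ↦ blk I (p (dih m k))` encoded as a number. -/
def blkCode (I : ℕ) (p : ℕ → ℕ) (m : ℕ) : ℕ :=
  blk I (p (dih m 0)) + 5 * (blk I (p (dih m 1)) + 5 * (blk I (p (dih m 2)) +
    5 * (blk I (p (dih m 3)) + 5 * blk I (p (dih m 4)))))

/-- The minimum of `f 0, …, f n`. -/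
def minUpTo (f : ℕ → ℕ) : ℕ → ℕ
  | 0 => f 0
  | n + 1 => bif Nat.ble (minUpTo f n) (f (n + 1)) then minUpTo f n else f (n + 1)

/-- An invariant of the cyclically ordered partition of `ℤ / 5` up to symmetries of the
pentagon. -/
def faceKey (I : ℕ) (p : ℕ → ℕ) : ℕ := 32 * minUpTo (blkCode I p) 9 + I

/-- The values of `faceKey`. -/
def faceKeys : List ℕ :=
  [1, 24994, 49988, 74984, 99984, 4995, 1989, 8389, 585, 2505, 145, 29990, 26986, 33386, 25586,
  27506, 54988, 51988, 58388, 79992, 5991, 9191, 5387, 6667, 6923, 13067, 5107, 5491, 2189, 2829,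
  8589, 10509, 2069, 2325, 8469, 9749, 633, 2553, 30990, 34190, 30390, 31670, 38070, 31926,
  27194, 27834, 33594, 35514, 55996, 59196, 6191, 6831, 6959, 9391, 10671, 13231, 6071, 6327,
  7607, 9271, 9527, 9911, 5435, 5563, 6715, 7099, 7483, 13115, 2237, 2365, 2877, 8637, 10557,
  11325, 31198, 31838, 34398, 35678, 38238, 31966, 6239, 6367, 6879, 7135, 7647, 7775, 9439,
  9567, 10719, 11487, 13279, 13919]

/-- The vertex of the triangulation which corresponds to a face. -/
def faceLabel (I : ℕ) (p : ℕ → ℕ) : ℕ := faceKeys.findIdx (Nat.beq (faceKey I p))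

/-- Evaluate `n` before passing it to `f`. -/
noncomputable def evalFirst {α : Type*} (f : ℕ → α) (n : ℕ) : α := Nat.rec (f 0) (fun m _ => f (Nat.succ m)) n

/-- The permutations of a list. -/
def allOrders : ℕ → List ℕ → List (List ℕ)
  | 0, _ => [[]]
  | n + 1, l => l.flatMap fun a => (allOrders n (l.filter fun b => !Nat.beq b a)).map (List.cons a)

/-- The facet of the barycentric subdivision which is determined by an ordering of the vertices. -/
noncomputable def flagFacet (p : ℕ → ℕ) : ℕ → List ℕ → ℕ → ℕ
  | _, [], m => m
  | I, a :: l, m => evalFirst (fun I' => evalFirst (flagFacet p I' l)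
      (Nat.lor m (Nat.shiftLeft 1 (faceLabel I' p)))) (Nat.lor I (Nat.shiftLeft 1 a))

/-- Representatives of the permutations of `ℤ / 5` modulo symmetries of the pentagon. -/
def sheets : List (List ℕ) :=
  (allOrders 5 [0, 1, 2, 3, 4]).filter fun l =>
    Nat.beq (l.getD 0 0) 0 && Nat.blt (l.getD 1 0) (l.getD 4 0)

/-- The facets of the triangulation of the orbifold. -/
noncomputable def orbFacets : List ℕ :=
  sheets.flatMap fun p => (allOrders 5 [0, 1, 2, 3, 4]).map fun f =>
    flagFacet (fun k => p.getD k 0) 0 f 0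

/-- A flip with equal weights. -/
def unitMove (m : List ℕ × List ℕ) : List (ℕ × ℕ) × List (ℕ × ℕ) :=
  (m.1.map fun i => (i, m.2.length), m.2.map fun i => (i, m.1.length))

/-- Flips which simplify the triangulation of the orbifold. -/
def orbFlips : List (List ℕ × List ℕ) :=
  [([25], [55, 67]), ([7], [0, 2]), ([19], [3, 4]), ([14], [1, 4]), ([77], [83, 89]),
  ([11], [1, 2]), ([59], [86, 90]), ([43], [2, 4]), ([5], [0, 1]), ([72], [88, 91]),
  ([8], [0, 3]), ([13], [1, 3]), ([39], [1, 16]), ([47], [3, 15]), ([10], [0, 4]),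
  ([21, 61], [0, 1, 2]), ([21, 88], [0, 1, 2, 54]), ([4, 35], [61, 88, 91]), ([45], [63, 75]),
  ([26], [0, 1, 4]), ([35], [2, 61, 88, 91]), ([36], [0, 3, 4]), ([29], [51, 70]),
  ([0, 61], [1, 88, 91]), ([34], [0, 18]), ([24, 85], [0, 1, 3]), ([66], [84, 89]),
  ([27], [0, 15]), ([33], [81, 83]), ([21, 91], [0, 1, 2, 55]), ([70], [82, 84]), ([16], [2, 3]),
  ([46], [82, 88]), ([30, 71], [0, 2, 3]), ([6, 51], [20, 82, 84]), ([4, 61], [40, 88, 91]),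
  ([30], [0, 2, 3, 53]), ([9, 51], [23, 82, 84]), ([21, 55], [0, 1, 2, 90]), ([56], [80, 82]),
  ([6, 57], [20, 81, 83]), ([4, 65], [0, 3, 15]), ([75], [81, 87]), ([18, 69], [49, 81, 83]),
  ([4, 69], [3, 81, 83]), ([82, 88], [1, 3, 4]), ([64], [82, 88]), ([0, 51], [1, 82, 84]),
  ([1, 61], [2, 40, 88, 91]), ([65, 85], [0, 1, 3, 15]), ([20, 51], [1, 2, 82, 84]),
  ([23, 51], [1, 3, 82, 84]), ([24, 52], [0, 1, 3, 83]), ([31], [2, 9]),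
  ([21, 90], [0, 1, 2, 86]), ([18, 57], [41, 81, 83]), ([28], [3, 6]), ([42], [84, 85]),
  ([53], [86, 87]), ([12, 63], [22, 81, 87]), ([17, 58], [32, 84, 85]), ([17, 78], [48, 84, 85]),
  ([44], [4, 12]), ([60], [87, 89]), ([4, 78], [3, 84, 85]), ([48, 78], [2, 3, 84, 85]),
  ([49, 69], [2, 3, 81, 83]), ([68], [80, 85]), ([37], [4, 9]), ([63], [0, 81, 87]),
  ([52], [1, 6]), ([15, 78], [1, 3, 84, 85]), ([73], [89, 90]), ([49], [3, 18]),
  ([69], [3, 6, 81, 83]), ([21, 54], [0, 1, 2, 89]), ([50], [80, 81]), ([62], [4, 22]),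
  ([48], [3, 17]), ([54], [1, 9]), ([71], [0, 3, 18]), ([38], [2, 12]),
  ([61], [2, 17, 40, 88, 91]), ([2, 57], [1, 81, 83]), ([40], [1, 17]), ([2, 4], [79, 86, 90]),
  ([4, 76], [1, 3, 17]), ([41, 57], [15, 81, 83]), ([74], [2, 4]), ([4, 58], [0, 84, 85]),
  ([51], [1, 2, 3, 82, 84]), ([55], [90, 91]), ([23, 89], [1, 9, 84]), ([18, 79], [3, 86, 90]),
  ([1, 79], [12, 86, 90]), ([3, 67], [4, 90, 91]), ([78], [1, 2, 3, 84, 85]),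
  ([21, 86], [0, 1, 2, 87]), ([76], [1, 2, 3, 17]), ([20, 85], [1, 6, 58]),
  ([15, 58], [0, 1, 84, 85]), ([23, 88], [1, 9, 82]), ([4, 79], [3, 12, 86, 90]),
  ([24], [0, 1, 3, 65, 83]), ([41], [83, 87]), ([17, 88], [1, 3, 91]), ([9, 67], [0, 4, 90, 91]),
  ([32, 58], [6, 84, 85]), ([67], [1, 4, 90, 91]), ([17, 91], [1, 2, 3, 4]),
  ([82, 88], [1, 4, 9]), ([22], [0, 12]), ([58], [20, 85]), ([3, 23], [1, 9, 82, 84]),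
  ([88], [1, 9, 91]), ([32], [82, 85]), ([23], [0, 1, 9, 82, 84]), ([86, 87], [0, 2, 12]),
  ([0, 91], [1, 9, 90]), ([17, 84], [3, 82, 85]), ([9, 82], [1, 4, 84]),
  ([20, 57], [0, 1, 81, 83]), ([12, 87], [0, 2, 81]), ([18, 86], [0, 3, 90]),
  ([4, 57], [0, 15, 81, 83]), ([9, 91], [1, 3, 90]), ([90, 91], [1, 3, 12]),
  ([79], [2, 3, 12, 86, 90]), ([18, 90], [0, 3, 89]), ([2, 9], [1, 89, 90]),
  ([9, 84], [1, 4, 89]), ([3, 87], [0, 18, 81]), ([18], [3, 87]), ([12, 90], [1, 3, 86]),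
  ([20, 85], [1, 6, 84]), ([3, 9], [1, 4, 89, 90]), ([17, 85], [3, 80, 82]),
  ([17, 80], [2, 4, 82]), ([65], [0, 1, 3, 15, 83]), ([15, 85], [0, 3, 84]),
  ([57], [0, 1, 15, 81, 83]), ([20, 83], [1, 6, 81]), ([17], [1, 2, 3, 4, 82]),
  ([6, 83], [1, 3, 81]), ([1, 85], [3, 6, 84]), ([4, 81], [0, 83, 87]), ([84, 89], [1, 4, 15]),
  ([20, 81], [1, 6, 80]), ([15, 81], [0, 1, 83, 87]), ([2, 20], [1, 6, 82]),
  ([21], [0, 1, 2, 87, 89]), ([15, 87], [0, 83, 89]), ([15, 89], [1, 4, 83]),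
  ([6, 81], [1, 3, 80]), ([1, 87], [0, 2, 83]), ([15], [0, 1, 3, 4]), ([83], [1, 87]),
  ([4, 84], [0, 3, 82]), ([6], [80, 84]), ([20], [0, 1, 80, 82, 84]), ([9], [0, 1, 4, 89, 90]),
  ([2, 85], [3, 80, 82, 84]), ([4, 85], [0, 3, 80, 82]), ([91], [1, 2, 3, 4, 12]),
  ([2, 84], [1, 3, 80, 82]), ([85], [0, 3, 80, 82, 84]), ([2, 82], [1, 3, 4, 80]),
  ([4, 87], [0, 1, 3, 89]), ([81, 87], [0, 1, 2, 3]), ([90], [86, 89]), ([1, 81], [0, 2, 80]),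
  ([86], [12, 89]), ([4, 89], [0, 1, 3, 12]), ([84], [0, 1, 3, 80, 82]),
  ([87], [0, 1, 2, 3, 89]), ([89], [0, 1, 2, 3, 12]), ([81], [0, 2, 3, 12, 80]),
  ([2, 4], [1, 3, 12, 80]), ([4], [12, 82]), ([80], [2, 82])]

/-- The vertices of the final triangulation. -/
def finalVertices : List ℕ := [0, 1, 2, 3, 12, 82]

/-- The facets of the boundary of a simplex. -/
def simplexBoundary (l : List ℕ) : List ℕ :=
  l.map fun i => (l.filter fun j => !Nat.beq i j).foldr (fun j m => Nat.lor m (Nat.shiftLeft 1 j)) 0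

/-! ### The certificate that the triangulated orbifold is a 4-sphere -/

theorem admissible_orbFlips :
    ((orbFlips.map unitMove).all fun m => admissible m.1 m.2) = true := by decide +kernel

/-- This finite check is the core of the sphere statement: starting from the 12 · 120 listed facets,
every flip is legal, and the outcome is the boundary of a 5-simplex. -/
theorem transforms_orbFlips :
    transforms (orbFlips.map unitMove) orbFacets (simplexBoundary finalVertices) = true := by
  decide +kernel

/-! ### The link of a cone point and the figure-eight knot in it -/

/-- The vertices of the triangulation in the singular set. -/
def singularVertices : List ℕ :=
  [0, 1, 2, 3, 4, 5, 6, 7, 8, 9, 10, 11, 12, 13, 14, 15, 16, 17, 18, 19, 24, 25, 29, 30, 33, 35,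
  42, 43, 45, 46]

/-- The facets of the link of the vertex `0`. -/
noncomputable def linkFacets : List ℕ :=
  (orbFacets.filter fun f => f.testBit 0).map fun f => delVertex f 0

/-- The faces of the link of the vertex `0` in the singular set. -/
noncomputable def linkSingular : List ℕ :=
  linkFacets.map fun f => Nat.land f (mask (singularVertices.map fun i => (i, 1)))

/-- Edges as faces. -/
def edgeFace (e : ℕ × ℕ) : ℕ := mask [(e.1, 1), (e.2, 1)]

/-- The edges of the singular set in the link of the vertex `0`. -/
def linkKnot : List (ℕ × ℕ) :=
  [(10, 33), (10, 35), (5, 24), (5, 25), (6, 29), (6, 33), (7, 30), (7, 35), (8, 24), (8, 30),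
  (9, 25), (9, 29)]

/-- Flips which simplify the link of the vertex `0`. -/
def linkFlips : List (List ℕ × List ℕ) :=
  [([52], [83, 85]), ([68], [80, 85]), ([64], [82, 88]), ([23], [5, 9]), ([29], [6, 9]),
  ([69], [81, 83]), ([27], [5, 10]), ([20, 82], [51, 56]), ([36], [8, 10]), ([21], [5, 7]),
  ([32], [6, 10]), ([51, 84], [9, 20]), ([24], [5, 8]), ([37], [9, 10]), ([70, 84], [6, 9, 10]),
  ([51], [9, 56]), ([28, 83], [6, 8]), ([50], [80, 81]), ([66], [84, 89]),
  ([84, 89], [5, 9, 10]), ([5, 20, 80], [56, 81]), ([53], [86, 87]), ([65, 85], [5, 8, 10]),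
  ([67], [90, 91]), ([28, 85], [6, 8, 80]), ([54], [88, 89]), ([28], [6, 8, 80, 81]),
  ([88, 89], [7, 9]), ([84], [10, 20]), ([31, 89], [7, 9, 73]), ([10, 58], [5, 6]),
  ([7, 73, 89], [9, 34]), ([56, 81], [5, 20, 80]), ([9, 34], [7, 73, 89]), ([10, 59], [26, 34]),
  ([60], [5, 34]), ([65], [5, 8, 10, 83]), ([72], [88, 91]), ([34, 59], [7, 26]),
  ([59, 86], [5, 7, 26]), ([10, 20], [5, 6, 9]), ([34, 87], [7, 10]), ([89], [9, 34]),
  ([9, 55], [25, 31]), ([34, 71], [7, 10, 86]), ([80, 85], [6, 8, 10]), ([26, 62], [80, 86]),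
  ([70], [6, 9, 10, 82]), ([10, 85], [5, 6, 8]), ([6, 82], [9, 10, 56]), ([5, 34], [7, 9, 10]),
  ([59], [5, 7, 26, 90]), ([34, 86], [7, 10, 26]), ([5, 62], [22, 80, 86]),
  ([22, 62], [8, 80, 86]), ([62], [8, 10, 80, 86]), ([9, 20], [5, 6, 56]),
  ([9, 34], [7, 10, 73]), ([55], [5, 31]), ([26, 34], [7, 10, 90]), ([20, 56], [5, 6, 80]),
  ([58], [5, 6, 20, 85]), ([63], [10, 22]), ([31, 88], [7, 9, 91]), ([30], [7, 8]),
  ([8, 85], [5, 6, 83]), ([31, 73], [7, 9, 90]), ([82], [9, 26]), ([20, 80], [5, 6, 81]),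
  ([71, 87], [7, 8, 10]), ([20, 81], [5, 6, 57]), ([87], [7, 22]), ([34], [7, 10, 73, 90]),
  ([5, 26, 91], [61, 90]), ([61, 90], [5, 26, 91]), ([85], [5, 6, 20, 83]), ([31], [7, 25]),
  ([71], [7, 8, 10, 86]), ([8, 10, 22], [7, 81]), ([7, 81], [8, 10, 22]), ([20], [5, 6, 57, 83]),
  ([56], [6, 26]), ([10, 80], [8, 26]), ([6, 57], [5, 33]), ([73], [7, 9, 10, 90]),
  ([22, 86], [7, 80]), ([80, 81], [6, 22]), ([26, 91], [61, 90]), ([5, 86], [7, 26, 80]),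
  ([10, 86], [7, 8, 26]), ([57, 83], [5, 10, 33]), ([57], [5, 10, 33, 81]), ([83], [8, 33]),
  ([8, 81], [22, 33]), ([81], [5, 22, 33]), ([10, 22], [7, 33]), ([86], [7, 8, 26, 80]),
  ([5, 88], [9, 61]), ([26, 88], [9, 10, 61]), ([88], [9, 35]), ([80], [22, 26]),
  ([22], [26, 33]), ([6, 10], [8, 9]), ([5, 10], [9, 33]), ([10, 91], [35, 90]),
  ([26, 61], [5, 10]), ([61, 90], [5, 35]), ([61, 91], [5, 7, 35]), ([26, 90], [5, 7, 10]),
  ([8, 26, 33], [6, 7]), ([6, 7], [8, 26, 33]), ([7, 61], [5, 9, 35]), ([8, 9, 26], [6, 10]),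
  ([91], [25, 35]), ([6, 10], [8, 9, 26]), ([61], [5, 9, 10, 35]), ([90], [10, 25]),
  ([5, 7, 10], [25, 26]), ([25, 26], [5, 7, 10]), ([5, 7, 9], [33, 35]), ([33, 35], [5, 7, 9]),
  ([7, 9, 10], [25, 33]), ([25, 33], [7, 9, 10]), ([26, 33], [6, 7]), ([7, 26], [6, 10]),
  ([5, 26], [6, 9, 10]), ([26], [6, 8, 9, 10])]

/-- The facets of a small triangulation of the `3`-sphere. -/
def smallSphere : List ℕ :=
  [1248, 8589934816, 864, 8589934944, 1632, 8589935264, 34359739040, 33555616, 34393292960,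
  8589935392, 34359739936, 34393293856, 1472, 8589935040, 1856, 8589936000, 33556096, 8589936256,
  34393293440, 8589936384, 34393294336]

/-- A figure-eight knot in it. -/
def smallKnot : List (ℕ × ℕ) :=
  [(5, 8), (5, 25), (6, 9), (6, 33), (7, 8), (7, 35), (9, 25), (10, 33), (10, 35)]

/-- Vectors in `ℝ⁴` which span the cones of a simplicial fan. -/
def fanVectors : List (ℕ × (Fin 4 → ℤ)) :=
  [(35, ![-1, -2, 0, 1]), (10, ![-1, 1, -1, 1]), (33, ![1, 1, 1, 1]), (6, ![2, 2, -1, 1]),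
  (9, ![-2, 1, 0, 1]), (25, ![3, -1, 0, 1]), (100, ![2, 3, 1, 1]), (101, ![-9, -7, 0, -7]),
  (5, ![13, 19, 7, 8]), (8, ![31, 40, 22, 35]), (7, ![11, 14, 8, 13]), (102, ![14, 17, 11, 19]),
  (103, ![14, 15, 13, 25])]

/-- The vertices of a simplex around the origin of `ℝ⁴`. -/
def fanSimplex : List ℕ :=
  [10, 33, 6, 25, 101]

/-- Stellar subdivisions of the fan over the boundary of this simplex. -/
def fanFlips : List (List (ℕ × ℕ) × List (ℕ × ℕ)) :=
  [([(33, 56), (6, 38), (25, 1), (101, 11)], [(100, 18)]),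
  ([(10, 23), (33, 23), (101, 4)], [(9, 18)]), ([(9, 68), (25, 69), (101, 13)], [(35, 46)]),
  ([(33, 18), (6, 11), (101, 3)], [(5, 1)]), ([(33, 27), (6, 5), (9, 3)], [(8, 1)]),
  ([(10, 3), (33, 21), (6, 2)], [(7, 2)]), ([(10, 7), (33, 29), (25, 2)], [(102, 2)]),
  ([(33, 13), (9, 7), (25, 5)], [(103, 1)])]

/-- A subdivision of the heptagon into edges of the subdivided fan. -/
def fanKnot : List (ℕ × ℕ) :=
  [(6, 33), (25, 100), (35, 10), (10, 33), (25, 9), (6, 9), (100, 5), (5, 8), (8, 7), (7, 102),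
  (102, 103), (103, 35)]

/-- Flips which simplify the subdivided fan. -/
def sphereFlips : List (List ℕ × List ℕ) :=
  [([100], [25, 5]), ([9, 102], [10, 103]), ([102], [7, 103]), ([6, 101], [10, 5]),
  ([10, 103], [9, 7]), ([6, 25], [5, 7]), ([25, 103], [35, 7]), ([35, 7], [25, 103]),
  ([33, 101], [35, 5]), ([103], [35, 7]), ([101], [35, 10, 5]), ([33, 25], [35, 5, 7]),
  ([35, 33], [9, 5, 7])]

/-- The facets of the subdivided fan. -/
def fanFacets : List ℕ :=
  fanFlips.foldl (fun K m => flipComplex K m.1 m.2) (simplexBoundary fanSimplex)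

/-! ### Certificates for the link of a cone point and for the fan -/

theorem admissible_linkFlips :
    ((linkFlips.map unitMove).all fun m => admissible m.1 m.2) = true := by decide +kernel

theorem admissible_sphereFlips :
    ((sphereFlips.map unitMove).all fun m => admissible m.1 m.2) = true := by decide +kernel

theorem admissible_fanFlips :
    (fanFlips.all fun m => admissible m.1 m.2) = true := by decide +kernel

theorem transforms_linkFlips :
    transforms (linkFlips.map unitMove) linkFacets smallSphere = true := by
  decide +kernel

/-- The same moves are legal for the knot regarded as a complex of its own, so the PL map reducing
the link carries the knot along with it. -/
theorem transforms_linkKnot :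
    transforms (linkFlips.map unitMove) (linkKnot.map edgeFace) (smallKnot.map edgeFace) = true := by
  decide +kernel

/-- The target is by definition the outcome of these moves; the content is that each stellar
subdivision is legal. -/
theorem transforms_fanFlips :
    transforms fanFlips (simplexBoundary fanSimplex) fanFacets = true := by
  decide +kernel

theorem transforms_sphereFlips :
    transforms (sphereFlips.map unitMove) fanFacets smallSphere = true := by
  decide +kernel

/-- The fan and its knot end at the same small pair as the link and its knot, which identifies the
knot in the link with the heptagon. -/
theorem transforms_fanKnot :
    transforms (sphereFlips.map unitMove) (fanKnot.map edgeFace) (smallKnot.map edgeFace) = true := by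
  decide +kernel

theorem linkSingular_linkKnot : (isSubcomplex linkSingular (linkKnot.map edgeFace) &&
    isSubcomplex (linkKnot.map edgeFace) linkSingular) = true := by
  decide +kernel

theorem fanKnot_subcomplex : isSubcomplex (fanKnot.map edgeFace) fanFacets = true := by
  decide +kernel

/-! ### Vertices of the triangulation and ordered partitions -/

theorem blk_lt (I : ℕ) {i : ℕ} (hi : i < 5) : blk I i < 5 := by
  unfold blk
  repeat' first
    | (cases I.testBit _ <;> simp only [cond_true, cond_false])
    | omega

theorem dih_lt (m k : ℕ) : dih m k < 5 := Nat.mod_lt _ (by norm_num)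

theorem dih_zero {k : ℕ} (hk : k < 5) : dih 0 k = k := by
  exact Nat.mod_eq_of_lt hk

theorem dih_dih : ∀ m < 10, ∀ n < 10, ∃ q < 10, ∀ k < 5, dih m (dih n k) = dih q k := by
  decide

theorem exists_dih_inv : ∀ m < 10, ∃ n < 10, ∀ k < 5, dih m (dih n k) = k ∧ dih n (dih m k) = k := by
  decide

/-- Nontrivial symmetries stay nontrivial under conjugation; this moves symmetric block patterns
from one sheet to another. -/
theorem dih_conj : ∀ g < 10, ∀ m < 10, m ≠ 0 →
    ∃ n < 10, n ≠ 0 ∧ ∀ k < 5, dih g (dih m k) = dih n (dih g k) := by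
  decide

theorem minUpTo_le (f : ℕ → ℕ) {n i : ℕ} (hi : i ≤ n) : minUpTo f n ≤ f i := by
  induction n with
  | zero => obtain rfl : i = 0 := by omega
            exact le_rfl
  | succ n ih =>
    rw [minUpTo]
    cases h : Nat.ble (minUpTo f n) (f (n + 1))
    · have h' : ¬ minUpTo f n ≤ f (n + 1) := by
        rw [← Nat.ble_eq]; simp [h]
      rcases Nat.lt_or_ge n i with h1 | h1
      · obtain rfl : i = n + 1 := by omega
        exact le_rfl
      · have := ih h1
        simp only [cond_false]; omega
    · have h' : minUpTo f n ≤ f (n + 1) := Nat.ble_eq ▸ h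
      rcases Nat.lt_or_ge n i with h1 | h1
      · obtain rfl : i = n + 1 := by omega
        exact h'
      · exact ih h1

theorem exists_minUpTo (f : ℕ → ℕ) (n : ℕ) : ∃ i ≤ n, minUpTo f n = f i := by
  induction n with
  | zero => exact ⟨0, le_rfl, rfl⟩
  | succ n ih =>
    obtain ⟨i, hi, h⟩ := ih
    rw [minUpTo]
    cases Nat.ble (minUpTo f n) (f (n + 1))
    · exact ⟨n + 1, le_rfl, rfl⟩
    · exact ⟨i, by omega, h⟩

theorem minUpTo_congr {f g : ℕ → ℕ} {n : ℕ} (h1 : ∀ i ≤ n, ∃ j ≤ n, f i = g j)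
    (h2 : ∀ i ≤ n, ∃ j ≤ n, g i = f j) : minUpTo f n = minUpTo g n := by
  obtain ⟨i, hi, hfi⟩ := exists_minUpTo f n
  obtain ⟨j, hj, hgj⟩ := exists_minUpTo g n
  obtain ⟨i', hi', h1⟩ := h1 i hi
  obtain ⟨j', hj', h2⟩ := h2 j hj
  apply le_antisymm
  · rw [hgj, h2]; exact minUpTo_le f hj'
  · rw [hfi, h1]; exact minUpTo_le g hi'

/-- The code is a base-5 numeral whose digits are the blocks, all less than 5. -/
theorem blkCode_eq_iff {I J : ℕ} {p q : ℕ → ℕ} (hp : ∀ k < 5, p k < 5) (hq : ∀ k < 5, q k < 5)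
    {m n : ℕ} : blkCode I p m = blkCode J q n ↔
      ∀ k < 5, blk I (p (dih m k)) = blk J (q (dih n k)) := by
  have hb : ∀ k, blk I (p (dih m k)) < 5 := fun k => blk_lt I (hp _ (dih_lt _ _))
  have hb' : ∀ k, blk J (q (dih n k)) < 5 := fun k => blk_lt J (hq _ (dih_lt _ _))
  have a0 := hb 0; have a1 := hb 1; have a2 := hb 2; have a3 := hb 3; have a4 := hb 4
  have b0 := hb' 0; have b1 := hb' 1; have b2 := hb' 2; have b3 := hb' 3; have b4 := hb' 4
  unfold blkCode
  constructor
  · intro h k hk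
    interval_cases k <;> omega
  · intro h
    rw [h 0 (by norm_num), h 1 (by norm_num), h 2 (by norm_num), h 3 (by norm_num),
      h 4 (by norm_num)]

/-- Two block functions agree up to a symmetry of the pentagon. -/
def BlkEquiv (I : ℕ) (p q : ℕ → ℕ) : Prop :=
  ∃ m < 10, ∀ k < 5, blk I (p k) = blk I (q (dih m k))

theorem BlkEquiv.symm {I : ℕ} {p q : ℕ → ℕ} (h : BlkEquiv I p q) : BlkEquiv I q p := by
  obtain ⟨m, hm, h⟩ := h
  obtain ⟨n, hn, hmn⟩ := exists_dih_inv m hm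
  refine ⟨n, hn, fun k hk => ?_⟩
  rw [h _ (dih_lt _ _), (hmn k hk).1]

theorem BlkEquiv.trans {I : ℕ} {p q r : ℕ → ℕ} (h : BlkEquiv I p q) (h' : BlkEquiv I q r) :
    BlkEquiv I p r := by
  obtain ⟨m, hm, h⟩ := h
  obtain ⟨n, hn, h'⟩ := h'
  obtain ⟨l, hl, hmn⟩ := dih_dih n hn m hm
  exact ⟨l, hl, fun k hk => by rw [h k hk, h' _ (dih_lt _ _), hmn k hk]⟩

/-- The five low bits store `I`; the rest is the least code over the ten symmetries, a canonical
representative of the block pattern. -/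
theorem faceKey_eq_iff {I J : ℕ} (hI : I < 32) (hJ : J < 32) {p q : ℕ → ℕ}
    (hp : ∀ k < 5, p k < 5) (hq : ∀ k < 5, q k < 5) :
    faceKey I p = faceKey J q ↔ I = J ∧ BlkEquiv I p q := by
  constructor
  · intro h
    obtain ⟨i, hi, h1⟩ := exists_minUpTo (blkCode I p) 9
    obtain ⟨j, hj, h2⟩ := exists_minUpTo (blkCode J q) 9
    rw [faceKey, faceKey, h1, h2] at h
    obtain rfl : I = J := by omega
    have h : blkCode I p i = blkCode I q j := by omega
    rw [blkCode_eq_iff hp hq] at h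
    refine ⟨rfl, ?_⟩
    have e1 : BlkEquiv I p fun k => p (dih i k) := BlkEquiv.symm ⟨i, by omega, fun _ _ => rfl⟩
    have e2 : BlkEquiv I (fun k => q (dih j k)) q := ⟨j, by omega, fun _ _ => rfl⟩
    exact (e1.trans ⟨0, by norm_num, fun k hk => by rw [dih_zero hk]; exact h k hk⟩).trans e2
  · rintro ⟨rfl, h⟩
    have key : ∀ {p q : ℕ → ℕ}, (∀ k < 5, p k < 5) → (∀ k < 5, q k < 5) → BlkEquiv I p q →
        ∀ i ≤ 9, ∃ j ≤ 9, blkCode I p i = blkCode I q j := by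
      intro p q hp hq h i hi
      obtain ⟨m, hm, h⟩ := h
      obtain ⟨l, hl, hml⟩ := dih_dih m hm i (by omega)
      refine ⟨l, by omega, (blkCode_eq_iff hp hq).2 fun k hk => ?_⟩
      rw [h _ (dih_lt _ _), hml k hk]
    rw [faceKey, faceKey, minUpTo_congr (key hp hq h) (key hq hp h.symm)]

/-! ### Permutations, sheets and the table of face labels -/

theorem mem_allOrders {n : ℕ} {s l : List ℕ} :
    l ∈ allOrders n s ↔ l.length = n ∧ l.Nodup ∧ ∀ a ∈ l, a ∈ s := by
  induction n generalizing s l with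
  | zero =>
    simp only [allOrders, List.mem_singleton, List.length_eq_zero_iff]
    constructor
    · rintro rfl; simp
    · exact fun h => h.1
  | succ n ih =>
    simp only [allOrders, List.mem_flatMap, List.mem_map, ih, List.mem_filter]
    constructor
    · rintro ⟨a, ha, l, ⟨h1, h2, h3⟩, rfl⟩
      refine ⟨by simp [h1], List.nodup_cons.2 ⟨fun h => ?_, h2⟩, ?_⟩
      · have := (h3 a h).2
        simp at this
      · intro b hb
        rcases List.mem_cons.1 hb with rfl | hb
        · exact ha
        · exact (h3 b hb).1
    · rintro ⟨h1, h2, h3⟩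
      cases l with
      | nil => simp at h1
      | cons a l =>
        rw [List.nodup_cons] at h2
        refine ⟨a, h3 a (by simp), l, ⟨by simpa using h1, h2.2, fun b hb => ⟨h3 b (by simp [hb]), ?_⟩⟩,
          rfl⟩
        have : b ≠ a := fun h => h2.1 (h ▸ hb)
        rw [Bool.not_eq_true', Bool.eq_false_iff, ne_eq, Nat.beq_eq]
        exact this

/-- A permutation of `Fin 5` as a function on natural numbers. -/
def natFun (p : Equiv.Perm (Fin 5)) (k : ℕ) : ℕ := if h : k < 5 then (p ⟨k, h⟩).val else 0

theorem natFun_lt (p : Equiv.Perm (Fin 5)) (k : ℕ) : natFun p k < 5 := by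
  unfold natFun
  split
  · exact (p _).2
  · norm_num

theorem natFun_val (p : Equiv.Perm (Fin 5)) (k : Fin 5) : natFun p k = (p k).val := by
  simp [natFun]

/-- A permutation of `Fin 5` as a list. -/
def permList (p : Equiv.Perm (Fin 5)) : List ℕ :=
  [(p 0).val, (p 1).val, (p 2).val, (p 3).val, (p 4).val]

theorem permList_mem (p : Equiv.Perm (Fin 5)) : permList p ∈ allOrders 5 [0, 1, 2, 3, 4] := by
  refine mem_allOrders.2 ⟨rfl, ?_, ?_⟩
  · have : permList p = (List.ofFn p).map Fin.val := by
      simp [permList, List.ofFn_succ]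
    rw [this]
    exact (List.nodup_ofFn.2 p.injective).map Fin.val_injective
  · intro a ha
    have : a < 5 := by
      simp only [permList, List.mem_cons, List.not_mem_nil, or_false] at ha
      rcases ha with rfl | rfl | rfl | rfl | rfl <;> exact (p _).2
    simp only [List.mem_cons, List.not_mem_nil, or_false]
    omega

theorem exists_permList {l : List ℕ} (hl : l ∈ allOrders 5 [0, 1, 2, 3, 4]) :
    ∃ p : Equiv.Perm (Fin 5), permList p = l := by
  obtain ⟨h1, h2, h3⟩ := mem_allOrders.1 hl
  have hlt : ∀ i : Fin 5, l.get (i.cast h1.symm) < 5 := fun i => by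
    have := h3 _ (l.get_mem (i.cast h1.symm))
    simp only [List.mem_cons, List.not_mem_nil, or_false] at this
    omega
  let f : Fin 5 → Fin 5 := fun i => ⟨l.get (i.cast h1.symm), hlt i⟩
  have hf : Function.Injective f := fun i j hij => by
    have := List.nodup_iff_injective_get.1 h2 (Fin.mk.inj hij)
    exact Fin.cast_injective _ this
  refine ⟨Equiv.ofBijective f (Finite.injective_iff_bijective.1 hf), ?_⟩
  apply List.ext_get
  · simp [permList, h1]
  · intro n hn hn'
    have : n < 5 := by simpa [permList] using hn
    interval_cases n <;> rfl

theorem natFun_permList (p : Equiv.Perm (Fin 5)) {k : ℕ} (hk : k < 5) :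
    (permList p).getD k 0 = natFun p k := by
  interval_cases k <;> rfl

/-- A symmetry of the pentagon as a permutation. -/
def dihPerm (m : Fin 10) : Equiv.Perm (Fin 5) where
  toFun k := ⟨dih m k, dih_lt _ _⟩
  invFun k := ⟨dih (if m.val < 5 then (5 - m.val) % 5 else m.val) k, dih_lt _ _⟩
  left_inv := by revert m; decide
  right_inv := by revert m; decide

theorem natFun_mul_dihPerm (p : Equiv.Perm (Fin 5)) (m : Fin 10) {k : ℕ} (hk : k < 5) :
    natFun (p * dihPerm m) k = natFun p (dih m k) := by
  simp [natFun, hk, dih_lt, dihPerm]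

theorem dihPerm_rotation : ∀ t : Fin 5, dihPerm (Fin.castAdd 5 t) 0 = t ∧
    dihPerm (Fin.castAdd 5 t) 1 = t + 1 ∧ dihPerm (Fin.castAdd 5 t) 4 = t + 4 := by
  decide

theorem dihPerm_reflection : ∀ t : Fin 5, dihPerm (Fin.natAdd 5 t) 0 = t ∧
    dihPerm (Fin.natAdd 5 t) 1 = t + 4 ∧ dihPerm (Fin.natAdd 5 t) 4 = t + 1 := by
  decide

/-- A rotation or a reflection puts the entry `0` first; one of the two choices also puts the
smaller of its two cyclic neighbours at index 1. -/
theorem exists_sheet (p : Equiv.Perm (Fin 5)) :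
    ∃ m : Fin 10, permList (p * dihPerm m) ∈ sheets := by
  have h0 : ∃ t : Fin 5, p t = 0 := p.surjective 0
  obtain ⟨t, ht⟩ := h0
  have hne : p (t + 1) ≠ p (t + 4) := fun h => by
    have := p.injective h
    exact absurd this (by clear * -; revert t; decide)
  rcases lt_or_gt_of_ne hne with h | h
  · obtain ⟨e0, e1, e4⟩ := dihPerm_rotation t
    refine ⟨Fin.castAdd 5 t, List.mem_filter.2 ⟨permList_mem _, ?_⟩⟩
    simp only [permList, List.getD_cons_zero, List.getD_cons_succ, Equiv.Perm.mul_apply, e0, e1,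
      e4, ht, Bool.and_eq_true, Nat.beq_eq, Nat.blt_eq]
    exact ⟨rfl, h⟩
  · obtain ⟨e0, e1, e4⟩ := dihPerm_reflection t
    refine ⟨Fin.natAdd 5 t, List.mem_filter.2 ⟨permList_mem _, ?_⟩⟩
    simp only [permList, List.getD_cons_zero, List.getD_cons_succ, Equiv.Perm.mul_apply, e0, e1,
      e4, ht, Bool.and_eq_true, Nat.beq_eq, Nat.blt_eq]
    exact ⟨rfl, h⟩

/-- The table is complete on the twelve representatives, hence on all permutations, because keys are
invariant under symmetries. -/
theorem sheets_faceKey : (sheets.all fun l => (List.range 32).all fun I =>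
    Nat.beq I 0 || memNat (faceKey I fun k => l.getD k 0) faceKeys) = true := by
  decide +kernel

theorem sheets_singular : (sheets.all fun l => (List.range 32).all fun I =>
    Nat.beq I 0 || ((memNat (faceLabel I fun k => l.getD k 0) singularVertices) ==
      ([1, 2, 3, 4, 5, 6, 7, 8, 9].any fun m => Nat.beq (blkCode I (fun k => l.getD k 0) 0)
        (blkCode I (fun k => l.getD k 0) m)))) = true := by
  decide +kernel

theorem blkEquiv_mul_dihPerm (I : ℕ) (p : Equiv.Perm (Fin 5)) (m : Fin 10) :
    BlkEquiv I (natFun (p * dihPerm m)) (natFun p) :=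
  ⟨m, m.2, fun k hk => by rw [natFun_mul_dihPerm p m hk]⟩

theorem faceKey_congr (I : ℕ) {p q : ℕ → ℕ} (h : ∀ k < 5, p k = q k) :
    faceKey I p = faceKey I q := by
  have : ∀ m, blkCode I p m = blkCode I q m := fun m => by
    simp only [blkCode, h _ (dih_lt _ _)]
  rw [faceKey, funext this, faceKey]

theorem faceKey_mem (p : Equiv.Perm (Fin 5)) {I : ℕ} (h0 : I ≠ 0) (hI : I < 32) :
    faceKey I (natFun p) ∈ faceKeys := by
  obtain ⟨m, hm⟩ := exists_sheet p
  have := sheets_faceKey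
  rw [List.all_eq_true] at this
  have := this _ hm
  rw [List.all_eq_true] at this
  have := this I (List.mem_range.2 hI)
  rw [Bool.or_eq_true, Nat.beq_eq, memNat_iff] at this
  have := this.resolve_left h0
  rw [faceKey_congr I fun k hk => natFun_permList _ hk] at this
  rwa [(faceKey_eq_iff hI hI (fun k _ => natFun_lt _ k) (fun k _ => natFun_lt _ k)).2
    ⟨rfl, blkEquiv_mul_dihPerm I p m⟩] at this

/-- The vertex of the triangulation which corresponds to a face and a permutation. -/
def permLabel (I : ℕ) (p : Equiv.Perm (Fin 5)) : ℕ := faceLabel I (natFun p)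

theorem faceKeys_permLabel (p : Equiv.Perm (Fin 5)) {I : ℕ} (h0 : I ≠ 0) (hI : I < 32) :
    permLabel I p < 92 ∧ faceKeys.getD (permLabel I p) 0 = faceKey I (natFun p) := by
  have h : permLabel I p < faceKeys.length := by
    rw [permLabel, faceLabel, List.findIdx_lt_length]
    exact ⟨_, faceKey_mem p h0 hI, by simp⟩
  refine ⟨h, ?_⟩
  rw [List.getD_eq_getElem _ _ h]
  have := List.findIdx_getElem (w := h)
  rw [Nat.beq_eq] at this
  exact this.symm

theorem permLabel_eq_iff {p q : Equiv.Perm (Fin 5)} {I J : ℕ} (hI0 : I ≠ 0) (hI : I < 32)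
    (hJ0 : J ≠ 0) (hJ : J < 32) :
    permLabel I p = permLabel J q ↔ I = J ∧ BlkEquiv I (natFun p) (natFun q) := by
  rw [← faceKey_eq_iff hI hJ (fun k _ => natFun_lt _ k) (fun k _ => natFun_lt _ k)]
  constructor
  · intro h
    rw [← (faceKeys_permLabel p hI0 hI).2, ← (faceKeys_permLabel q hJ0 hJ).2, h]
  · intro h
    rw [permLabel, permLabel, faceLabel, faceLabel, h]

theorem testBit_faceKeys (p : Equiv.Perm (Fin 5)) {I : ℕ} (h0 : I ≠ 0) (hI : I < 32)
    (i : Fin 5) : (faceKeys.getD (permLabel I p) 0).testBit i = I.testBit i := by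
  rw [(faceKeys_permLabel p h0 hI).2, faceKey]
  have : 32 * minUpTo (blkCode I (natFun p)) 9 + I = 2 ^ 5 * minUpTo (blkCode I (natFun p)) 9 + I :=
    rfl
  rw [this, Nat.testBit_two_pow_mul_add _ (by simpa using hI)]
  simp [i.2]

/-- The finite check `sheets_singular` covers the representatives; conjugation by the symmetry `g`
that reaches a representative carries an invariant block pattern over in both directions. -/
theorem permLabel_mem_singular (p : Equiv.Perm (Fin 5)) {I : ℕ} (h0 : I ≠ 0) (hI : I < 32) :
    permLabel I p ∈ singularVertices ↔
      ∃ m < 10, m ≠ 0 ∧ ∀ k < 5, blk I (natFun p k) = blk I (natFun p (dih m k)) := by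
  obtain ⟨g, hg⟩ := exists_sheet p
  set q := p * dihPerm g with hq
  have hpq : permLabel I p = permLabel I q :=
    (permLabel_eq_iff h0 hI h0 hI).2 ⟨rfl, (blkEquiv_mul_dihPerm I p g).symm⟩
  have := sheets_singular
  rw [List.all_eq_true] at this
  have := this _ hg
  rw [List.all_eq_true] at this
  have := this I (List.mem_range.2 hI)
  rw [Bool.or_eq_true, Nat.beq_eq] at this
  have := this.resolve_left h0
  rw [beq_iff_eq, Bool.eq_iff_iff, memNat_iff, List.any_eq_true] at this
  have hc : ∀ m, blkCode I (fun k => (permList q).getD k 0) m = blkCode I (natFun q) m := fun m => by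
    simp only [blkCode, natFun_permList q (dih_lt _ _)]
  rw [faceLabel, faceKey_congr I fun k hk => natFun_permList _ hk] at this
  change permLabel I q ∈ _ ↔ _ at this
  rw [hpq, this]
  have hlt : ∀ q : Equiv.Perm (Fin 5), ∀ k < 5, natFun q k < 5 := fun q k _ => natFun_lt _ k
  have hq' : ∀ k < 5, natFun q k = natFun p (dih g k) := fun k hk => natFun_mul_dihPerm p g hk
  constructor
  · rintro ⟨m, hm, h⟩
    rw [Nat.beq_eq, hc, hc, blkCode_eq_iff (hlt q) (hlt q)] at h
    have hm' : m < 10 ∧ m ≠ 0 := by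
      simp only [List.mem_cons, List.not_mem_nil, or_false] at hm; omega
    obtain ⟨n, hn, hn0, hmn⟩ := dih_conj g g.2 m hm'.1 hm'.2
    obtain ⟨g', hg', hgg⟩ := exists_dih_inv g g.2
    refine ⟨n, hn, hn0, fun k hk => ?_⟩
    have h1 := h (dih g' k) (dih_lt _ _)
    rw [dih_zero (dih_lt _ _), hq' _ (dih_lt _ _), hq' _ (dih_lt _ _), hmn _ (dih_lt _ _),
      (hgg k hk).1] at h1
    exact h1
  · rintro ⟨m, hm, hm0, h⟩
    obtain ⟨g', hg', hgg⟩ := exists_dih_inv g g.2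
    obtain ⟨n, hn, hn0, hmn⟩ := dih_conj g' hg' m hm hm0
    refine ⟨n, by simp only [List.mem_cons, List.not_mem_nil, or_false]; omega, ?_⟩
    rw [Nat.beq_eq, hc, hc, blkCode_eq_iff (hlt q) (hlt q)]
    intro k hk
    rw [dih_zero hk, hq' _ hk, hq' _ (dih_lt _ _), h _ (dih_lt _ _)]
    have := hmn (dih g k) (dih_lt _ _)
    rw [(hgg k hk).2] at this
    rw [← this, (hgg _ (dih_lt _ _)).1]

/-! ### Configurations of five points on the circle -/

/-- Congruence of real numbers modulo the integers. -/
def ModInt (x y : ℝ) : Prop := ∃ n : ℤ, x = y + n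

theorem ModInt.refl (x : ℝ) : ModInt x x := ⟨0, by simp⟩

theorem ModInt.symm {x y : ℝ} (h : ModInt x y) : ModInt y x := by
  obtain ⟨n, rfl⟩ := h
  exact ⟨-n, by simp⟩

theorem ModInt.trans {x y z : ℝ} (h : ModInt x y) (h' : ModInt y z) : ModInt x z := by
  obtain ⟨n, rfl⟩ := h
  obtain ⟨m, rfl⟩ := h'
  exact ⟨m + n, by push_cast; ring⟩

/-- The gaps between cyclically consecutive points of a configuration `e 0 ≤ … ≤ e 4 ≤ e 0 + 1`. -/
def gap (e : Fin 5 → ℝ) (i : Fin 5) : ℝ := e i - e (i - 1) + if i = 0 then 1 else 0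

theorem gap_zero (e : Fin 5 → ℝ) : gap e 0 = e 0 - e 4 + 1 := rfl
theorem gap_one (e : Fin 5 → ℝ) : gap e 1 = e 1 - e 0 := by simp [gap]
theorem gap_two (e : Fin 5 → ℝ) : gap e 2 = e 2 - e 1 := by
  have : (2 : Fin 5) - 1 = 1 := rfl
  simp [gap, this]
theorem gap_three (e : Fin 5 → ℝ) : gap e 3 = e 3 - e 2 := by
  have : (3 : Fin 5) - 1 = 2 := rfl
  simp [gap, this]
theorem gap_four (e : Fin 5 → ℝ) : gap e 4 = e 4 - e 3 := by
  have : (4 : Fin 5) - 1 = 3 := rfl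
  simp [gap, this]

theorem sum_gap (e : Fin 5 → ℝ) : ∑ i, gap e i = 1 := by
  rw [Fin.sum_univ_five, gap_zero, gap_one, gap_two, gap_three, gap_four]
  ring

theorem eq_of_gap_eq {e e' : Fin 5 → ℝ} (h : gap e = gap e') (hs : ∑ i, e i = ∑ i, e' i) :
    e = e' := by
  rw [Fin.sum_univ_five, Fin.sum_univ_five] at hs
  have h1 := congrFun h 1
  have h2 := congrFun h 2
  have h3 := congrFun h 3
  have h4 := congrFun h 4
  rw [gap_one, gap_one] at h1
  rw [gap_two, gap_two] at h2
  rw [gap_three, gap_three] at h3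
  rw [gap_four, gap_four] at h4
  ext i
  fin_cases i <;> simp only [Fin.zero_eta, Fin.mk_one, Fin.reduceFinMk] <;> linarith

/-- The configuration `d` modulo `ℤ`, in cyclic order, is the configuration `e` of sum `0`. -/
structure IsChamber (d : Fin 5 → ℝ) (p : Equiv.Perm (Fin 5)) (e : Fin 5 → ℝ) : Prop where
  gap_nonneg : ∀ i, 0 ≤ gap e i
  sum_eq : ∑ i, e i = 0
  modInt : ∀ k, ModInt (d k) (e (p k))

/-- Sorting the fractional parts gives a cyclically ordered configuration whose sum is a natural
number; rotating the cyclic order then lowers the sum one unit at a time. -/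
theorem exists_isChamber {d : Fin 5 → ℝ} (hd : ∑ k, d k = 0) : ∃ p e, IsChamber d p e := by
  have key : ∀ n : ℕ, ∀ (p : Equiv.Perm (Fin 5)) (e : Fin 5 → ℝ), (∀ i, 0 ≤ gap e i) →
      ∑ i, e i = n → (∀ k, ModInt (d k) (e (p k))) → ∃ p e, IsChamber d p e := by
    intro n
    induction n with
    | zero => exact fun p e h1 h2 h3 => ⟨p, e, h1, by simpa using h2, h3⟩
    | succ n ih =>
      intro p e h1 h2 h3
      -- The last point is moved down by a full turn and becomes the first. The gaps are merely
      -- rotated, and the sum drops by 1.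
      refine ih (p.trans (Equiv.addRight 1)) (fun i => e (i - 1) - if i = 0 then 1 else 0) ?_ ?_ ?_
      · intro i
        have : gap (fun i => e (i - 1) - if i = 0 then 1 else 0) i = gap e (i - 1) := by
          simp only [gap, sub_eq_zero]
          ring
        rw [this]
        exact h1 _
      · have : ∑ i, e (i - 1) = ∑ i, e i := Equiv.sum_comp (Equiv.subRight (1 : Fin 5)) e
        rw [Finset.sum_sub_distrib, this, h2]
        simp
      · intro k
        refine (h3 k).trans ?_
        refine ⟨if p k + 1 = 0 then 1 else 0, ?_⟩
        simp only [Equiv.trans_apply, Equiv.coe_addRight, add_sub_cancel_right]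
        split_ifs with h <;> simp [h]
  set f : Fin 5 → ℝ := fun k => Int.fract (d k) with hf
  have hmono := Tuple.monotone_sort f
  set s := Tuple.sort f with hs
  have h0 : ∀ i, 0 ≤ f (s i) := fun i => Int.fract_nonneg _
  have h1 : ∀ i, f (s i) < 1 := fun i => Int.fract_lt_one _
  have hsum : ∑ i, f (s i) = ((-∑ k, ⌊d k⌋ : ℤ) : ℝ) := by
    rw [Equiv.sum_comp s f]
    simp only [hf, Int.fract, Finset.sum_sub_distrib, hd]
    push_cast
    ring
  have hnn : 0 ≤ -∑ k, ⌊d k⌋ := by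
    have : 0 ≤ ∑ i, f (s i) := Finset.sum_nonneg fun i _ => h0 i
    rw [hsum] at this
    exact_mod_cast this
  obtain ⟨n, hn⟩ := Int.eq_ofNat_of_zero_le hnn
  refine key n s.symm (fun i => f (s i)) ?_ ?_ ?_
  · intro i
    have m1 : f (s 0) ≤ f (s 1) := hmono (by decide)
    have m2 : f (s 1) ≤ f (s 2) := hmono (by decide)
    have m3 : f (s 2) ≤ f (s 3) := hmono (by decide)
    have m4 : f (s 3) ≤ f (s 4) := hmono (by decide)
    fin_cases i
    · have := h1 4; have := h0 0
      exact (gap_zero _).symm ▸ (by linarith : 0 ≤ f (s 0) - f (s 4) + 1)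
    · exact (gap_one _).symm ▸ sub_nonneg.2 m1
    · exact (gap_two _).symm ▸ sub_nonneg.2 m2
    · exact (gap_three _).symm ▸ sub_nonneg.2 m3
    · exact (gap_four _).symm ▸ sub_nonneg.2 m4
  · rw [hsum, hn]; rfl
  · intro k
    simp only [Equiv.apply_symm_apply, hf]
    exact ⟨⌊d k⌋, (Int.fract_add_floor _).symm⟩

section Chamber

variable {e : Fin 5 → ℝ} (he : ∀ i, 0 ≤ gap e i)
include he

theorem chamber_le : e 0 ≤ e 1 ∧ e 1 ≤ e 2 ∧ e 2 ≤ e 3 ∧ e 3 ≤ e 4 ∧ e 4 ≤ e 0 + 1 := by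
  have h0 := he 0; have h1 := he 1; have h2 := he 2; have h3 := he 3; have h4 := he 4
  rw [gap_zero] at h0
  rw [gap_one] at h1
  rw [gap_two] at h2
  rw [gap_three] at h3
  rw [gap_four] at h4
  refine ⟨?_, ?_, ?_, ?_, ?_⟩ <;> linarith

/-- The sum of floors counts, up to a shift, the points of the periodic configuration not exceeding
`t`. All points lie within one period, so each floor is pinned by the side of `e j` on which `t`
lies; the 4 is the number of other points. -/
theorem chamber_le_iff (j : Fin 5) (t : ℝ) : e j ≤ t ↔ (j : ℤ) - 4 ≤ ∑ i, ⌊t - e i⌋ := by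
  obtain ⟨h0, h1, h2, h3, h4⟩ := chamber_le he
  rw [Fin.sum_univ_five]
  have hle : ∀ i, ∀ z : ℤ, e i ≤ t - z → z ≤ ⌊t - e i⌋ := fun i z h =>
    Int.le_floor.2 (by linarith)
  have hlt : ∀ i, ∀ z : ℤ, t - z < e i → ⌊t - e i⌋ ≤ z - 1 := fun i z h => by
    have : ⌊t - e i⌋ < z := Int.floor_lt.2 (by linarith)
    omega
  constructor
  · intro h
    have hm : ∀ i, -1 ≤ ⌊t - e i⌋ := by
      intro i
      refine hle i (-1) ?_
      push_cast
      fin_cases i <;> fin_cases j <;>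
        simp only [Fin.zero_eta, Fin.mk_one, Fin.reduceFinMk] at h ⊢ <;> linarith
    have h' : ∀ i ≤ j, 0 ≤ ⌊t - e i⌋ := by
      intro i hij
      refine hle i 0 ?_
      push_cast
      fin_cases i <;> fin_cases j <;>
        simp only [Fin.zero_eta, Fin.mk_one, Fin.reduceFinMk] at h hij ⊢ <;>
        first | linarith | exact absurd hij (by decide)
    have m0 := hm 0; have m1 := hm 1; have m2 := hm 2; have m3 := hm 3; have m4 := hm 4
    fin_cases j
    · have := h' 0 (by decide); simp; omega
    · have := h' 0 (by decide); have := h' 1 (by decide); simp; omega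
    · have := h' 0 (by decide); have := h' 1 (by decide); have := h' 2 (by decide); simp; omega
    · have := h' 0 (by decide); have := h' 1 (by decide); have := h' 2 (by decide)
      have := h' 3 (by decide); simp; omega
    · have := h' 0 (by decide); have := h' 1 (by decide); have := h' 2 (by decide)
      have := h' 3 (by decide); have := h' 4 (by decide); simp; omega
  · intro hC
    by_contra h
    push Not at h
    have hm : ∀ i, ⌊t - e i⌋ ≤ 0 := by
      intro i
      refine hlt i 1 ?_
      push_cast
      fin_cases i <;> fin_cases j <;>
        simp only [Fin.zero_eta, Fin.mk_one, Fin.reduceFinMk] at h ⊢ <;> linarith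
    have h' : ∀ i, j ≤ i → ⌊t - e i⌋ ≤ -1 := by
      intro i hij
      refine hlt i 0 ?_
      push_cast
      fin_cases i <;> fin_cases j <;>
        simp only [Fin.zero_eta, Fin.mk_one, Fin.reduceFinMk] at h hij ⊢ <;>
        first | linarith | exact absurd hij (by decide)
    have m0 := hm 0; have m1 := hm 1; have m2 := hm 2; have m3 := hm 3; have m4 := hm 4
    fin_cases j
    · have := h' 0 (by decide); have := h' 1 (by decide); have := h' 2 (by decide)
      have := h' 3 (by decide); have := h' 4 (by decide); simp at hC; omega
    · have := h' 1 (by decide); have := h' 2 (by decide)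
      have := h' 3 (by decide); have := h' 4 (by decide); simp at hC; omega
    · have := h' 2 (by decide)
      have := h' 3 (by decide); have := h' 4 (by decide); simp at hC; omega
    · have := h' 3 (by decide); have := h' 4 (by decide); simp at hC; omega
    · have := h' 4 (by decide); simp at hC; omega

end Chamber

/-- The counting function of an ordered lift equals `∑ ⌊t - d k⌋ + ∑ d k`, which depends only on
`d`; by `chamber_le_iff` it determines every `e j`. -/
theorem IsChamber.unique {d : Fin 5 → ℝ} {p p' : Equiv.Perm (Fin 5)} {e e' : Fin 5 → ℝ}
    (h : IsChamber d p e) (h' : IsChamber d p' e') : e = e' := by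
  have key : ∀ {p : Equiv.Perm (Fin 5)} {e : Fin 5 → ℝ}, IsChamber d p e → ∀ t : ℝ,
      ((∑ i, ⌊t - e i⌋ : ℤ) : ℝ) = ∑ k, (⌊t - d k⌋ : ℝ) + ∑ k, d k := by
    intro p e h t
    choose n hn using h.modInt
    have h1 : ∑ k, d k = ∑ k, (n k : ℝ) := by
      simp_rw [hn, Finset.sum_add_distrib]
      rw [Equiv.sum_comp p e, h.sum_eq, zero_add]
    rw [h1, ← Finset.sum_add_distrib, ← Equiv.sum_comp p]
    push_cast
    refine Finset.sum_congr rfl fun k _ => ?_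
    rw [hn k, ← sub_sub, Int.floor_sub_intCast]
    push_cast
    ring
  have hC : ∀ t : ℝ, ∑ i, ⌊t - e i⌋ = ∑ i, ⌊t - e' i⌋ := fun t => by
    have := (key h t).trans (key h' t).symm
    exact_mod_cast this
  have hiff : ∀ j t, e j ≤ t ↔ e' j ≤ t := fun j t => by
    rw [chamber_le_iff h.gap_nonneg, chamber_le_iff h'.gap_nonneg, hC]
  ext j
  exact le_antisymm ((hiff j _).2 le_rfl) ((hiff j _).1 le_rfl)

theorem blk_eq_of_between : ∀ I < 32, ∀ a b : Fin 5, a < b →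
    (∀ i : Fin 5, a < i → i ≤ b → I.testBit i = false) → I = 0 ∨ blk I a = blk I b := by
  decide +kernel

theorem blk_eq_of_outside : ∀ I < 32, ∀ a b : Fin 5, a < b →
    (∀ i : Fin 5, i ≤ a ∨ b < i → I.testBit i = false) → I = 0 ∨ blk I a = blk I b := by
  decide +kernel

/-- Congruent points of a chamber are equal or a full turn apart, so all gaps on one of the two arcs
between them vanish and no cut of `I` separates them. For `I = 0` there are no cuts and `blk` takes
a meaningless default value. -/
theorem blk_eq_of_modInt {e : Fin 5 → ℝ} (he : ∀ i, 0 ≤ gap e i) {I : ℕ} (hI : I < 32)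
    (hI0 : I ≠ 0) (hsupp : ∀ i : Fin 5, I.testBit i = true → gap e i ≠ 0) {a b : Fin 5}
    (hab : ModInt (e a) (e b)) : blk I a = blk I b := by
  wlog h : a < b generalizing a b
  · rcases (not_lt.1 h).eq_or_lt with rfl | h
    · rfl
    · exact (this hab.symm h).symm
  obtain ⟨h0, h1, h2, h3, h4⟩ := chamber_le he
  have hb : ∀ i : Fin 5, gap e i = 0 → I.testBit i = false := fun i hi => by
    rw [Bool.eq_false_iff]
    exact fun h => hsupp i h hi
  have hg : ∀ i : Fin 5, gap e i ≤ 0 → I.testBit i = false := fun i hi =>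
    hb i (le_antisymm hi (he i))
  obtain ⟨n, hn⟩ := hab
  -- The order `a < b` gives `e a ≤ e b ≤ e a + 1`, leaving two possible integers; they correspond
  -- to the two arcs.
  have hn0 : n = 0 ∨ n = -1 := by
    have h5 : (-2 : ℝ) < n := by
      fin_cases a <;> fin_cases b <;>
        simp only [Fin.zero_eta, Fin.mk_one, Fin.reduceFinMk] at hn <;> linarith
    have h6 : (n : ℝ) < 1 := by
      fin_cases a <;> fin_cases b <;>
        simp only [Fin.zero_eta, Fin.mk_one, Fin.reduceFinMk] at hn h <;>
        first | linarith | exact absurd h (by decide)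
    have h5 : -2 < n := by exact_mod_cast h5
    have h6 : n < 1 := by exact_mod_cast h6
    omega
  have hle : ∀ i j : Fin 5, i ≤ j → e i ≤ e j := by
    intro i j hij
    fin_cases i <;> fin_cases j <;>
      simp only [Fin.zero_eta, Fin.mk_one, Fin.reduceFinMk] at hij ⊢ <;>
      first | linarith | exact absurd hij (by decide)
  have hpos : ∀ i : Fin 5, i ≠ 0 → gap e i = e i - e (i - 1) := fun i hi => by simp [gap, hi]
  rcases hn0 with rfl | rfl
  · refine (blk_eq_of_between I hI a b h ?_).resolve_left hI0
    intro i hai hib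
    have hi0 : i ≠ 0 := fun h => by rw [h] at hai; exact absurd hai (by simp)
    apply hg
    rw [hpos i hi0]
    have e1 := hle i b hib
    have e2 := hle a (i - 1) (by
      clear * - hai; revert a i; decide)
    push_cast at hn
    linarith
  · refine (blk_eq_of_outside I hI a b h ?_).resolve_left hI0
    intro i hi
    apply hg
    push_cast at hn
    have ea := hle 0 a (Fin.zero_le _)
    have eb := hle b 4 (Fin.le_last b)
    by_cases hi0 : i = 0
    · subst hi0
      rw [gap_zero]
      linarith
    rw [hpos i hi0]
    rcases hi with hi | hi
    · have e1 := hle i a hi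
      have e2 := hle 0 (i - 1) (Fin.zero_le _)
      linarith
    · have e1 := hle i 4 (Fin.le_last i)
      have e2 := hle b (i - 1) (by clear * - hi; revert b i; decide)
      linarith

/-- Across a position not in `I` the gap vanishes, so a point is congruent to its predecessor; `blk`
walks back through such positions to the start of the block. -/
theorem modInt_blk {e : Fin 5 → ℝ} {I : ℕ} 
    (hsupp : ∀ i : Fin 5, I.testBit i = false → gap e i = 0) (a : Fin 5) {b : Fin 5}
    (hb : blk I a = b) : ModInt (e a) (e b) := by
  have step : ∀ i : Fin 5, I.testBit i = false → ModInt (e i) (e (i + 4)) := by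
    intro i hi
    have := hsupp i hi
    have hi' : i + 4 = i - 1 := (by decide : ∀ i : Fin 5, i + 4 = i - 1) i
    rw [hi']
    rw [gap] at this
    refine ⟨if i = 0 then -1 else 0, ?_⟩
    split_ifs at this ⊢ <;> push_cast <;> linarith
  have main : ∀ a b : Fin 5, ∀ t0 t1 t2 t3 : Bool, I.testBit a = t0 → I.testBit (a + 4 : Fin 5) = t1 →
      I.testBit (a + 3 : Fin 5) = t2 → I.testBit (a + 2 : Fin 5) = t3 →
      (bif t0 then a else bif t1 then a + 4 else bif t2 then a + 3 else bif t3 then a + 2 else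
        a + 1) = b → ModInt (e a) (e b) := by
    intro a b t0 t1 t2 t3 h0 h1 h2 h3 h
    have e4 : a + 4 + 4 = a + 3 := (by decide : ∀ a : Fin 5, a + 4 + 4 = a + 3) a
    have e3 : a + 3 + 4 = a + 2 := (by decide : ∀ a : Fin 5, a + 3 + 4 = a + 2) a
    have e2 : a + 2 + 4 = a + 1 := (by decide : ∀ a : Fin 5, a + 2 + 4 = a + 1) a
    cases t0
    swap
    · subst h; exact ModInt.refl _
    have s0 := step _ h0
    cases t1
    swap
    · subst h; exact s0
    have s1 := step _ h1
    rw [e4] at s1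
    cases t2
    swap
    · subst h; exact s0.trans s1
    have s2 := step _ h2
    rw [e3] at s2
    cases t3
    swap
    · subst h; exact (s0.trans s1).trans s2
    have s3 := step _ h3
    rw [e2] at s3
    subst h
    exact ((s0.trans s1).trans s2).trans s3
  refine main a b _ _ _ _ rfl rfl rfl rfl (Fin.val_injective ?_)
  rw [← hb, blk]
  have v4 : ((a + 4 : Fin 5) : ℕ) = (a.val + 4) % 5 := rfl
  have v3 : ((a + 3 : Fin 5) : ℕ) = (a.val + 3) % 5 := rfl
  have v2 : ((a + 2 : Fin 5) : ℕ) = (a.val + 2) % 5 := rfl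
  have v1 : ((a + 1 : Fin 5) : ℕ) = (a.val + 1) % 5 := rfl
  rw [v4, v3, v2]
  cases I.testBit a.val <;> cases I.testBit ((a.val + 4) % 5) <;>
    cases I.testBit ((a.val + 3) % 5) <;> cases I.testBit ((a.val + 2) % 5) <;> rfl

/-! ### Barycentric coordinates -/

/-- The set of the first `k + 1` elements in an ordering. -/
def flagMask (f : Equiv.Perm (Fin 5)) (k : Fin 5) : ℕ :=
  ((permList f).take (k + 1)).foldl (fun I a => Nat.lor I (Nat.shiftLeft 1 a)) 0

theorem testBit_lor_shiftLeft {I a i : ℕ} :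
    (Nat.lor I (Nat.shiftLeft 1 a)).testBit i = true ↔ I.testBit i = true ∨ i = a := by
  have : Nat.shiftLeft 1 a = 1 <<< a := rfl
  rw [testBit_lor, this, Nat.one_shiftLeft, Nat.testBit_two_pow, decide_eq_true_eq, eq_comm (a := i)]

theorem testBit_foldl_lor {l : List ℕ} {I i : ℕ} :
    (l.foldl (fun I a => Nat.lor I (Nat.shiftLeft 1 a)) I).testBit i = true ↔
      I.testBit i = true ∨ i ∈ l := by
  induction l generalizing I with
  | nil => simp
  | cons a l ih =>
    rw [List.foldl_cons, ih, testBit_lor_shiftLeft, List.mem_cons, or_assoc]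

theorem testBit_flagMask {f : Equiv.Perm (Fin 5)} {k : Fin 5} {i : ℕ} :
    (flagMask f k).testBit i = true ↔ ∃ j ≤ k, (f j).val = i := by
  rw [flagMask, testBit_foldl_lor]
  simp only [Nat.zero_testBit, Bool.false_eq_true, false_or]
  fin_cases k <;> simp [permList, Fin.exists_fin_succ, eq_comm]

theorem testBit_flagMask_fin {f : Equiv.Perm (Fin 5)} {k i : Fin 5} :
    (flagMask f k).testBit i = true ↔ f.symm i ≤ k := by
  rw [testBit_flagMask]
  constructor
  · rintro ⟨j, hj, h⟩
    rw [Fin.val_injective h.symm]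
    simpa using hj
  · exact fun h => ⟨f.symm i, h, by simp⟩

theorem flagMask_lt (f : Equiv.Perm (Fin 5)) (k : Fin 5) : flagMask f k < 32 := by
  refine Nat.lt_pow_two_of_testBit (n := 5) _ fun i hi => ?_
  rw [Bool.eq_false_iff, ne_eq, testBit_flagMask]
  rintro ⟨j, -, rfl⟩
  exact absurd (f j).2 (by omega)

theorem flagMask_ne_zero (f : Equiv.Perm (Fin 5)) (k : Fin 5) : flagMask f k ≠ 0 := by
  intro h
  have : (flagMask f k).testBit (f k) = true := testBit_flagMask.2 ⟨k, le_rfl, rfl⟩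
  rw [h] at this
  simp at this

theorem flagMask_injective (f : Equiv.Perm (Fin 5)) : Function.Injective (flagMask f) := by
  intro k l h
  have h1 : ∀ i, f.symm i ≤ k ↔ f.symm i ≤ l := fun i => by
    rw [← testBit_flagMask_fin, ← testBit_flagMask_fin, h]
  apply le_antisymm
  · have := h1 (f k); simpa using this
  · have := h1 (f l); simpa using this

theorem evalFirst_eq {α : Type*} (f : ℕ → α) (n : ℕ) : evalFirst f n = f n := by
  cases n <;> rfl

theorem testBit_flagFacet {p : ℕ → ℕ} {l : List ℕ} {I m j : ℕ} :
    (flagFacet p I l m).testBit j = true ↔ m.testBit j = true ∨ ∃ n < l.length,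
      j = faceLabel ((l.take (n + 1)).foldl (fun I a => Nat.lor I (Nat.shiftLeft 1 a)) I) p := by
  induction l generalizing I m with
  | nil => simp [flagFacet]
  | cons a l ih =>
    rw [flagFacet, evalFirst_eq, evalFirst_eq, ih, testBit_lor_shiftLeft, or_assoc]
    apply or_congr_right
    constructor
    · rintro (h | ⟨n, hn, h⟩)
      · exact ⟨0, by simp, by simpa using h⟩
      · exact ⟨n + 1, by simpa using hn, by simpa using h⟩
    · rintro ⟨n, hn, h⟩
      cases n with
      | zero => exact Or.inl (by simpa using h)
      | succ n => exact Or.inr ⟨n, by simpa using hn, by simpa using h⟩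

/-- The label of the face spanned by the first `k + 1` vertices. -/
def flagLabel (p f : Equiv.Perm (Fin 5)) (k : Fin 5) : ℕ := permLabel (flagMask f k) p

theorem flagLabel_lt (p f : Equiv.Perm (Fin 5)) (k : Fin 5) : flagLabel p f k < 92 :=
  (faceKeys_permLabel p (flagMask_ne_zero f k) (flagMask_lt f k)).1

theorem flagLabel_eq_iff {p f p' f' : Equiv.Perm (Fin 5)} {k k' : Fin 5} :
    flagLabel p f k = flagLabel p' f' k' ↔ flagMask f k = flagMask f' k' ∧
      BlkEquiv (flagMask f k) (natFun p) (natFun p') :=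
  permLabel_eq_iff (flagMask_ne_zero f k) (flagMask_lt f k) (flagMask_ne_zero f' k')
    (flagMask_lt f' k')

theorem flagLabel_injective (p f : Equiv.Perm (Fin 5)) : Function.Injective (flagLabel p f) :=
  fun _ _ h => flagMask_injective f (flagLabel_eq_iff.1 h).1

/-- A flag over any permutation has the same labels as over its representative sheet, so the facets
listed for the twelve sheets suffice. -/
theorem exists_facet (p f : Equiv.Perm (Fin 5)) :
    ∃ F ∈ orbFacets, ∀ k, F.testBit (flagLabel p f k) = true := by
  obtain ⟨m, hm⟩ := exists_sheet p
  refine ⟨_, List.mem_flatMap.2 ⟨_, hm, List.mem_map.2 ⟨_, permList_mem f, rfl⟩⟩, fun k => ?_⟩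
  rw [testBit_flagFacet]
  refine Or.inr ⟨k, k.2, ?_⟩
  rw [faceLabel, faceKey_congr _ fun k hk => natFun_permList _ hk]
  change _ = permLabel (flagMask f k) _
  exact (permLabel_eq_iff (flagMask_ne_zero f k) (flagMask_lt f k) (flagMask_ne_zero f k)
    (flagMask_lt f k)).2 ⟨rfl, (blkEquiv_mul_dihPerm _ p m).symm⟩

theorem exists_flag_of_facet {F : ℕ} (hF : F ∈ orbFacets) : ∃ p f : Equiv.Perm (Fin 5),
    ∀ j, F.testBit j = true → ∃ k, j = flagLabel p f k := by
  obtain ⟨l, hl, hF⟩ := List.mem_flatMap.1 hF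
  obtain ⟨l', hl', rfl⟩ := List.mem_map.1 hF
  obtain ⟨p, rfl⟩ := exists_permList (List.mem_of_mem_filter hl)
  obtain ⟨f, rfl⟩ := exists_permList hl'
  refine ⟨p, f, fun j hj => ?_⟩
  rw [testBit_flagFacet] at hj
  simp only [Nat.zero_testBit, Bool.false_eq_true, false_or] at hj
  obtain ⟨n, hn, h⟩ := hj
  refine ⟨⟨n, hn⟩, ?_⟩
  rw [faceLabel, faceKey_congr _ fun k hk => natFun_permList _ hk] at h
  exact h

/-- Differences of consecutive values of `g` in the given order. -/
def descent (g : Fin 5 → ℝ) (f : Equiv.Perm (Fin 5)) (k : Fin 5) : ℝ :=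
  g (f k) - if k = 4 then 0 else g (f (k + 1))

theorem sum_Ici_descent (g : Fin 5 → ℝ) (f : Equiv.Perm (Fin 5)) (j : Fin 5) :
    ∑ k, (if j ≤ k then descent g f k else 0) = g (f j) := by
  fin_cases j <;> simp [Fin.sum_univ_five, descent]

/-- Abel summation: `g` is the sum of `descent g f k` times the indicator of the first `k + 1`
vertices, and that indicator is `k + 1` times the barycentre of the face. This explains the factor
in `flagVector`. -/
theorem sum_mul_descent (g : Fin 5 → ℝ) (f : Equiv.Perm (Fin 5)) :
    ∑ k : Fin 5, ((k : ℝ) + 1) * descent g f k = ∑ i, g i := by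
  rw [← Equiv.sum_comp f g]
  simp [Fin.sum_univ_five, descent]
  ring

/-- The vector of barycentric coordinates of a point with gaps `g`. -/
def flagVector (p : Equiv.Perm (Fin 5)) (g : Fin 5 → ℝ) (f : Equiv.Perm (Fin 5)) : ℕ → ℝ :=
  ∑ k : Fin 5, (((k : ℝ) + 1) * descent g f k) • Pi.single (flagLabel p f k) 1

theorem flagVector_apply (p f : Equiv.Perm (Fin 5)) (g : Fin 5 → ℝ) (k : Fin 5) :
    flagVector p g f (flagLabel p f k) = ((k : ℝ) + 1) * descent g f k := by
  rw [flagVector, Finset.sum_apply, Finset.sum_eq_single k]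
  · simp
  · intro l _ hl
    have : flagLabel p f k ≠ flagLabel p f l := fun h => hl (flagLabel_injective p f h).symm
    simp [this]
  · simp

theorem flagVector_ne_zero {p f : Equiv.Perm (Fin 5)} {g : Fin 5 → ℝ} {j : ℕ}
    (h : flagVector p g f j ≠ 0) : ∃ k, j = flagLabel p f k ∧ descent g f k ≠ 0 := by
  rw [flagVector, Finset.sum_apply] at h
  obtain ⟨k, -, hk⟩ := Finset.exists_ne_zero_of_sum_ne_zero h
  simp only [Pi.smul_apply, smul_eq_mul, Pi.single_apply, mul_ite, mul_one, mul_zero, ne_eq,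
    ite_eq_right_iff, not_forall] at hk
  exact ⟨k, hk.1, fun h => hk.2 (by rw [h, mul_zero])⟩

/-- The ordering `f` lists the gaps in decreasing order. -/
def IsSorted (g : Fin 5 → ℝ) (f : Equiv.Perm (Fin 5)) : Prop := Antitone (g ∘ f)

theorem exists_isSorted (g : Fin 5 → ℝ) : ∃ f, IsSorted g f := by
  refine ⟨Tuple.sort (fun i => -g i), fun i j hij => ?_⟩
  have := Tuple.monotone_sort (fun i => -g i) hij
  simpa using this

section Sorted

variable {g : Fin 5 → ℝ} {f : Equiv.Perm (Fin 5)} (hf : IsSorted g f) (hg : ∀ i, 0 ≤ g i)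
include hf hg

theorem descent_nonneg (k : Fin 5) : 0 ≤ descent g f k := by
  unfold descent
  split_ifs with h
  · simpa using hg _
  · have : k ≤ k + 1 := by
      rw [Fin.le_def, Fin.val_add_one_of_lt (Fin.lt_last_iff_ne_last.2 h)]; omega
    exact sub_nonneg.2 (hf this)

theorem pos_of_descent_ne_zero {k : Fin 5} (h : descent g f k ≠ 0) : 0 < g (f k) := by
  have h1 := lt_of_le_of_ne (descent_nonneg hf hg k) (Ne.symm h)
  unfold descent at h1
  split_ifs at h1
  · simpa using h1
  · have := hg (f (k + 1)); linarith

theorem gap_ne_zero_of_testBit {k : Fin 5} (h : descent g f k ≠ 0) (i : Fin 5)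
    (hi : (flagMask f k).testBit i = true) : g i ≠ 0 := by
  rw [testBit_flagMask_fin] at hi
  have h1 := pos_of_descent_ne_zero hf hg h
  have h2 : g (f k) ≤ g (f (f.symm i)) := hf hi
  rw [f.apply_symm_apply] at h2
  linarith

omit hf hg in
-- For the last nonzero descent, everything later telescopes to zero, so the corresponding face
-- contains the support of `g`.
theorem exists_top (hne : ∃ i, g i ≠ 0) : ∃ k, descent g f k ≠ 0 ∧
    ∀ i : Fin 5, (flagMask f k).testBit i = false → g i = 0 := by
  classical
  by_contra hcon
  push Not at hcon
  have key : ∀ k : Fin 5, (∀ l, k < l → descent g f l = 0) → g (f k) = descent g f k := by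
    intro k hk
    rw [← sum_Ici_descent g f k, Finset.sum_eq_single k]
    · simp
    · intro l _ hl
      split_ifs with h
      · exact hk l (lt_of_le_of_ne h (Ne.symm hl))
      · rfl
    · simp
  obtain ⟨i, hi⟩ := hne
  have hex : ∃ k, descent g f k ≠ 0 := by
    by_contra h
    push Not at h
    have := key (f.symm i) (fun l _ => h l)
    rw [h, f.apply_symm_apply] at this
    exact hi this
  set S := Finset.univ.filter fun k => descent g f k ≠ 0 with hS
  have hSne : S.Nonempty := by
    obtain ⟨k, hk⟩ := hex
    exact ⟨k, by simp [hS, hk]⟩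
  have hk := Finset.max'_mem S hSne
  set k := S.max' hSne with hkdef
  have hkd : descent g f k ≠ 0 := (Finset.mem_filter.1 hk).2
  have hmax : ∀ l, k < l → descent g f l = 0 := fun l hl => by
    by_contra h
    have := S.le_max' l (by simp [hS, h])
    exact absurd hl (not_lt.2 this)
  obtain ⟨i, hi, hgi⟩ := hcon k hkd
  have hi' : k < f.symm i := by
    rw [← not_le, ← testBit_flagMask_fin, hi]; simp
  have := key (f.symm i) (fun l hl => hmax l (hi'.trans hl))
  rw [hmax _ hi', f.apply_symm_apply] at this
  exact hgi this

theorem flagVector_nonneg (p : Equiv.Perm (Fin 5)) (j : ℕ) : 0 ≤ flagVector p g f j := by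
  rw [flagVector, Finset.sum_apply]
  refine Finset.sum_nonneg fun k _ => ?_
  simp only [Pi.smul_apply, smul_eq_mul, Pi.single_apply]
  have := descent_nonneg hf hg k
  split_ifs <;> positivity

theorem flagVector_mem (p : Equiv.Perm (Fin 5)) : flagVector p g f ∈ simplicialCone orbFacets := by
  obtain ⟨F, hF, h⟩ := exists_facet p f
  refine ⟨flagVector_nonneg hf hg p, F, hF, fun j hj => ?_⟩
  obtain ⟨k, rfl, -⟩ := flagVector_ne_zero hj
  exact h k

end Sorted

theorem comp_eq_of_isSorted {g : Fin 5 → ℝ} {f f' : Equiv.Perm (Fin 5)} (h : IsSorted g f)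
    (h' : IsSorted g f') : g ∘ f = g ∘ f' := by
  have h1 : Monotone ((fun i => -g i) ∘ f) := fun i j hij => neg_le_neg (h hij)
  have h2 : Monotone ((fun i => -g i) ∘ f') := fun i j hij => neg_le_neg (h' hij)
  have := Tuple.unique_monotone h1 h2
  funext i
  have := congrFun this i
  simpa using this

/-- A strict drop after position `k` makes the first `k + 1` entries a superlevel set of `g`, which
does not depend on how ties are ordered. -/
theorem flagMask_subset {g : Fin 5 → ℝ} {f f' : Equiv.Perm (Fin 5)} (h : IsSorted g f)
    (h' : IsSorted g f') (hg : ∀ i, 0 ≤ g i) {k : Fin 5} (hk : descent g f k ≠ 0) {i : Fin 5}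
    (hi : f.symm i ≤ k) : f'.symm i ≤ k := by
  by_contra hcon
  push Not at hcon
  have hc := congrFun (comp_eq_of_isSorted h h')
  have hk' : 0 < descent g f k := lt_of_le_of_ne (descent_nonneg h hg k) (Ne.symm hk)
  have hk4 : k ≠ 4 := fun hk4 => absurd hcon (by rw [hk4]; exact not_lt.2 (Fin.le_last _))
  rw [descent, if_neg hk4] at hk'
  have h1 : k + 1 ≤ f'.symm i := by
    rw [Fin.le_def, Fin.val_add_one_of_lt (Fin.lt_last_iff_ne_last.2 hk4)]
    exact hcon
  have h2 : g (f k) ≤ g (f (f.symm i)) := h hi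
  have h3 : g (f' (f'.symm i)) ≤ g (f' (k + 1)) := h' h1
  have h4 : g (f (k + 1)) = g (f' (k + 1)) := hc (k + 1)
  rw [Equiv.apply_symm_apply] at h2 h3
  linarith

theorem flagMask_eq {g : Fin 5 → ℝ} {f f' : Equiv.Perm (Fin 5)} (h : IsSorted g f)
    (h' : IsSorted g f') (hg : ∀ i, 0 ≤ g i) {k : Fin 5} (hk : descent g f k ≠ 0) :
    flagMask f k = flagMask f' k := by
  have hd : descent g f' k = descent g f k := by
    have hc := congrFun (comp_eq_of_isSorted h h')
    simp only [Function.comp_apply] at hc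
    simp only [descent, hc]
  apply Nat.eq_of_testBit_eq
  intro i
  rcases Nat.lt_or_ge i 5 with hi | hi
  · rw [Bool.eq_iff_iff]
    have h1 := testBit_flagMask_fin (f := f) (k := k) (i := ⟨i, hi⟩)
    have h2 := testBit_flagMask_fin (f := f') (k := k) (i := ⟨i, hi⟩)
    rw [h1, h2]
    exact ⟨flagMask_subset h h' hg hk, flagMask_subset h' h hg (by rwa [hd])⟩
  · have key : ∀ f, flagMask f k < 2 ^ i := fun f =>
      ((flagMask_lt f k).trans_eq (by norm_num : 32 = 2 ^ 5)).trans_le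
        (Nat.pow_le_pow_right (by norm_num) hi)
    rw [Nat.testBit_lt_two_pow (key f), Nat.testBit_lt_two_pow (key f')]

/-- `y` is the vector of barycentric coordinates of the configuration `d` modulo symmetries. -/
def HasCoord (d : Fin 5 → ℝ) (y : ℕ → ℝ) : Prop :=
  ∃ p e f, IsChamber d p e ∧ IsSorted (gap e) f ∧ y = flagVector p (gap e) f

/-- Two configurations on the circle differ by a symmetry of the pentagon. -/
def DihEquiv (d d' : Fin 5 → ℝ) : Prop := ∃ m, ∀ k, ModInt (d' k) (d (dihPerm m k))

theorem exists_hasCoord {d : Fin 5 → ℝ} (hd : ∑ k, d k = 0) : ∃ y, HasCoord d y := by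
  obtain ⟨p, e, h⟩ := exists_isChamber hd
  obtain ⟨f, hf⟩ := exists_isSorted (gap e)
  exact ⟨_, p, e, f, h, hf, rfl⟩

/-- The ordered lift is unique, and two sorting orders differ only at ties, where the descent
vanishes. Two labellings of the same lift have congruent points at each index, hence the same blocks
on every face in the support and the same vertex labels. -/
theorem HasCoord.eq {d d' : Fin 5 → ℝ} {y y' : ℕ → ℝ} (h : HasCoord d y) (h' : HasCoord d' y')
    (hdd : DihEquiv d d') : y = y' := by
  obtain ⟨p, e, f, he, hf, rfl⟩ := h
  obtain ⟨p', e', f', he', hf', rfl⟩ := h'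
  obtain ⟨m, hm⟩ := hdd
  have hq : IsChamber d' (p * dihPerm m) e :=
    ⟨he.gap_nonneg, he.sum_eq, fun k => (hm k).trans (he.modInt _)⟩
  obtain rfl := hq.unique he'
  have hc := congrFun (comp_eq_of_isSorted hf hf')
  simp only [Function.comp_apply] at hc
  refine Finset.sum_congr rfl fun k _ => ?_
  have hd : descent (gap e) f' k = descent (gap e) f k := by simp only [descent, hc]
  rw [hd]
  by_cases h0 : descent (gap e) f k = 0
  · simp [h0]
  suffices hl : flagLabel p f k = flagLabel p' f' k by rw [hl]
  rw [flagLabel_eq_iff]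
  refine ⟨flagMask_eq hf hf' he.gap_nonneg h0,
    BlkEquiv.trans (blkEquiv_mul_dihPerm _ p m).symm ⟨0, by norm_num, fun k' hk' => ?_⟩⟩
  have e1 := natFun_val (p * dihPerm m) ⟨k', hk'⟩
  have e2 := natFun_val p' ⟨k', hk'⟩
  simp only at e1 e2
  rw [dih_zero hk', e1, e2]
  exact blk_eq_of_modInt he.gap_nonneg (flagMask_lt f k) (flagMask_ne_zero f k)
    (gap_ne_zero_of_testBit hf he.gap_nonneg h0)
    ((hq.modInt ⟨k', hk'⟩).symm.trans (he'.modInt ⟨k', hk'⟩))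

/-- The gap which is recovered from barycentric coordinates. -/
noncomputable def gapOfCoord (i : Fin 5) : (ℕ → ℝ) →ₗ[ℝ] ℝ :=
  ∑ j ∈ Finset.range 92, (if (faceKeys.getD j 0).testBit i then
    ((∑ l : Fin 5, if (faceKeys.getD j 0).testBit l then (1 : ℝ) else 0)⁻¹) else 0) •
      LinearMap.proj j

theorem sum_testBit_flagMask (f : Equiv.Perm (Fin 5)) (k : Fin 5) :
    (∑ l : Fin 5, if (flagMask f k).testBit l then (1 : ℝ) else 0) = (k : ℝ) + 1 := by
  rw [← Equiv.sum_comp f]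
  simp only [testBit_flagMask_fin, Equiv.symm_apply_apply]
  rw [Fin.sum_univ_five]
  fin_cases k <;> simp <;> norm_num

/-- A label remembers its face `I` in the low bits of its key, and the barycentre of a face with `k
+ 1` vertices contributes `1 / (k + 1)` to each of their gaps. -/
theorem gapOfCoord_flagVector (p f : Equiv.Perm (Fin 5)) (g : Fin 5 → ℝ) (i : Fin 5) :
    gapOfCoord i (flagVector p g f) = g i := by
  have h1 : ∀ k, gapOfCoord i (Pi.single (flagLabel p f k) 1) =
      if (flagMask f k).testBit i then ((k : ℝ) + 1)⁻¹ else 0 := by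
    intro k
    rw [gapOfCoord, LinearMap.sum_apply, Finset.sum_eq_single (flagLabel p f k)]
    · simp only [flagLabel, testBit_faceKeys p (flagMask_ne_zero f k) (flagMask_lt f k),
        sum_testBit_flagMask, LinearMap.smul_apply, LinearMap.proj_apply, Pi.single_eq_same,
        smul_eq_mul, mul_one]
    · intro j _ hj
      rw [LinearMap.smul_apply, LinearMap.proj_apply, Pi.single_eq_of_ne hj, smul_zero]
    · intro h
      exact absurd (Finset.mem_range.2 (flagLabel_lt p f k)) h
  rw [flagVector, map_sum]
  simp only [map_smul, h1]
  have h2 := sum_Ici_descent g f (f.symm i)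
  rw [f.apply_symm_apply] at h2
  rw [← h2]
  refine Finset.sum_congr rfl fun k _ => ?_
  simp only [testBit_flagMask_fin]
  split_ifs
  · have : (k : ℝ) + 1 ≠ 0 := by positivity
    rw [smul_eq_mul]; field_simp
  · simp

/-- The sum of the barycentric coordinates. -/
def coordSum : (ℕ → ℝ) →ₗ[ℝ] ℝ := ∑ j ∈ Finset.range 92, LinearMap.proj j

theorem coordSum_single {j : ℕ} (hj : j < 92) : coordSum (Pi.single j 1) = 1 := by
  rw [coordSum, LinearMap.sum_apply, Finset.sum_eq_single j]
  · simp
  · intro l _ hl; simp [hl]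
  · intro h; exact absurd (Finset.mem_range.2 hj) h

theorem coordSum_flagVector (p f : Equiv.Perm (Fin 5)) (g : Fin 5 → ℝ) :
    coordSum (flagVector p g f) = ∑ i, g i := by
  rw [flagVector, map_sum, ← sum_mul_descent g f]
  refine Finset.sum_congr rfl fun k _ => ?_
  rw [map_smul, coordSum_single (flagLabel_lt p f k), smul_eq_mul, mul_one]

theorem HasCoord.mem {d : Fin 5 → ℝ} {y : ℕ → ℝ} (h : HasCoord d y) :
    y ∈ simplicialCone orbFacets ∧ coordSum y = 1 := by
  obtain ⟨p, e, f, he, hf, rfl⟩ := h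
  exact ⟨flagVector_mem hf he.gap_nonneg p, by rw [coordSum_flagVector, sum_gap]⟩

theorem exists_gap_ne_zero (e : Fin 5 → ℝ) : ∃ i, gap e i ≠ 0 := by
  by_contra h
  push Not at h
  have := sum_gap e
  simp [h] at this

/-- The coordinates determine the gaps, hence the ordered lift. The label of the largest face in the
support determines the blocks up to a pentagon symmetry, and points in one block are congruent
because all other gaps vanish. -/
theorem HasCoord.dihEquiv {d d' : Fin 5 → ℝ} {y : ℕ → ℝ} (h : HasCoord d y)
    (h' : HasCoord d' y) : DihEquiv d' d := by
  obtain ⟨p, e, f, he, hf, rfl⟩ := h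
  obtain ⟨p', e', f', he', hf', h⟩ := h'
  have hgap : gap e = gap e' := by
    funext i
    rw [← gapOfCoord_flagVector p f (gap e), h, gapOfCoord_flagVector]
  obtain rfl := eq_of_gap_eq hgap (he.sum_eq.trans he'.sum_eq.symm)
  obtain ⟨k, hk, htop⟩ := exists_top (f := f) (exists_gap_ne_zero e)
  have hne : flagVector p (gap e) f (flagLabel p f k) ≠ 0 := by
    rw [flagVector_apply]
    exact mul_ne_zero (by positivity) hk
  rw [h] at hne
  obtain ⟨k', hkk, -⟩ := flagVector_ne_zero hne
  obtain ⟨-, m, hm, hblk⟩ := flagLabel_eq_iff.1 hkk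
  refine ⟨⟨m, hm⟩, fun j => ?_⟩
  have h1 := hblk j j.2
  rw [natFun_val] at h1
  have h2 : natFun p' (dih m j) = (p' (dihPerm ⟨m, hm⟩ j)).val := natFun_val p' (dihPerm ⟨m, hm⟩ j)
  rw [h2] at h1
  set b : Fin 5 := ⟨blk (flagMask f k) (p j), blk_lt _ (p j).2⟩
  have h3 := modInt_blk htop (p j) (b := b) rfl
  have h4 := modInt_blk htop (p' (dihPerm ⟨m, hm⟩ j)) (b := b) h1.symm
  exact (he.modInt j).trans ((h3.trans h4.symm).trans (he'.modInt _).symm)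

theorem exists_hasCoord_of_mem {y : ℕ → ℝ} (hy : y ∈ simplicialCone orbFacets)
    (hs : coordSum y = 1) : ∃ d : Fin 5 → ℝ, ∑ k, d k = 0 ∧ HasCoord d y := by
  obtain ⟨hy0, F, hF, hyF⟩ := hy
  obtain ⟨p, f, hFl⟩ := exists_flag_of_facet hF
  have hsupp : ∀ j, y j ≠ 0 → ∃ k, j = flagLabel p f k := fun j hj => hFl j (hyF j hj)
  -- Dividing by the size of the face turns a barycentric coordinate back into a descent; partial
  -- sums from above give the gaps.
  set c : Fin 5 → ℝ := fun k => y (flagLabel p f k) / ((k : ℝ) + 1) with hc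
  have hc0 : ∀ k, 0 ≤ c k := fun k => div_nonneg (hy0 _) (by positivity)
  set g : Fin 5 → ℝ := fun i => ∑ k, if f.symm i ≤ k then c k else 0 with hgdef
  have hg0 : ∀ i, 0 ≤ g i := fun i => Finset.sum_nonneg fun k _ => by
    split_ifs
    · exact hc0 k
    · exact le_rfl
  have hgf : ∀ j, g (f j) = ∑ k, if j ≤ k then c k else 0 := fun j => by
    simp only [hgdef, Equiv.symm_apply_apply]
  have hdesc : ∀ k, descent g f k = c k := by
    intro k
    simp only [descent, hgf]
    fin_cases k <;> simp [Fin.sum_univ_five]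
  have hfs : IsSorted g f := by
    intro i j hij
    simp only [Function.comp_apply, hgf]
    refine Finset.sum_le_sum fun k _ => ?_
    split_ifs with h1 h2 h2
    · exact le_rfl
    · exact absurd (hij.trans h1) h2
    · exact hc0 k
    · exact le_rfl
  have hvec : flagVector p g f = y := by
    funext j
    by_cases hj : ∃ k, j = flagLabel p f k
    · obtain ⟨k, rfl⟩ := hj
      rw [flagVector_apply, hdesc, hc]
      have : (k : ℝ) + 1 ≠ 0 := by positivity
      field_simp
    · have h1 : y j = 0 := by
        by_contra h; exact hj (hsupp j h)
      have h2 : flagVector p g f j = 0 := by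
        by_contra h
        obtain ⟨k, hk, -⟩ := flagVector_ne_zero h
        exact hj ⟨k, hk⟩
      rw [h1, h2]
  have hsum : ∑ i, g i = 1 := by rw [← coordSum_flagVector p f, hvec, hs]
  -- The starting point that makes the five positions sum to zero.
  set e0 : ℝ := -(4 * g 1 + 3 * g 2 + 2 * g 3 + g 4) / 5 with he0
  set e : Fin 5 → ℝ := ![e0, e0 + g 1, e0 + g 1 + g 2, e0 + g 1 + g 2 + g 3,
    e0 + g 1 + g 2 + g 3 + g 4] with he
  have hgap : gap e = g := by
    rw [Fin.sum_univ_five] at hsum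
    funext i
    fin_cases i
    · refine (gap_zero e).trans ?_
      simp [he]; linarith
    · refine (gap_one e).trans ?_
      simp [he]
    · refine (gap_two e).trans ?_
      simp [he]
    · refine (gap_three e).trans ?_
      simp [he]
    · refine (gap_four e).trans ?_
      simp [he]
  have hesum : ∑ i, e i = 0 := by
    rw [Fin.sum_univ_five]
    simp [he, he0]; ring
  refine ⟨fun k => e (p k), by rw [Equiv.sum_comp p e, hesum], p, e, f,
    ⟨by rw [hgap]; exact hg0, hesum, fun k => ModInt.refl _⟩, by rw [hgap]; exact hfs, ?_⟩
  rw [hgap, hvec]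

/-- A symmetry of the configuration preserves the block pattern of every face in its support.
Conversely, the largest face of the support sees all nonzero gaps, so a symmetry of its blocks is a
symmetry of the configuration. -/
theorem HasCoord.singular_iff {d : Fin 5 → ℝ} {y : ℕ → ℝ} (h : HasCoord d y) :
    (∃ m : Fin 10, m ≠ 0 ∧ ∀ k, ModInt (d k) (d (dihPerm m k))) ↔
      ∀ j, y j ≠ 0 → j ∈ singularVertices := by
  obtain ⟨p, e, f, he, hf, rfl⟩ := h
  constructor
  · rintro ⟨m, hm0, hm⟩ j hj
    obtain ⟨k, rfl, hk⟩ := flagVector_ne_zero hj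
    rw [flagLabel, permLabel_mem_singular p (flagMask_ne_zero f k) (flagMask_lt f k)]
    refine ⟨m, m.2, fun h => hm0 (Fin.val_injective h), fun i hi => ?_⟩
    have e1 := natFun_val p ⟨i, hi⟩
    have e2 := natFun_val p (dihPerm m ⟨i, hi⟩)
    have e3 : ((dihPerm m ⟨i, hi⟩ : Fin 5) : ℕ) = dih m i := rfl
    rw [e3] at e2
    simp only at e1
    rw [e1, e2]
    exact blk_eq_of_modInt he.gap_nonneg (flagMask_lt f k) (flagMask_ne_zero f k)
      (gap_ne_zero_of_testBit hf he.gap_nonneg hk)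
      ((he.modInt ⟨i, hi⟩).symm.trans ((hm ⟨i, hi⟩).trans (he.modInt _)))
  · intro h
    obtain ⟨k, hk, htop⟩ := exists_top (f := f) (exists_gap_ne_zero e)
    have hne : flagVector p (gap e) f (flagLabel p f k) ≠ 0 := by
      rw [flagVector_apply]
      exact mul_ne_zero (by positivity) hk
    have := h _ hne
    rw [flagLabel, permLabel_mem_singular p (flagMask_ne_zero f k) (flagMask_lt f k)] at this
    obtain ⟨m, hm, hm0, hblk⟩ := this
    refine ⟨⟨m, hm⟩, fun h => hm0 (congrArg Fin.val h), fun i => ?_⟩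
    have h1 := hblk i i.2
    have e2 : natFun p (dih m i) = (p (dihPerm ⟨m, hm⟩ i)).val := natFun_val p (dihPerm ⟨m, hm⟩ i)
    rw [natFun_val, e2] at h1
    set b : Fin 5 := ⟨blk (flagMask f k) (p i), blk_lt _ (p i).2⟩
    have h3 := modInt_blk htop (p i) (b := b) rfl
    have h4 := modInt_blk htop (p (dihPerm ⟨m, hm⟩ i)) (b := b) h1.symm
    exact (he.modInt i).trans ((h3.trans h4.symm).trans (he.modInt _).symm)

/-! ### Configurations and points of `ℂ²` -/

/-- The configuration of points on a circle which corresponds to a point of `ℂ²`, given by the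
differences of consecutive points. -/
noncomputable def confMap : (ℂ × ℂ) →ₗ[ℝ] (Fin 5 → ℝ) where
  toFun v k := 2 / 5 * (v.1 * (zeta ^ (4 * (k.val + 1)) - zeta ^ (4 * k.val)) +
    v.2 * (zeta ^ (3 * (k.val + 1)) - zeta ^ (3 * k.val))).re
  map_add' v w := by
    funext k
    simp only [Prod.fst_add, Prod.snd_add, Pi.add_apply, ← mul_add, ← Complex.add_re]
    congr 2
    ring
  map_smul' c v := by
    funext k
    simp only [Prod.smul_fst, Prod.smul_snd, Complex.real_smul, Pi.smul_apply, smul_eq_mul,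
      RingHom.id_apply, mul_assoc, ← mul_add, Complex.re_ofReal_mul]
    ring

/-- As `ζ⁴ = ζ⁻¹` and `ζ³ = ζ⁻²`, this is `x (k + 1) - x k` for `x j = (2/5) Re (z ζ⁻ʲ + w ζ⁻²ʲ)`,
the mean-zero real function with `∑ x j ζʲ = z` and `∑ x j ζ²ʲ = w`. -/
theorem confMap_apply (v : ℂ × ℂ) (k : Fin 5) : confMap v k =
    2 / 5 * (v.1 * (zeta ^ (4 * (k.val + 1)) - zeta ^ (4 * k.val)) +
    v.2 * (zeta ^ (3 * (k.val + 1)) - zeta ^ (3 * k.val))).re := rfl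

theorem zeta_pow_mod (n : ℕ) : zeta ^ n = zeta ^ (n % 5) := by
  conv_lhs => rw [← Nat.div_add_mod n 5, pow_add, pow_mul, zeta_pow_five, one_pow, one_mul]

theorem conj_zeta_pow (n : ℕ) : conj (zeta ^ n) = zeta ^ (4 * n) := by
  rw [map_pow, conj_zeta, ← pow_mul]

theorem ofReal_confMap (v : ℂ × ℂ) (k : Fin 5) : ((confMap v k : ℝ) : ℂ) =
    1 / 5 * (v.1 * (zeta ^ (4 * (k.val + 1)) - zeta ^ (4 * k.val)) +
      v.2 * (zeta ^ (3 * (k.val + 1)) - zeta ^ (3 * k.val)) +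
      conj v.1 * (zeta ^ (k.val + 1) - zeta ^ k.val) +
      conj v.2 * (zeta ^ (2 * (k.val + 1)) - zeta ^ (2 * k.val))) := by
  have h16 : ∀ n, zeta ^ (4 * (4 * n)) = zeta ^ n := fun n => by
    rw [zeta_pow_mod, zeta_pow_mod n]; congr 1; omega
  have h12 : ∀ n, zeta ^ (4 * (3 * n)) = zeta ^ (2 * n) := fun n => by
    rw [zeta_pow_mod, zeta_pow_mod (2 * n)]; congr 1; omega
  rw [confMap_apply, Complex.ofReal_mul, Complex.re_eq_add_conj]
  simp only [map_add, map_mul, map_sub, conj_zeta_pow, h16, h12]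
  push_cast
  ring

theorem confMap_sum (v : ℂ × ℂ) : ∑ k, confMap v k = 0 := by
  have h : ((∑ k, confMap v k : ℝ) : ℂ) = 0 := by
    rw [Complex.ofReal_sum, Fin.sum_univ_five]
    simp only [ofReal_confMap]
    have h5 := zeta_pow_five
    simp only [Fin.coe_ofNat_eq_mod]
    norm_num
    have e20 : zeta ^ 20 = 1 := by rw [zeta_pow_mod]; norm_num
    have e15 : zeta ^ 15 = 1 := by rw [zeta_pow_mod]; norm_num
    have e10 : zeta ^ 10 = 1 := by rw [zeta_pow_mod]; norm_num
    rw [e20, e15, e10, h5]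
    ring
  exact_mod_cast h

/-- The point of `ℂ²` with the given configuration. -/
noncomputable def confInv : (Fin 5 → ℝ) →ₗ[ℝ] (ℂ × ℂ) where
  toFun d := d 0 • (zeta, zeta ^ 2) + (d 0 + d 1) • (zeta ^ 2, zeta ^ 4) +
    (d 0 + d 1 + d 2) • (zeta ^ 3, zeta) + (d 0 + d 1 + d 2 + d 3) • (zeta ^ 4, zeta ^ 3)
  map_add' d d' := by
    simp only [Pi.add_apply]
    module
  map_smul' c d := by
    simp only [Pi.smul_apply, smul_eq_mul, RingHom.id_apply]
    module

theorem confInv_apply (d : Fin 5 → ℝ) : confInv d =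
    d 0 • (zeta, zeta ^ 2) + (d 0 + d 1) • (zeta ^ 2, zeta ^ 4) +
    (d 0 + d 1 + d 2) • (zeta ^ 3, zeta) + (d 0 + d 1 + d 2 + d 3) • (zeta ^ 4, zeta ^ 3) := rfl

/-- The coefficients in `confInv` are partial sums of `d`, which recover `x` up to an additive
constant; the Fourier sums ignore constants because `1 + ζ + ζ² + ζ³ + ζ⁴ = 0`. -/
theorem confInv_confMap (v : ℂ × ℂ) : confInv (confMap v) = v := by
  have h5 := zeta_pow_five
  have hs := zeta_sum
  rw [confInv_apply]
  have c0 := ofReal_confMap v 0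
  have c1 := ofReal_confMap v 1
  have c2 := ofReal_confMap v 2
  have c3 := ofReal_confMap v 3
  simp only [Fin.coe_ofNat_eq_mod] at c0 c1 c2 c3
  norm_num at c0 c1 c2 c3
  have e8 : zeta ^ 8 = zeta ^ 3 := by rw [zeta_pow_mod]
  have e6 : zeta ^ 6 = zeta := by rw [zeta_pow_mod]; norm_num
  have e12 : zeta ^ 12 = zeta ^ 2 := by rw [zeta_pow_mod]
  have e9 : zeta ^ 9 = zeta ^ 4 := by rw [zeta_pow_mod]
  have e16 : zeta ^ 16 = zeta := by rw [zeta_pow_mod]; norm_num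
  rw [e8, e6] at c1
  rw [e12, e8, e9, e6] at c2
  rw [e16, e12, e9, e8, e6] at c3
  ext1
  · simp only [Prod.fst_add, Prod.smul_fst, Complex.real_smul]
    push_cast
    rw [c0, c1, c2, c3]
    grind
  · simp only [Prod.snd_add, Prod.smul_snd, Complex.real_smul]
    push_cast
    rw [c0, c1, c2, c3]
    grind

theorem confMap_confInv {d : Fin 5 → ℝ} (hd : ∑ k, d k = 0) : confMap (confInv d) = d := by
  have h5 := zeta_pow_five
  have hs := zeta_sum
  have e8 : zeta ^ 8 = zeta ^ 3 := by rw [zeta_pow_mod]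
  have e6 : zeta ^ 6 = zeta := by rw [zeta_pow_mod]; norm_num
  have e12 : zeta ^ 12 = zeta ^ 2 := by rw [zeta_pow_mod]
  have e9 : zeta ^ 9 = zeta ^ 4 := by rw [zeta_pow_mod]
  have e16 : zeta ^ 16 = zeta := by rw [zeta_pow_mod]; norm_num
  have e20 : zeta ^ 20 = 1 := by rw [zeta_pow_mod]; norm_num
  have e15 : zeta ^ 15 = 1 := by rw [zeta_pow_mod]; norm_num
  have e10 : zeta ^ 10 = 1 := by rw [zeta_pow_mod]; norm_num
  have hd' : (d 0 + d 1 + d 2 + d 3 + d 4 : ℂ) = 0 := by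
    rw [Fin.sum_univ_five] at hd
    exact_mod_cast hd
  have hv : confInv d = ((d 0 : ℂ) * zeta + (d 0 + d 1) * zeta ^ 2 + (d 0 + d 1 + d 2) * zeta ^ 3 +
      (d 0 + d 1 + d 2 + d 3) * zeta ^ 4, (d 0 : ℂ) * zeta ^ 2 + (d 0 + d 1) * zeta ^ 4 +
      (d 0 + d 1 + d 2) * zeta + (d 0 + d 1 + d 2 + d 3) * zeta ^ 3) := by
    rw [confInv_apply]
    ext1 <;> simp
  funext k
  suffices h : ((confMap (confInv d) k : ℝ) : ℂ) = (d k : ℂ) by exact_mod_cast h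
  rw [ofReal_confMap, hv]
  simp only [map_add, map_mul, Complex.conj_ofReal, conj_zeta_pow, conj_zeta]
  fin_cases k
  · simp only [Fin.zero_eta]
    norm_num
    rw [e8, e16, e12]
    grind
  · simp only [Fin.mk_one]
    norm_num
    rw [e8, e16, e12, e6]
    grind
  · simp only [Fin.reduceFinMk]
    norm_num
    rw [e8, e16, e12, e6, e9]
    grind
  · simp only [Fin.reduceFinMk]
    norm_num
    rw [e8, e16, e12, e6, e9]
    grind
  · simp only [Fin.reduceFinMk]
    norm_num
    rw [e8, e16, e12, e20, e15, e10, h5]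
    grind

theorem modInt_iff_sub (x y : ℝ) : ModInt x y ↔ ∃ n : ℤ, x - y = n := by
  constructor
  · rintro ⟨n, rfl⟩; exact ⟨n, by ring⟩
  · rintro ⟨n, h⟩; exact ⟨n, by linarith⟩

/-- The vectors `(ζʲ, ζ²ʲ)` come from indicator functions on `ℤ/5`, whose differences are integral.
Conversely, integral differences have integral partial sums, and these are the coefficients in
`confInv`. -/
theorem mem_lattice_iff (v : ℂ × ℂ) : v ∈ lattice ↔ ∀ k, ∃ n : ℤ, confMap v k = n := by
  constructor
  · intro hv
    induction hv using AddSubgroup.closure_induction with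
    | mem x hx =>
      have key : ∀ d : Fin 5 → ℤ, ∑ k, d k = 0 → x = confInv (fun k => (d k : ℝ)) →
          ∀ k, ∃ n : ℤ, confMap x k = n := by
        rintro d hd rfl k
        rw [confMap_confInv (by exact_mod_cast congrArg (Int.cast : ℤ → ℝ) hd)]
        exact ⟨d k, rfl⟩
      rcases hx with rfl | rfl | rfl | rfl
      -- The difference vectors of the indicator functions of `0`, `1`, `2`, `3`, in this order.
      · refine key ![-1, 0, 0, 0, 1] (by decide) ?_
        rw [confInv_apply]
        have hs := zeta_sum
        ext1
        · simp; grind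
        · simp; grind
      · refine key ![1, -1, 0, 0, 0] (by decide) ?_
        rw [confInv_apply]
        ext1 <;> simp
      · refine key ![0, 1, -1, 0, 0] (by decide) ?_
        rw [confInv_apply]
        ext1 <;> simp
      · refine key ![0, 0, 1, -1, 0] (by decide) ?_
        rw [confInv_apply]
        ext1 <;> simp
    | zero => exact fun k => ⟨0, by simp⟩
    | add x y _ _ hx hy =>
      intro k
      obtain ⟨n, hn⟩ := hx k
      obtain ⟨m, hm⟩ := hy k
      exact ⟨n + m, by simp [hn, hm]⟩
    | neg x _ hx =>
      intro k
      obtain ⟨n, hn⟩ := hx k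
      exact ⟨-n, by simp [hn]⟩
  · intro h
    choose n hn using h
    have h1 := lattice_mem_pow 1 (by norm_num)
    have h2 := lattice_mem_pow 2 (by norm_num)
    have h3 := lattice_mem_pow 3 (by norm_num)
    have h4 := lattice_mem_pow 4 (by norm_num)
    norm_num at h1 h2 h3 h4
    have e6 : zeta ^ 6 = zeta := by rw [zeta_pow_mod]; norm_num
    have e8 : zeta ^ 8 = zeta ^ 3 := by rw [zeta_pow_mod]
    rw [e6] at h3
    rw [e8] at h4
    have key : ∀ (m : ℤ) (w : ℂ × ℂ), w ∈ lattice → (m : ℝ) • w ∈ lattice := fun m w hw => by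
      rw [Int.cast_smul_eq_zsmul]
      exact lattice.zsmul_mem hw m
    rw [← confInv_confMap v, confInv_apply, hn, hn, hn, hn]
    refine lattice.add_mem (lattice.add_mem (lattice.add_mem (key _ _ h1) ?_) ?_) ?_
    · exact_mod_cast key (n 0 + n 1) _ h2
    · exact_mod_cast key (n 0 + n 1 + n 2) _ h3
    · exact_mod_cast key (n 0 + n 1 + n 2 + n 3) _ h4

theorem torus_eq_iff (v w : ℂ × ℂ) :
    (QuotientAddGroup.mk v : Torus4) = QuotientAddGroup.mk w ↔
      ∀ k, ModInt (confMap v k) (confMap w k) := by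
  rw [eq_comm, QuotientAddGroup.eq_iff_sub_mem, ← neg_sub, lattice.neg_mem_iff, mem_lattice_iff]
  simp only [modInt_iff_sub, map_sub, Pi.sub_apply]

/-- Multiplying the Fourier coefficients by `ζ` and `ζ²` shifts `x` by one position. -/
theorem confMap_rot (v : ℂ × ℂ) (k : Fin 5) : confMap (rot v) k = confMap v (dihPerm 4 k) := by
  have h : ∀ a b, b = a + 1 → zeta * zeta ^ a = zeta ^ b := by rintro a b rfl; ring
  have key : ∀ a b c d : ℕ, (4 * a + 1) % 5 = (4 * b) % 5 → (4 * (a + 1) + 1) % 5 = (4 * (b + 1)) % 5 →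
      (3 * a + 2) % 5 = (3 * b) % 5 → (3 * (a + 1) + 2) % 5 = (3 * (b + 1)) % 5 →
      2 / 5 * ((zeta * v.1) * (zeta ^ (4 * (a + 1)) - zeta ^ (4 * a)) +
        (zeta ^ 2 * v.2) * (zeta ^ (3 * (a + 1)) - zeta ^ (3 * a))).re =
      2 / 5 * (v.1 * (zeta ^ (4 * (b + 1)) - zeta ^ (4 * b)) +
        v.2 * (zeta ^ (3 * (b + 1)) - zeta ^ (3 * b))).re := by
    intro a b _ _ h1 h2 h3 h4
    have p : ∀ {m n : ℕ}, m % 5 = n % 5 → zeta ^ m = zeta ^ n := fun h => by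
      rw [zeta_pow_mod, h, ← zeta_pow_mod]
    rw [← p h1, ← p h2, ← p h3, ← p h4]
    congr 2
    ring
  have hk := k.2
  refine key k (dihPerm 4 k) 0 0 ?_ ?_ ?_ ?_
  all_goals
    have : ((dihPerm 4 k : Fin 5) : ℕ) = (k + 4) % 5 := rfl
    rw [this]
    omega

/-- The map `-conj` replaces `x j` by `-x (-j)`, so the difference at `k` becomes the one at `-k -
1`. -/
theorem confMap_refl (v : ℂ × ℂ) (k : Fin 5) : confMap (refl v) k = confMap v (dihPerm 9 k) := by
  have p : ∀ {m n : ℕ}, m % 5 = n % 5 → zeta ^ m = zeta ^ n := fun h => by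
    rw [zeta_pow_mod, h, ← zeta_pow_mod]
  have hd : ((dihPerm 9 k : Fin 5) : ℕ) = (4 * k + 9) % 5 := rfl
  have hk := k.2
  rw [confMap_apply, confMap_apply, hd]
  have h1 : (v.1 * (zeta ^ (4 * ((4 * k.val + 9) % 5 + 1)) - zeta ^ (4 * ((4 * k.val + 9) % 5))) +
      v.2 * (zeta ^ (3 * ((4 * k.val + 9) % 5 + 1)) - zeta ^ (3 * ((4 * k.val + 9) % 5)))) =
      conj (-conj v.1 * (zeta ^ (4 * (k.val + 1)) - zeta ^ (4 * k.val)) +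
      -conj v.2 * (zeta ^ (3 * (k.val + 1)) - zeta ^ (3 * k.val))) := by
    simp only [map_add, map_mul, map_sub, map_neg, Complex.conj_conj, conj_zeta_pow]
    rw [p (show (4 * ((4 * k.val + 9) % 5 + 1)) % 5 = (4 * (4 * k.val)) % 5 by omega),
      p (show (4 * ((4 * k.val + 9) % 5)) % 5 = (4 * (4 * (k.val + 1))) % 5 by omega),
      p (show (3 * ((4 * k.val + 9) % 5 + 1)) % 5 = (4 * (3 * k.val)) % 5 by omega),
      p (show (3 * ((4 * k.val + 9) % 5)) % 5 = (4 * (3 * (k.val + 1))) % 5 by omega)]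
    ring
  rw [h1, Complex.conj_re]
  rfl

/-! ### The action of the dihedral group -/

/-- The linear map of `ℂ²` which permutes the entries of configurations. -/
noncomputable def permMap (σ : Equiv.Perm (Fin 5)) : (ℂ × ℂ) →ₗ[ℝ] (ℂ × ℂ) :=
  confInv ∘ₗ LinearMap.funLeft ℝ ℝ σ ∘ₗ confMap

theorem confMap_permMap (σ : Equiv.Perm (Fin 5)) (v : ℂ × ℂ) (k : Fin 5) :
    confMap (permMap σ v) k = confMap v (σ k) := by
  have : permMap σ v = confInv (fun k => confMap v (σ k)) := rfl
  rw [this, confMap_confInv]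
  rw [Equiv.sum_comp σ (confMap v), confMap_sum]

theorem confMap_injective : Function.Injective confMap :=
  Function.LeftInverse.injective confInv_confMap

/-- Permutations act by precomposition, whence the reversed order here and in `ActsBy.mul`. -/
theorem permMap_permMap (σ τ : Equiv.Perm (Fin 5)) (v : ℂ × ℂ) :
    permMap σ (permMap τ v) = permMap (τ * σ) v := by
  apply confMap_injective
  funext k
  simp [confMap_permMap]

theorem permMap_one (v : ℂ × ℂ) : permMap 1 v = v := by
  apply confMap_injective
  funext k
  simp [confMap_permMap]

theorem permMap_rot : permMap (dihPerm 4) = fun v => rot v := by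
  funext v
  apply confMap_injective
  funext k
  rw [confMap_permMap, confMap_rot]

theorem permMap_refl : permMap (dihPerm 9) = fun v => refl v := by
  funext v
  apply confMap_injective
  funext k
  rw [confMap_permMap, confMap_refl]

theorem torus_eq_iff_sub (v w : ℂ × ℂ) :
    (QuotientAddGroup.mk v : Torus4) = QuotientAddGroup.mk w ↔ v - w ∈ lattice := by
  rw [eq_comm, QuotientAddGroup.eq_iff_sub_mem, ← neg_sub, lattice.neg_mem_iff]

/-- The permutation `g` of the torus is induced by `permMap σ`. -/
def ActsBy (g : Equiv.Perm Torus4) (σ : Equiv.Perm (Fin 5)) : Prop :=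
  ∀ v : ℂ × ℂ, g (QuotientAddGroup.mk v) = QuotientAddGroup.mk (permMap σ v)

theorem actsBy_one : ActsBy 1 1 := fun v => by rw [permMap_one]; rfl

theorem ActsBy.mul {g h : Equiv.Perm Torus4} {σ τ : Equiv.Perm (Fin 5)} (hg : ActsBy g σ)
    (hh : ActsBy h τ) : ActsBy (g * h) (τ * σ) := fun v => by
  rw [Equiv.Perm.mul_apply, hh, hg, permMap_permMap]

theorem ActsBy.inv {g : Equiv.Perm Torus4} {σ : Equiv.Perm (Fin 5)} (hg : ActsBy g σ) :
    ActsBy g⁻¹ σ⁻¹ := fun v => by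
  rw [Equiv.Perm.inv_eq_iff_eq, hg, permMap_permMap, inv_mul_cancel, permMap_one]

theorem ActsBy.pow {g : Equiv.Perm Torus4} {σ : Equiv.Perm (Fin 5)} (hg : ActsBy g σ) (n : ℕ) :
    ActsBy (g ^ n) (σ ^ n) := by
  induction n with
  | zero => simpa using actsBy_one
  | succ n ih => rw [pow_succ, pow_succ']; exact ih.mul hg

theorem actsBy_rotT : ActsBy rotT (dihPerm 4) := fun v => by rw [permMap_rot]; rfl

theorem actsBy_reflT : ActsBy reflT (dihPerm 9) := fun v => by rw [permMap_refl]; rfl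

theorem exists_dihPerm_mul : ∀ m n : Fin 10, ∃ q, dihPerm q = dihPerm m * dihPerm n := by
  decide +kernel

theorem exists_dihPerm_inv : ∀ m : Fin 10, ∃ q, dihPerm q = (dihPerm m)⁻¹ := by
  decide +kernel

theorem dihPerm_zero : dihPerm 0 = 1 := by decide

theorem dihPerm_eq_mul : ∀ m : Fin 10, ∃ i : Fin 5, ∃ j : Fin 2,
    dihPerm m = dihPerm 9 ^ j.val * dihPerm 4 ^ i.val := by decide +kernel

theorem exists_actsBy {g : Equiv.Perm Torus4} (hg : g ∈ D10) : ∃ m, ActsBy g (dihPerm m) := by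
  induction hg using Subgroup.closure_induction with
  | mem x hx =>
    rcases hx with rfl | rfl
    · exact ⟨4, actsBy_rotT⟩
    · exact ⟨9, actsBy_reflT⟩
  | one => exact ⟨0, dihPerm_zero ▸ actsBy_one⟩
  | mul x y _ _ hx hy =>
    obtain ⟨m, hm⟩ := hx
    obtain ⟨n, hn⟩ := hy
    obtain ⟨q, hq⟩ := exists_dihPerm_mul n m
    exact ⟨q, hq ▸ hm.mul hn⟩
  | inv x _ hx =>
    obtain ⟨m, hm⟩ := hx
    obtain ⟨q, hq⟩ := exists_dihPerm_inv m
    exact ⟨q, hq ▸ hm.inv⟩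

theorem exists_mem_D10 (m : Fin 10) : ∃ g ∈ D10, ActsBy g (dihPerm m) := by
  obtain ⟨i, j, h⟩ := dihPerm_eq_mul m
  refine ⟨rotT ^ i.val * reflT ^ j.val, D10.mul_mem (D10.pow_mem (Subgroup.subset_closure (by simp)) _)
    (D10.pow_mem (Subgroup.subset_closure (by simp)) _), h ▸ (actsBy_rotT.pow _).mul (actsBy_reflT.pow _)⟩

theorem torusProj_eq_iff (p q : Torus4) : torusProj p = torusProj q ↔ ∃ g ∈ D10, g p = q := by
  rw [eq_comm]
  refine Quotient.eq.trans (MulAction.orbitRel_apply.trans ?_)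
  constructor
  · rintro ⟨⟨g, hg⟩, h⟩
    exact ⟨g, hg, h⟩
  · rintro ⟨g, hg, h⟩
    exact ⟨⟨g, hg⟩, h⟩

theorem proj_eq_iff (v w : ℂ × ℂ) :
    proj v = proj w ↔ ∃ m, permMap (dihPerm m) v - w ∈ lattice := by
  rw [proj, proj, torusProj_eq_iff]
  constructor
  · rintro ⟨g, hg, h⟩
    obtain ⟨m, hm⟩ := exists_actsBy hg
    exact ⟨m, by rwa [hm, torus_eq_iff_sub] at h⟩
  · rintro ⟨m, h⟩
    obtain ⟨g, hg, hm⟩ := exists_mem_D10 m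
    exact ⟨g, hg, by rwa [hm, torus_eq_iff_sub]⟩

theorem proj_eq_iff_dihEquiv (v w : ℂ × ℂ) :
    proj v = proj w ↔ DihEquiv (confMap v) (confMap w) := by
  rw [proj_eq_iff]
  refine exists_congr fun m => ?_
  rw [← torus_eq_iff_sub, torus_eq_iff]
  simp only [confMap_permMap]
  exact forall_congr' fun k => ⟨ModInt.symm, ModInt.symm⟩

theorem proj_surjective : Function.Surjective proj := by
  intro x
  obtain ⟨p, rfl⟩ := Quotient.exists_rep x
  obtain ⟨v, rfl⟩ := QuotientAddGroup.mk_surjective p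
  exact ⟨v, rfl⟩

theorem dihPerm_apply_ne : ∀ m : Fin 10, m ≠ 0 → ∃ k, dihPerm m k ≠ k := by decide

theorem not_actsBy_one {m : Fin 10} (hm : m ≠ 0) : ¬ ActsBy 1 (dihPerm m) := by
  intro h
  obtain ⟨k, hk⟩ := dihPerm_apply_ne m hm
  -- A generic configuration: distinct entries of sum zero with all differences less than 1 in size,
  -- so no two are congruent.
  let d : Fin 5 → ℝ := ![1 / 100, 2 / 100, 3 / 100, 4 / 100, -10 / 100]
  have hd : ∑ k, d k = 0 := by rw [Fin.sum_univ_five]; simp [d]; norm_num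
  have h1 := h (confInv d)
  rw [Equiv.Perm.one_apply, torus_eq_iff] at h1
  obtain ⟨n, hn⟩ := h1 k
  rw [confMap_permMap, confMap_confInv hd] at hn
  have hlt : ∀ i j, i ≠ j → d i - d j ≠ 0 ∧ -1 < d i - d j ∧ d i - d j < 1 := by
    intro i j
    fin_cases i <;> fin_cases j <;> simp [d] <;> norm_num
  obtain ⟨a, b, c⟩ := hlt k _ hk.symm
  have e : d k - d (dihPerm m k) = n := by linarith
  rw [e] at a b c
  have b' : -1 < n := by exact_mod_cast b
  have c' : n < 1 := by exact_mod_cast c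
  exact a (by rw [show n = 0 by omega]; simp)

theorem stabilizer_ne_bot_iff (v : ℂ × ℂ) :
    MulAction.stabilizer D10 (QuotientAddGroup.mk v : Torus4) ≠ ⊥ ↔
      ∃ m : Fin 10, m ≠ 0 ∧ ∀ k, ModInt (confMap v k) (confMap v (dihPerm m k)) := by
  rw [Subgroup.ne_bot_iff_exists_ne_one]
  constructor
  · rintro ⟨⟨⟨g, hg⟩, hs⟩, hne⟩
    obtain ⟨m, hm⟩ := exists_actsBy hg
    refine ⟨m, ?_, ?_⟩
    · rintro rfl
      apply hne
      ext p
      obtain ⟨w, rfl⟩ := QuotientAddGroup.mk_surjective p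
      change g _ = _
      rw [hm, dihPerm_zero, permMap_one]
      rfl
    · have h : g (QuotientAddGroup.mk v) = QuotientAddGroup.mk v := hs
      rw [hm, eq_comm, torus_eq_iff] at h
      simpa only [confMap_permMap] using h
  · rintro ⟨m, hm0, hm⟩
    obtain ⟨g, hg, hgm⟩ := exists_mem_D10 m
    refine ⟨⟨⟨g, hg⟩, ?_⟩, fun h => ?_⟩
    · change g _ = _
      rw [hgm, eq_comm, torus_eq_iff]
      simpa only [confMap_permMap] using hm
    · have : g = 1 := congrArg (fun x => ((x : MulAction.stabilizer D10 _) : D10).1) h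
      exact not_actsBy_one hm0 (this ▸ hgm)

/-- Isotropy groups of different lifts of a point are conjugate, so nontriviality can be tested on
any one lift. -/
theorem proj_mem_singularSet_iff (v : ℂ × ℂ) : proj v ∈ singularSet ↔
    ∃ m : Fin 10, m ≠ 0 ∧ ∀ k, ModInt (confMap v k) (confMap v (dihPerm m k)) := by
  rw [← stabilizer_ne_bot_iff]
  constructor
  · rintro ⟨p, hp, hs⟩
    obtain ⟨g, hg, hgp⟩ := (torusProj_eq_iff _ _).1 hp
    rw [← hgp]
    have h := MulAction.stabilizer_smul_eq_stabilizer_map_conj (⟨g, hg⟩ : D10) p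
    change MulAction.stabilizer D10 (g p) = _ at h
    intro hb
    have hb : MulAction.stabilizer D10 (g p) = ⊥ := hb
    rw [h, Subgroup.map_eq_bot_iff_of_injective _ (MulEquiv.injective _)] at hb
    exact hs hb
  · exact fun h => ⟨_, rfl, h⟩

/-! ### The topology of the orbifold -/

theorem continuous_permMap (σ : Equiv.Perm (Fin 5)) : Continuous (permMap σ) :=
  LinearMap.continuous_of_finiteDimensional _

instance : ContinuousConstSMul D10 Torus4 where
  continuous_const_smul := by
    rintro ⟨g, hg⟩
    obtain ⟨m, hm⟩ := exists_actsBy hg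
    rw [(QuotientAddGroup.isQuotientMap_mk lattice).continuous_iff]
    exact (QuotientAddGroup.continuous_mk.comp (continuous_permMap (dihPerm m))).congr
      fun v => (hm v).symm

theorem continuous_proj : Continuous proj :=
  continuous_quotient_mk'.comp QuotientAddGroup.continuous_mk

theorem isOpenMap_proj : IsOpenMap proj :=
  (isOpenMap_quotient_mk'_mul (Γ := D10) (T := Torus4)).comp
    QuotientAddGroup.isOpenMap_coe

theorem isQuotientMap_proj : Topology.IsQuotientMap proj :=
  isOpenMap_proj.isQuotientMap continuous_proj proj_surjective

/-- The chamber representative has sum zero and spread at most 1. The bounded box gives compactness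
of the quotient. -/
theorem exists_mem_box (x : Orb) : ∃ v, proj v = x ∧ ∀ k, confMap v k ∈ Set.Icc (-1 : ℝ) 1 := by
  obtain ⟨v, rfl⟩ := proj_surjective x
  obtain ⟨p, e, h⟩ := exists_isChamber (confMap_sum v)
  have hs : ∑ k, e (p k) = 0 := by rw [Equiv.sum_comp p e]; exact h.sum_eq
  refine ⟨confInv (fun k => e (p k)), ?_, ?_⟩
  · rw [proj_eq_iff_dihEquiv]
    refine ⟨0, fun k => ?_⟩
    rw [dihPerm_zero, confMap_confInv hs]
    exact h.modInt k
  · rw [confMap_confInv hs]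
    intro k
    obtain ⟨h0, h1, h2, h3, h4⟩ := chamber_le h.gap_nonneg
    have := h.sum_eq
    rw [Fin.sum_univ_five] at this
    change e (p k) ∈ _
    generalize p k = i
    fin_cases i <;> constructor <;> simp only [Fin.zero_eta, Fin.mk_one, Fin.reduceFinMk] <;> linarith

instance : CompactSpace Orb := by
  have hK : IsCompact (Set.univ.pi fun _ : Fin 5 => Set.Icc (-1 : ℝ) 1) :=
    isCompact_univ_pi fun _ => isCompact_Icc
  have hc : Continuous fun d => proj (confInv d) :=
    continuous_proj.comp (LinearMap.continuous_of_finiteDimensional _)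
  refine ⟨(hK.image hc).of_isClosed_subset isClosed_univ fun x _ => ?_⟩
  obtain ⟨v, rfl, hv⟩ := exists_mem_box x
  exact ⟨confMap v, fun k _ => hv k, congrArg proj (confInv_confMap v)⟩

/-! ### Barycentric coordinates on the orbifold -/

/-- The barycentric coordinates of the image of a point of `ℂ²`. -/
noncomputable def planeCoord (v : ℂ × ℂ) : ℕ → ℝ := (exists_hasCoord (confMap_sum v)).choose

theorem hasCoord_planeCoord (v : ℂ × ℂ) : HasCoord (confMap v) (planeCoord v) :=
  (exists_hasCoord (confMap_sum v)).choose_spec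

/-- The barycentric coordinates of a point of the orbifold. -/
noncomputable def orbCoord (x : Orb) : ℕ → ℝ := planeCoord (Function.surjInv proj_surjective x)

theorem hasCoord_orbCoord (v : ℂ × ℂ) : HasCoord (confMap v) (orbCoord (proj v)) := by
  have h := hasCoord_planeCoord (Function.surjInv proj_surjective (proj v))
  rw [orbCoord, h.eq (hasCoord_planeCoord v)
    ((proj_eq_iff_dihEquiv _ _).1 (Function.surjInv_eq _ _))]
  exact hasCoord_planeCoord v

theorem orbCoord_injective : Function.Injective orbCoord := by
  intro x y h
  obtain ⟨v, rfl⟩ := proj_surjective x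
  obtain ⟨w, rfl⟩ := proj_surjective y
  rw [eq_comm, proj_eq_iff_dihEquiv]
  exact (hasCoord_orbCoord v).dihEquiv (h ▸ hasCoord_orbCoord w)

theorem range_orbCoord :
    Set.range orbCoord = {y | y ∈ simplicialCone orbFacets ∧ coordSum y = 1} := by
  ext y
  constructor
  · rintro ⟨x, rfl⟩
    obtain ⟨v, rfl⟩ := proj_surjective x
    exact (hasCoord_orbCoord v).mem
  · rintro ⟨h1, h2⟩
    obtain ⟨d, hd, h⟩ := exists_hasCoord_of_mem h1 h2
    refine ⟨proj (confInv d), ?_⟩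
    have h' := hasCoord_orbCoord (confInv d)
    rw [confMap_confInv hd] at h'
    exact h'.eq h ⟨0, fun k => by rw [dihPerm_zero]; exact ModInt.refl _⟩

theorem proj_mem_singularSet_iff_coord (x : Orb) :
    x ∈ singularSet ↔ ∀ j, orbCoord x j ≠ 0 → j ∈ singularVertices := by
  obtain ⟨v, rfl⟩ := proj_surjective x
  rw [proj_mem_singularSet_iff, (hasCoord_orbCoord v).singular_iff]

/-- `gap` as an affine map. -/
noncomputable def gapAffine : (Fin 5 → ℝ) →ᵃ[ℝ] (Fin 5 → ℝ) where
  toFun := gap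
  linear := LinearMap.id - LinearMap.funLeft ℝ ℝ (fun i : Fin 5 => i - 1)
  map_vadd' e d := by
    funext i
    simp [gap, LinearMap.funLeft]
    ring

/-- `descent` as a linear map. -/
noncomputable def descentLinear (f : Equiv.Perm (Fin 5)) (k : Fin 5) : (Fin 5 → ℝ) →ₗ[ℝ] ℝ :=
  LinearMap.proj (R := ℝ) (φ := fun _ : Fin 5 => ℝ) (f k) -
    if k = 4 then 0 else LinearMap.proj (R := ℝ) (φ := fun _ : Fin 5 => ℝ) (f (k + 1))

/-- `flagVector` as a linear map. -/
noncomputable def flagLinear (p f : Equiv.Perm (Fin 5)) : (Fin 5 → ℝ) →ₗ[ℝ] (ℕ → ℝ) :=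
  ∑ k : Fin 5, ((k : ℝ) + 1) • (descentLinear f k).smulRight (Pi.single (flagLabel p f k) 1)

theorem flagLinear_apply (p f : Equiv.Perm (Fin 5)) (g : Fin 5 → ℝ) :
    flagLinear p f g = flagVector p g f := by
  rw [flagLinear, flagVector, LinearMap.sum_apply]
  refine Finset.sum_congr rfl fun k _ => ?_
  rw [LinearMap.smul_apply, LinearMap.smulRight_apply, smul_smul]
  congr 2
  unfold descentLinear descent
  split_ifs <;> simp

theorem isPolyhedron_sorted (f : Equiv.Perm (Fin 5)) :
    IsPolyhedron {g : Fin 5 → ℝ | (∀ i, 0 ≤ g i) ∧ IsSorted g f} := by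
  have h1 : IsPolyhedron (⋂ i : Fin 5, {g : Fin 5 → ℝ | 0 ≤ g i}) :=
    IsPolyhedron.iInter fun i =>
      isPolyhedron_halfspace (LinearMap.proj (R := ℝ) (φ := fun _ : Fin 5 => ℝ) i).toAffineMap
  have h2 : IsPolyhedron (⋂ q : {q : Fin 5 × Fin 5 // q.1 ≤ q.2},
      {g : Fin 5 → ℝ | g (f q.1.2) ≤ g (f q.1.1)}) :=
    IsPolyhedron.iInter fun q => isPolyhedron_le
      (LinearMap.proj (R := ℝ) (φ := fun _ : Fin 5 => ℝ) (f q.1.2)).toAffineMap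
      (LinearMap.proj (R := ℝ) (φ := fun _ : Fin 5 => ℝ) (f q.1.1)).toAffineMap
  convert h1.inter h2 using 1
  ext g
  simp only [Set.mem_ofPred_eq, Set.mem_inter_iff, Set.mem_iInter]
  exact and_congr_right fun _ => ⟨fun h q => h q.2, fun h i j hij => h ⟨(i, j), hij⟩⟩

/-- The points of the configuration of `v`, translated by integers and ordered by `p`. -/
noncomputable def orderedConf (p : Equiv.Perm (Fin 5)) (z : Fin 5 → ℤ) :
    (ℂ × ℂ) →ᵃ[ℝ] (Fin 5 → ℝ) :=
  (LinearMap.funLeft ℝ ℝ p.symm ∘ₗ confMap).toAffineMap -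
    AffineMap.const ℝ _ (fun i => (z (p.symm i) : ℝ))

theorem orderedConf_apply (p : Equiv.Perm (Fin 5)) (z : Fin 5 → ℤ) (v : ℂ × ℂ) (i : Fin 5) :
    orderedConf p z v i = confMap v (p.symm i) - z (p.symm i) := by
  simp [orderedConf, LinearMap.funLeft]

theorem isChamber_orderedConf {p : Equiv.Perm (Fin 5)} {z : Fin 5 → ℤ} (hz : ∑ k, z k = 0)
    {v : ℂ × ℂ} (h : ∀ i, 0 ≤ gap (orderedConf p z v) i) :
    IsChamber (confMap v) p (orderedConf p z v) := by
  refine ⟨h, ?_, fun k => ⟨z k, by simp [orderedConf_apply]⟩⟩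
  rw [← Equiv.sum_comp p]
  simp only [orderedConf_apply, Equiv.symm_apply_apply, Finset.sum_sub_distrib, confMap_sum]
  rw [← Int.cast_sum, hz]
  simp

theorem continuous_confMap : Continuous confMap := LinearMap.continuous_of_finiteDimensional _

theorem IsChamber.abs_le_one {d : Fin 5 → ℝ} {p : Equiv.Perm (Fin 5)} {e : Fin 5 → ℝ}
    (h : IsChamber d p e) (i : Fin 5) : |e i| ≤ 1 := by
  obtain ⟨h0, h1, h2, h3, h4⟩ := chamber_le h.gap_nonneg
  have := h.sum_eq
  rw [Fin.sum_univ_five] at this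
  rw [abs_le]
  fin_cases i <;> constructor <;> simp only [Fin.zero_eta, Fin.mk_one, Fin.reduceFinMk] <;> linarith

/-- Near `v₀` only finitely many alcoves occur, each given by an ordering and an integral
translation. On the part of an alcove where the gaps have a fixed order, the coordinates are an
affine function. -/
theorem plNear_orbCoord (v₀ : ℂ × ℂ) : PLNear (fun v => orbCoord (proj v)) v₀ := by
  obtain ⟨N, hN⟩ : ∃ N : ℕ, ∀ k, |confMap v₀ k| < N := by
    obtain ⟨N, hN⟩ := exists_nat_gt (∑ k, |confMap v₀ k|)
    exact ⟨N, fun k => (Finset.single_le_sum (f := fun k => |confMap v₀ k|)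
      (fun _ _ => abs_nonneg _) (Finset.mem_univ k)).trans_lt hN⟩
  have hnear : ∀ᶠ v in 𝓝 v₀, ∀ k, |confMap v k| < N := by
    rw [Filter.eventually_all]
    intro k
    exact ((continuous_abs.comp ((continuous_apply k).comp continuous_confMap)).tendsto
      v₀).eventually_lt_const (hN k)
  -- The bound `N + 1` is the bound `N` on the configuration plus the bound 1 on the entries of a
  -- chamber.
  let I : Set (Equiv.Perm (Fin 5) × Equiv.Perm (Fin 5) × (Fin 5 → ℤ)) :=
    {q | (∀ k, q.2.2 k ∈ Set.Icc (-(N + 1) : ℤ) (N + 1)) ∧ ∑ k, q.2.2 k = 0}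
  have hI : I.Finite := by
    have : (Set.univ.pi fun _ : Fin 5 => Set.Icc (-(N + 1) : ℤ) (N + 1)).Finite :=
      Set.Finite.pi fun _ => Set.finite_Icc _ _
    refine (Set.finite_univ.prod (Set.finite_univ.prod this)).subset ?_
    exact fun q hq => ⟨trivial, trivial, fun k _ => hq.1 k⟩
  refine ⟨(fun q => ((gapAffine.comp (orderedConf q.1 q.2.2)) ⁻¹'
    {g | (∀ i, 0 ≤ g i) ∧ IsSorted g q.2.1},
    (flagLinear q.1 q.2.1).toAffineMap.comp (gapAffine.comp (orderedConf q.1 q.2.2)))) '' I,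
    hI.image _, ?_, ?_⟩
  · rintro _ ⟨⟨p, f, z⟩, ⟨-, hz⟩, rfl⟩
    refine ⟨(isPolyhedron_sorted f).preimage _, fun v hv => ?_⟩
    refine (hasCoord_orbCoord v).eq (y' := flagLinear p f (gap (orderedConf p z v))) ?_
      ⟨0, fun k => by rw [dihPerm_zero]; exact ModInt.refl _⟩
    exact ⟨p, _, f, isChamber_orderedConf hz hv.1, hv.2, flagLinear_apply _ _ _⟩
  · filter_upwards [hnear] with v hv
    obtain ⟨p, e, f, he, hf, -⟩ := hasCoord_orbCoord v
    choose z hz using he.modInt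
    have hze : orderedConf p z v = e := by
      funext i
      rw [orderedConf_apply, hz, Equiv.apply_symm_apply]
      ring
    have hsum : ∑ k, z k = 0 := by
      have h1 := confMap_sum v
      have h2 := he.sum_eq
      rw [← Equiv.sum_comp p] at h2
      simp only [hz, Finset.sum_add_distrib, h2, zero_add] at h1
      exact_mod_cast h1
    refine ⟨_, ⟨(p, f, z), ⟨fun k => ?_, hsum⟩, rfl⟩, ?_⟩
    · have h1 := abs_lt.1 (hv k)
      have h2 := abs_le.1 (he.abs_le_one (p k))
      have h3 := hz k
      have h4 : (-(N + 1) : ℝ) < z k := by linarith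
      have h5 : (z k : ℝ) < N + 1 := by linarith
      exact ⟨by exact_mod_cast h4.le, by exact_mod_cast h5.le⟩
    · change (∀ i, 0 ≤ gap (orderedConf p z v) i) ∧ IsSorted (gap (orderedConf p z v)) f
      rw [hze]
      exact ⟨he.gap_nonneg, hf⟩

theorem continuous_orbCoord : Continuous orbCoord := by
  rw [isQuotientMap_proj.continuous_iff, continuous_iff_continuousAt]
  exact fun v => (plNear_orbCoord v).continuousAt

instance : T2Space Orb := T2Space.of_injective_continuous orbCoord_injective continuous_orbCoord

/-! ### The orbifold is a sphere -/

/-- With the weights of `unitMove` both sides have total weight `|s| · |t|`, so flips preserve the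
slice on which the coordinates sum to 1. -/
theorem coordSum_unitMove : ∀ m ∈ orbFlips.map unitMove,
    coordSum (wvec m.1) = coordSum (wvec m.2) := by
  have h1 : ((orbFlips.map unitMove).all fun m => ((m.1 ++ m.2).all fun p => Nat.blt p.1 92) &&
      Nat.beq (m.1.map Prod.snd).sum (m.2.map Prod.snd).sum) = true := by decide +kernel
  have h2 : ∀ s : List (ℕ × ℕ), (∀ p ∈ s, p.1 < 92) →
      coordSum (wvec s) = ((s.map Prod.snd).sum : ℕ) := by
    intro s hs
    induction s with
    | nil => simp [wvec]
    | cons p l ih =>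
      have ih := ih fun q hq => hs q (List.mem_cons_of_mem _ hq)
      have h3 : wvec (p :: l) = Pi.single p.1 (p.2 : ℝ) + wvec l := by simp [wvec]
      have h4 : (Pi.single p.1 (p.2 : ℝ) : ℕ → ℝ) = (p.2 : ℝ) • Pi.single p.1 1 := by
        rw [← Pi.single_smul]; simp
      rw [h3, map_add, ih, h4, map_smul, coordSum_single (hs p List.mem_cons_self)]
      simp
  intro m hm
  rw [List.all_eq_true] at h1
  have h := h1 m hm
  simp only [Bool.and_eq_true, List.all_eq_true, Nat.blt_eq, Nat.beq_eq, List.mem_append] at h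
  rw [h2 _ fun p hp => h.1 p (Or.inl hp), h2 _ fun p hp => h.1 p (Or.inr hp), h.2]

theorem mem_simplexBoundary_cone {l : List ℕ} {x : ℕ → ℝ} :
    x ∈ simplicialCone (simplexBoundary l) ↔
      (∀ i, 0 ≤ x i) ∧ (∀ j, x j ≠ 0 → j ∈ l) ∧ ∃ i ∈ l, x i = 0 := by
  have key : ∀ (k : List ℕ) (j : ℕ),
      (k.foldr (fun j m => Nat.lor m (Nat.shiftLeft 1 j)) 0).testBit j = true ↔ j ∈ k := by
    intro k j
    induction k with
    | nil => simp
    | cons a k ih => rw [List.foldr_cons, testBit_lor_shiftLeft, ih, List.mem_cons, or_comm]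
  have hne : ∀ i j : ℕ, (!Nat.beq i j) = true ↔ i ≠ j := fun i j => by
    rw [Bool.not_eq_true', ← Bool.not_eq_true, Nat.beq_eq]
  simp only [simplicialCone, Set.mem_ofPred_eq, simplexBoundary, List.mem_map,
    exists_exists_and_eq_and, key, List.mem_filter, hne]
  refine and_congr_right fun _ => ⟨?_, ?_⟩
  · rintro ⟨i, hi, h⟩
    exact ⟨fun j hj => (h j hj).1, i, hi, by_contra fun hx => (h i hx).2 rfl⟩
  · rintro ⟨h, i, hi, hx⟩
    exact ⟨i, hi, fun j hj => ⟨h j hj, fun hij => hj (hij ▸ hx)⟩⟩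

/-- The vertices of the final triangulation. -/
def finalVertex (i : Fin 6) : ℕ := finalVertices.getD i 0

theorem finalVertex_injective : Function.Injective finalVertex := by decide

theorem mem_finalVertices {j : ℕ} : j ∈ finalVertices ↔ ∃ i, finalVertex i = j := by
  simp [finalVertices, finalVertex, Fin.exists_fin_succ, eq_comm]

theorem coordSum_eq_sum {y : ℕ → ℝ} (hy : ∀ j, y j ≠ 0 → j ∈ finalVertices) :
    coordSum y = ∑ i, y (finalVertex i) := by
  have h1 : coordSum y = ∑ j ∈ Finset.range 92, y j := by simp [coordSum]
  have h2 : ∑ i, y (finalVertex i) = ∑ j ∈ Finset.univ.image finalVertex, y j :=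
    (Finset.sum_image finalVertex_injective.injOn).symm
  rw [h1, h2]
  refine (Finset.sum_subset (fun j hj => ?_) fun j _ hj => ?_).symm
  · obtain ⟨i, -, rfl⟩ := Finset.mem_image.1 hj
    rw [Finset.mem_range]
    revert i
    decide
  · by_contra h
    obtain ⟨i, rfl⟩ := mem_finalVertices.1 (hy j h)
    exact hj (Finset.mem_image_of_mem _ (Finset.mem_univ i))

/-- The map from the orbifold to the boundary of a simplex. -/
noncomputable def sphereMap (x : Orb) : Fin 6 → ℝ :=
  LinearMap.funLeft ℝ ℝ finalVertex (flipSeq (orbFlips.map unitMove) (orbCoord x))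

theorem flipSeq_orbCoord (x : Orb) :
    flipSeq (orbFlips.map unitMove) (orbCoord x) ∈
      simplicialCone (simplexBoundary finalVertices) ∧
    coordSum (flipSeq (orbFlips.map unitMove) (orbCoord x)) = 1 := by
  have h : orbCoord x ∈ {y | y ∈ simplicialCone orbFacets ∧ coordSum y = 1} :=
    range_orbCoord ▸ ⟨x, rfl⟩
  exact ⟨(flipSeq_mem admissible_orbFlips transforms_orbFlips h.1).1,
    (map_flipSeq coordSum coordSum_unitMove _).trans h.2⟩

theorem sphereMap_mem (x : Orb) : sphereMap x ∈ plSphere4 := by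
  obtain ⟨h1, h2⟩ := flipSeq_orbCoord x
  obtain ⟨h3, h4, j, hj, h5⟩ := mem_simplexBoundary_cone.1 h1
  obtain ⟨i, rfl⟩ := mem_finalVertices.1 hj
  exact ⟨⟨fun i => h3 _, (coordSum_eq_sum h4).symm.trans h2⟩, i, h5⟩

theorem sphereMap_injective : Function.Injective sphereMap := by
  intro x y h
  apply orbCoord_injective
  have hx : orbCoord x ∈ {y | y ∈ simplicialCone orbFacets ∧ coordSum y = 1} :=
    range_orbCoord ▸ ⟨x, rfl⟩
  have hy : orbCoord y ∈ {y | y ∈ simplicialCone orbFacets ∧ coordSum y = 1} :=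
    range_orbCoord ▸ ⟨y, rfl⟩
  have ex := (flipSeq_mem admissible_orbFlips transforms_orbFlips hx.1).2
  have ey := (flipSeq_mem admissible_orbFlips transforms_orbFlips hy.1).2
  refine ex.symm.trans (Eq.trans (congrArg _ ?_) ey)
  funext j
  obtain ⟨-, h4, -⟩ := mem_simplexBoundary_cone.1 (flipSeq_orbCoord x).1
  obtain ⟨-, h5, -⟩ := mem_simplexBoundary_cone.1 (flipSeq_orbCoord y).1
  by_cases hj : j ∈ finalVertices
  · obtain ⟨i, rfl⟩ := mem_finalVertices.1 hj
    exact congrFun h i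
  · rw [not_imp_comm.1 (h4 j) hj, not_imp_comm.1 (h5 j) hj]

theorem exists_sphereMap_eq {a : Fin 6 → ℝ} (ha : a ∈ plSphere4) : ∃ x, sphereMap x = a := by
  obtain ⟨⟨h0, h1⟩, i, hi⟩ := ha
  set y : ℕ → ℝ := Function.extend finalVertex a 0 with hy
  have hya : ∀ i, y (finalVertex i) = a i := fun i => finalVertex_injective.extend_apply _ _ _
  have hy0 : ∀ j, y j ≠ 0 → j ∈ finalVertices := fun j hj => by
    by_contra h
    rw [mem_finalVertices] at h
    exact hj (Function.extend_apply' _ _ _ h)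
  have hpos : ∀ j, 0 ≤ y j := fun j => by
    rcases eq_or_ne (y j) 0 with h | h
    · exact h.ge
    · obtain ⟨i, rfl⟩ := mem_finalVertices.1 (hy0 j h)
      exact hya i ▸ h0 i
  have hmem : y ∈ simplicialCone (simplexBoundary finalVertices) :=
    mem_simplexBoundary_cone.2 ⟨hpos, hy0, _, mem_finalVertices.2 ⟨i, rfl⟩, (hya i).trans hi⟩
  obtain ⟨h2, h3⟩ := unflipSeq_mem admissible_orbFlips transforms_orbFlips hmem
  have h4 : coordSum (unflipSeq (orbFlips.map unitMove) y) = 1 := by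
    rw [map_unflipSeq coordSum coordSum_unitMove, coordSum_eq_sum hy0]
    simpa only [hya] using h1
  have h5 : unflipSeq (orbFlips.map unitMove) y ∈ Set.range orbCoord := by
    rw [range_orbCoord]; exact ⟨h2, h4⟩
  obtain ⟨x, hx⟩ := h5
  refine ⟨x, ?_⟩
  funext i
  rw [sphereMap, hx, h3]
  exact hya i

theorem plNear_sphereMap (v : ℂ × ℂ) : PLNear (fun v => sphereMap (proj v)) v :=
  ((isPL_linear _).comp (isPL_flipSeq _)).comp_plNear (plNear_orbCoord v)

theorem continuous_sphereMap : Continuous sphereMap := by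
  rw [isQuotientMap_proj.continuous_iff, continuous_iff_continuousAt]
  exact fun v => (plNear_sphereMap v).continuousAt

/-- The underlying space of the orbifold is `PL`-homeomorphic to the sphere. -/
theorem exists_homeomorph_sphere :
    ∃ h : Orb ≃ₜ plSphere4, IsPLOnOrb (fun x => (h x : Fin 6 → ℝ)) Set.univ := by
  let e : Orb ≃ plSphere4 := Equiv.ofBijective (fun x => ⟨sphereMap x, sphereMap_mem x⟩)
    ⟨fun x y h => sphereMap_injective (congrArg Subtype.val h),
      fun a => (exists_sphereMap_eq a.2).imp fun x hx => Subtype.ext hx⟩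
  have he : Continuous e := continuous_sphereMap.subtype_mk _
  exact ⟨he.homeoOfEquivCompactToT2, isPLOn_of_plNear isOpen_univ fun v _ => plNear_sphereMap v⟩

/-! ### The singular set -/

theorem modInt_iff_coe (x y : ℝ) : ModInt x y ↔ (x : UnitAddCircle) = y := by
  rw [eq_comm (a := (x : UnitAddCircle))]
  refine Iff.trans ?_ QuotientAddGroup.eq.symm
  rw [AddSubgroup.mem_zmultiples_iff]
  refine exists_congr fun n => ?_
  simp only [zsmul_eq_mul, mul_one]
  constructor <;> intro h <;> linarith

theorem permMap_dihPerm_nine_eq_self (v : ℂ × ℂ) :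
    permMap (dihPerm 9) v = v ↔ v.1.re = 0 ∧ v.2.re = 0 := by
  have h : ∀ z : ℂ, -conj z = z ↔ z.re = 0 := fun z => by
    rw [Complex.ext_iff]
    simp only [Complex.neg_re, Complex.conj_re, Complex.neg_im, Complex.conj_im, neg_neg, and_true]
    constructor <;> intro h <;> linarith
  rw [permMap_refl, Prod.ext_iff]
  exact and_congr (h _) (h _)

theorem permMap_dihPerm_nine_eq_self_iff (v : ℂ × ℂ) :
    permMap (dihPerm 9) v = v ↔ confMap v 4 = confMap v 0 ∧ confMap v 3 = confMap v 1 := by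
  rw [← confMap_injective.eq_iff, funext_iff]
  simp only [confMap_permMap]
  constructor
  · exact fun h => ⟨h 0, h 1⟩
  · rintro ⟨h0, h1⟩ k
    fin_cases k
    · exact h0
    · exact h1
    · rfl
    · exact h1.symm
    · exact h0.symm

theorem exists_conj_reflection : ∀ m : Fin 5, ∃ q : Fin 10,
    ∀ k, dihPerm q (dihPerm 9 k) = dihPerm (Fin.natAdd 5 m) (dihPerm q k) := by decide +kernel

theorem exists_pow_rotation : ∀ m : Fin 5, m ≠ 0 → ∀ k : Fin 5, ∃ i : Fin 5,
    ((dihPerm (Fin.castAdd 5 m)) ^ i.val) 0 = k := by decide +kernel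

/-- Five is prime, so a nontrivial rotation is transitive on the pentagon. -/
theorem eq_of_comp_rotation {α : Type*} {d : Fin 5 → α} {m : Fin 5} (hm : m ≠ 0)
    (h : ∀ k, d k = d (dihPerm (Fin.castAdd 5 m) k)) (k : Fin 5) : d k = d 0 := by
  obtain ⟨i, rfl⟩ := exists_pow_rotation m hm k
  induction i.val with
  | zero => simp
  | succ n ih => rw [pow_succ', Equiv.Perm.mul_apply, ← h, ih]

/-- Invariance under a rotation forces a constant function, invariant under everything. Otherwise
the symmetry is a reflection, and all reflections of a pentagon are conjugate. -/
theorem exists_comp_reflection {α : Type*} {d : Fin 5 → α} {m : Fin 10} (hm : m ≠ 0)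
    (h : ∀ k, d k = d (dihPerm m k)) :
    ∃ q : Fin 10, ∀ k, d (dihPerm q k) = d (dihPerm q (dihPerm 9 k)) := by
  induction m using Fin.addCases (m := 5) (n := 5) with
  | left m =>
    have hm : m ≠ 0 := by rintro rfl; exact hm rfl
    exact ⟨0, fun k => by rw [eq_of_comp_rotation hm h, eq_of_comp_rotation hm h (dihPerm 0 _)]⟩
  | right m =>
    obtain ⟨q, hq⟩ := exists_conj_reflection m
    exact ⟨q, fun k => by rw [hq, ← h]⟩

/-- A configuration which is symmetric with respect to a reflection. -/
noncomputable def symmConf (a b : ℝ) : Fin 5 → ℝ := ![a, b, -2 * a - 2 * b, b, a]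

theorem symmConf_sum (a b : ℝ) : ∑ k, symmConf a b k = 0 := by
  simp only [symmConf, Fin.sum_univ_five, Matrix.cons_val]
  ring

/-- The point of the orbifold with configuration `symmConf a b`. -/
noncomputable def symmPoint (a b : ℝ) : Orb := proj (confInv (symmConf a b))

theorem symmPoint_mem_lagrangianTorus (a b : ℝ) : symmPoint a b ∈ lagrangianTorus := by
  refine ⟨_, ?_, rfl⟩
  change _ ∧ _
  rw [← permMap_dihPerm_nine_eq_self, permMap_dihPerm_nine_eq_self_iff,
    confMap_confInv (symmConf_sum a b)]
  exact ⟨rfl, rfl⟩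

theorem lagrangianTorus_subset : lagrangianTorus ⊆ singularSet := by
  rintro _ ⟨v, hv, rfl⟩
  rw [proj_mem_singularSet_iff]
  refine ⟨9, by decide, fun k => ?_⟩
  rw [← confMap_permMap, (permMap_dihPerm_nine_eq_self v).2 hv]
  exact ModInt.refl _

theorem exists_symmPoint {x : Orb} (hx : x ∈ singularSet) : ∃ a b, symmPoint a b = x := by
  obtain ⟨v, rfl⟩ := proj_surjective x
  rw [proj_mem_singularSet_iff] at hx
  obtain ⟨m, hm0, hm⟩ := hx
  simp only [modInt_iff_coe] at hm
  obtain ⟨q, hq⟩ := exists_comp_reflection (d := fun k => (confMap v k : UnitAddCircle)) hm0 hm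
  have hsum : ∑ k, confMap v (dihPerm q k) = 0 := by
    rw [Equiv.sum_comp (dihPerm q) (confMap v), confMap_sum]
  refine ⟨confMap v (dihPerm q 0), confMap v (dihPerm q 1), ?_⟩
  rw [eq_comm, symmPoint, proj_eq_iff_dihEquiv, confMap_confInv (symmConf_sum _ _)]
  refine ⟨q, fun k => ?_⟩
  have h0 : ModInt (confMap v (dihPerm q 0)) (confMap v (dihPerm q 4)) :=
    (modInt_iff_coe _ _).2 (hq 0)
  have h1 : ModInt (confMap v (dihPerm q 1)) (confMap v (dihPerm q 3)) :=
    (modInt_iff_coe _ _).2 (hq 1)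
  fin_cases k
  · exact ModInt.refl _
  · exact ModInt.refl _
  -- The middle entry is determined modulo `ℤ` by the other four and the vanishing sum.
  · obtain ⟨n, hn⟩ := h0
    obtain ⟨l, hl⟩ := h1
    rw [Fin.sum_univ_five] at hsum
    refine ⟨-n - l, ?_⟩
    simp only [symmConf, Fin.reduceFinMk, Matrix.cons_val]
    push_cast
    linarith
  · exact h1
  · exact h0

theorem singularSet_eq_lagrangianTorus : singularSet = lagrangianTorus := by
  refine Set.Subset.antisymm (fun x hx => ?_) lagrangianTorus_subset
  obtain ⟨a, b, rfl⟩ := exists_symmPoint hx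
  exact symmPoint_mem_lagrangianTorus a b

/-- Two configurations with the same axis can differ only by a symmetry preserving the axis, unless
there is a second axis and everything is constant. So the torus of pairs `(a, b)` injects into the
quotient. -/
theorem eq_of_comp_dihPerm {α : Type*} {d d' : Fin 5 → α} (h04 : d 0 = d 4) (h13 : d 1 = d 3)
    (h04' : d' 0 = d' 4) (h13' : d' 1 = d' 3) {q : Fin 10} (h : ∀ k, d' k = d (dihPerm q k)) :
    d 0 = d' 0 ∧ d 1 = d' 1 := by
  have e : ∀ k, dihPerm q k = ⟨dih q k, dih_lt _ _⟩ := fun _ => rfl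
  simp only [e] at h
  have e0 := h 0
  have e1 := h 1
  have e2 := h 2
  have e3 := h 3
  have e4 := h 4
  clear h e
  fin_cases q <;> simp [dih] at e0 e1 e2 e3 e4 <;> grind

theorem symmPoint_eq_iff {a b a' b' : ℝ} : symmPoint a b = symmPoint a' b' ↔
    (a : UnitAddCircle) = a' ∧ (b : UnitAddCircle) = b' := by
  rw [symmPoint, symmPoint, proj_eq_iff_dihEquiv, confMap_confInv (symmConf_sum _ _),
    confMap_confInv (symmConf_sum _ _)]
  constructor
  · rintro ⟨q, hq⟩
    simp only [modInt_iff_coe] at hq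
    exact eq_of_comp_dihPerm (d := fun k => (symmConf a b k : UnitAddCircle))
      (d' := fun k => (symmConf a' b' k : UnitAddCircle)) rfl rfl rfl rfl hq
  · rintro ⟨ha, hb⟩
    obtain ⟨n, rfl⟩ := (modInt_iff_coe _ _).2 ha
    obtain ⟨m, rfl⟩ := (modInt_iff_coe _ _).2 hb
    refine ⟨0, fun k => ?_⟩
    rw [dihPerm_zero, Equiv.Perm.one_apply]
    fin_cases k
    · exact ⟨-n, by simp [symmConf]⟩
    · exact ⟨-m, by simp [symmConf]⟩
    · exact ⟨2 * n + 2 * m, by simp [symmConf]; ring⟩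
    · exact ⟨-m, by simp [symmConf]⟩
    · exact ⟨-n, by simp [symmConf]⟩

theorem continuous_symmPoint : Continuous fun p : ℝ × ℝ => symmPoint p.1 p.2 := by
  refine continuous_proj.comp ((LinearMap.continuous_of_finiteDimensional confInv).comp ?_)
  refine continuous_pi fun k => ?_
  fin_cases k <;> simp only [symmConf, Fin.zero_eta, Fin.mk_one, Fin.reduceFinMk, Matrix.cons_val] <;>
    fun_prop

/-- The singular set is a torus. -/
theorem nonempty_homeomorph_torus :
    Nonempty (singularSet ≃ₜ UnitAddCircle × UnitAddCircle) := by
  let π : ℝ × ℝ → UnitAddCircle × UnitAddCircle := Prod.map (↑) (↑)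
  have hπ : IsOpenQuotientMap π :=
    IsOpenQuotientMap.prodMap QuotientAddGroup.isOpenQuotientMap_mk
      QuotientAddGroup.isOpenQuotientMap_mk
  let F : UnitAddCircle × UnitAddCircle → singularSet := fun p =>
    ⟨symmPoint (Function.surjInv hπ.surjective p).1 (Function.surjInv hπ.surjective p).2,
      lagrangianTorus_subset (symmPoint_mem_lagrangianTorus _ _)⟩
  have hF : ∀ p : ℝ × ℝ, (F (π p) : Orb) = symmPoint p.1 p.2 := fun p => by
    have := Function.surjInv_eq hπ.surjective (π p)
    exact symmPoint_eq_iff.2 ⟨congrArg Prod.fst this, congrArg Prod.snd this⟩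
  have hc : Continuous F := by
    rw [hπ.isQuotientMap.continuous_iff, continuous_induced_rng]
    exact continuous_symmPoint.congr fun p => (hF p).symm
  have hb : Function.Bijective F := by
    constructor
    · intro p q h
      obtain ⟨p, rfl⟩ := hπ.surjective p
      obtain ⟨q, rfl⟩ := hπ.surjective q
      have := congrArg Subtype.val h
      rw [hF, hF, symmPoint_eq_iff] at this
      exact Prod.ext this.1 this.2
    · rintro ⟨x, hx⟩
      obtain ⟨a, b, rfl⟩ := exists_symmPoint hx
      exact ⟨π (a, b), Subtype.ext (hF _)⟩
  exact ⟨(Continuous.homeoOfEquivCompactToT2 (f := Equiv.ofBijective F hb) hc).symm⟩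

/-! ### The cone points -/

/-- The configuration of a cone point. -/
noncomputable def coneConf (t : Fin 5) : Fin 5 → ℝ :=
  ![-t / 5, -t / 5, -t / 5, -t / 5, 4 * t / 5]

theorem coneConf_sum (t : Fin 5) : ∑ k, coneConf t k = 0 := by
  simp only [coneConf, Fin.sum_univ_five, Matrix.cons_val]
  ring

theorem modInt_coneConf (t k : Fin 5) : ModInt (coneConf t k) (-t / 5) := by
  fin_cases k
  · exact ModInt.refl _
  · exact ModInt.refl _
  · exact ModInt.refl _
  · exact ModInt.refl _
  · exact ⟨t, by simp only [coneConf, Fin.reduceFinMk, Matrix.cons_val]; push_cast; ring⟩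

/-- A lift of a cone point. -/
noncomputable def coneVec (t : Fin 5) : ℂ × ℂ := confInv (coneConf t)

theorem confMap_coneVec (t : Fin 5) : confMap (coneVec t) = coneConf t :=
  confMap_confInv (coneConf_sum t)

theorem conePoint_eq (t : Fin 5) : conePoint t = proj (coneVec t) := by
  rw [conePoint, coneVec, confInv_apply]
  congr 1
  have h5 := zeta_pow_five
  have hs := zeta_sum
  ext1
  · simp [coneConf]
    grind
  · simp [coneConf]
    grind

theorem conePoint_injective : Function.Injective conePoint := by
  intro t t' h
  rw [conePoint_eq, conePoint_eq, proj_eq_iff_dihEquiv, confMap_coneVec, confMap_coneVec] at h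
  obtain ⟨m, hm⟩ := h
  obtain ⟨n, hn⟩ := (modInt_coneConf t' 0).symm.trans ((hm 0).trans (modInt_coneConf t _))
  have h1 : (t : ℝ) - t' = 5 * n := by linarith
  have h2 : ((t : ℕ) : ℤ) - (t' : ℕ) = 5 * n := by exact_mod_cast h1
  have := t.2
  have := t'.2
  exact Fin.ext (by omega)

theorem conePoint_mem (t : Fin 5) : conePoint t ∈ singularSet := by
  rw [conePoint_eq, proj_mem_singularSet_iff, confMap_coneVec]
  exact ⟨1, by decide, fun k => (modInt_coneConf t k).trans (modInt_coneConf t _).symm⟩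

/-! ### Local flatness away from the cone points -/

/-- Intersecting every polyhedron with a small simplex on which the two functions agree leaves
polyhedra still covering a neighbourhood. -/
theorem PLNear.congr {E F : Type*} [NormedAddCommGroup E] [NormedSpace ℝ E]
    [FiniteDimensional ℝ E] [AddCommGroup F] [Module ℝ F] {f g : E → F} {x : E}
    (hf : PLNear f x) (h : f =ᶠ[𝓝 x] g) : PLNear g x := by
  obtain ⟨C, hC, h1, h2⟩ := hf
  obtain ⟨b, hb, hbX⟩ := exists_mem_interior_convexHull_affineBasis h
  have hpoly : IsPolyhedron (convexHull ℝ (Set.range b)) := by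
    rw [b.convexHull_eq_nonneg_coord]
    simp only [Set.ofPred_forall]
    exact IsPolyhedron.iInter fun i => isPolyhedron_halfspace _
  refine ⟨(fun c => (c.1 ∩ convexHull ℝ (Set.range b), c.2)) '' C, hC.image _, ?_, ?_⟩
  · rintro _ ⟨c, hc, rfl⟩
    refine ⟨(h1 c hc).1.inter hpoly, fun y hy => ?_⟩
    rw [← (h1 c hc).2 hy.1]
    exact (hbX hy.2).symm
  · filter_upwards [h2, mem_interior_iff_mem_nhds.1 hb] with y hy hyb
    obtain ⟨c, hc, hyc⟩ := hy
    exact ⟨_, ⟨c, hc, rfl⟩, hyc, hyb⟩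

/-- Sums of absolute values of linear forms are piecewise linear. -/
theorem isPL_abs {E F : Type*} [AddCommGroup E] [Module ℝ E] [AddCommGroup F] [Module ℝ F]
    {n : ℕ} (A : E →ₗ[ℝ] F) (l : Fin n → E →ₗ[ℝ] ℝ) (c : Fin n → F) :
    IsPL fun x => A x + ∑ i, |l i x| • c i := by
  let s : Bool → ℝ := fun b => if b then 1 else -1
  refine ⟨Set.range fun ε : Fin n → Bool => ({x : E | ∀ i, 0 ≤ (s (ε i) • l i) x},
    (A + ∑ i, (s (ε i) • l i).smulRight (c i)).toAffineMap), Set.finite_range _, ?_, fun x => ?_⟩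
  · rintro _ ⟨ε, rfl⟩
    constructor
    · simp only [Set.ofPred_forall]
      exact IsPolyhedron.iInter fun i => isPolyhedron_halfspace (s (ε i) • l i).toAffineMap
    · intro x hx
      change A x + ∑ i, |l i x| • c i = (A + ∑ i, (s (ε i) • l i).smulRight (c i) : E →ₗ[ℝ] F) x
      rw [LinearMap.add_apply, LinearMap.sum_apply]
      congr 1
      refine Finset.sum_congr rfl fun i _ => ?_
      rw [LinearMap.smulRight_apply]
      congr 1
      have := hx i
      rw [← abs_of_nonneg this, LinearMap.smul_apply, smul_eq_mul, abs_mul]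
      have : |s (ε i)| = 1 := by cases ε i <;> simp [s]
      rw [this, one_mul]
  · refine ⟨_, ⟨fun i => decide (0 ≤ l i x), rfl⟩, fun i => ?_⟩
    rw [LinearMap.smul_apply, smul_eq_mul]
    by_cases h : 0 ≤ l i x
    · simp [s, h]
    · simp [s, h, (not_le.1 h).le]

/-- Two open maps with the same fibres over an open set induce a local homeomorphism. -/
theorem exists_openPartialHomeomorph {V X Y : Type*} [TopologicalSpace V] [TopologicalSpace X]
    [TopologicalSpace Y] [Nonempty V] {p : V → X} {E : V → Y} (hp : Continuous p)
    (hp' : IsOpenMap p) (hE : Continuous E) (hE' : IsOpenMap E) {W : Set V} (hW : IsOpen W)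
    (h : ∀ w ∈ W, ∀ w' ∈ W, p w = p w' ↔ E w = E w') :
    ∃ e : OpenPartialHomeomorph X Y, e.source = p '' W ∧ ∀ w ∈ W, e (p w) = E w := by
  have key1 : ∀ w ∈ W, E (Function.invFunOn p W (p w)) = E w := fun w hw =>
    (h _ (Function.invFunOn_mem ⟨w, hw, rfl⟩) _ hw).1 (Function.invFunOn_eq ⟨w, hw, rfl⟩)
  have key2 : ∀ w ∈ W, p (Function.invFunOn E W (E w)) = p w := fun w hw =>
    (h _ (Function.invFunOn_mem ⟨w, hw, rfl⟩) _ hw).2 (Function.invFunOn_eq ⟨w, hw, rfl⟩)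
  refine ⟨{
    toFun := fun x => E (Function.invFunOn p W x)
    invFun := fun y => p (Function.invFunOn E W y)
    source := p '' W
    target := E '' W
    map_source' := by
      rintro _ ⟨w, hw, rfl⟩
      exact ⟨w, hw, (key1 w hw).symm⟩
    map_target' := by
      rintro _ ⟨w, hw, rfl⟩
      exact ⟨w, hw, (key2 w hw).symm⟩
    left_inv' := by
      rintro _ ⟨w, hw, rfl⟩
      rw [key1 w hw, key2 w hw]
    right_inv' := by
      rintro _ ⟨w, hw, rfl⟩
      rw [key2 w hw, key1 w hw]
    open_source := hp' _ hW
    open_target := hE' _ hW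
    continuousOn_toFun := by
      rw [continuousOn_open_iff (hp' _ hW)]
      intro U hU
      convert hp' _ (hW.inter (hU.preimage hE)) using 1
      ext x
      constructor
      · rintro ⟨⟨w, hw, rfl⟩, hx⟩
        exact ⟨w, ⟨hw, by rwa [Set.mem_preimage, key1 w hw] at hx⟩, rfl⟩
      · rintro ⟨w, ⟨hw, hx⟩, rfl⟩
        exact ⟨⟨w, hw, rfl⟩, by rwa [Set.mem_preimage, key1 w hw]⟩
    continuousOn_invFun := by
      rw [continuousOn_open_iff (hE' _ hW)]
      intro U hU
      convert hE' _ (hW.inter (hU.preimage hp)) using 1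
      ext x
      constructor
      · rintro ⟨⟨w, hw, rfl⟩, hx⟩
        exact ⟨w, ⟨hw, by rwa [Set.mem_preimage, key2 w hw] at hx⟩, rfl⟩
      · rintro ⟨w, ⟨hw, hx⟩, rfl⟩
        exact ⟨⟨w, hw, rfl⟩, by rwa [Set.mem_preimage, key2 w hw]⟩ }, rfl, key1⟩

theorem isClosed_lattice : IsClosed (lattice : Set (ℂ × ℂ)) := by
  have h : (lattice : Set (ℂ × ℂ)) = ⋂ k, {v | confMap v k ∈ Set.range ((↑) : ℤ → ℝ)} := by
    ext v
    simp only [SetLike.mem_coe, mem_lattice_iff, Set.mem_iInter, Set.mem_ofPred_eq, Set.mem_range,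
      eq_comm]
  rw [h]
  exact isClosed_iInter fun k => Int.isClosedEmbedding_coe_real.isClosed_range.preimage
    ((continuous_apply k).comp continuous_confMap)

/-- The lattice is discrete and closed: integral coordinates of size less than 1 vanish. -/
theorem eventually_mem_lattice (u₀ : ℂ × ℂ) : ∀ᶠ u in 𝓝 u₀, u ∈ lattice → u = u₀ := by
  by_cases h : u₀ ∈ lattice
  · have hc : ∀ k, ∀ᶠ u in 𝓝 u₀, |confMap (u - u₀) k| < 1 := fun k => by
      have : Continuous fun u => |confMap (u - u₀) k| :=
        continuous_abs.comp ((continuous_apply k).comp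
          (continuous_confMap.comp (continuous_id.sub continuous_const)))
      exact (this.tendsto u₀).eventually_lt_const (by simp)
    filter_upwards [Filter.eventually_all.2 hc] with u hu hul
    have h1 := (mem_lattice_iff _).1 (lattice.sub_mem hul h)
    have h2 : confMap (u - u₀) = 0 := by
      funext k
      obtain ⟨n, hn⟩ := h1 k
      have h3 := hu k
      rw [hn] at h3 ⊢
      have h4 : |n| < 1 := by exact_mod_cast h3
      rw [Int.abs_lt_one_iff.1 h4]
      simp
    rw [← map_zero confMap] at h2
    exact sub_eq_zero.1 (confMap_injective h2)
  · filter_upwards [isClosed_lattice.isOpen_compl.mem_nhds h] with u hu hul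
    exact absurd hul hu

/-- The group generated by `Λ`, `r` and `s` acts properly discontinuously. -/
theorem eventually_sub_mem_lattice (v : ℂ × ℂ) : ∀ᶠ p in 𝓝 (v, v), ∀ m : Fin 10,
    permMap (dihPerm m) p.1 - p.2 ∈ lattice →
      permMap (dihPerm m) v - v ∈ lattice ∧ p.2 - v = permMap (dihPerm m) (p.1 - v) := by
  rw [Filter.eventually_all]
  intro m
  have hc : Continuous fun p : (ℂ × ℂ) × (ℂ × ℂ) => permMap (dihPerm m) p.1 - p.2 :=
    ((continuous_permMap _).comp continuous_fst).sub continuous_snd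
  -- A continuous expression that stays in a discrete closed lattice near `(v, v)` must keep its
  -- value at `(v, v)`.
  filter_upwards [(hc.tendsto (v, v)).eventually (eventually_mem_lattice _)] with p hp hl
  have h := hp hl
  refine ⟨h ▸ hl, ?_⟩
  rw [map_sub]
  linear_combination (exp := 1) -h

/-- Near a singular point which is not a cone point, only one reflection acts. -/
theorem eq_of_not_conePoint {v : ℂ × ℂ} (hv : permMap (dihPerm 9) v = v)
    (hcone : proj v ∉ Set.range conePoint) {m : Fin 10}
    (hm : permMap (dihPerm m) v - v ∈ lattice) : m = 0 ∨ m = 9 := by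
  have h : ∀ k, ModInt (confMap v k) (confMap v (dihPerm m k)) := fun k => by
    rw [← torus_eq_iff_sub, torus_eq_iff] at hm
    simpa only [confMap_permMap] using (hm k).symm
  have h9 : ∀ k, confMap v k = confMap v (dihPerm 9 k) := fun k => by
    rw [← confMap_permMap, hv]
  by_contra hne
  push Not at hne
  -- A further symmetry is a rotation, or becomes one after composition with reflection `9`; the
  -- rotation is nontrivial.
  obtain ⟨j, hj, hjd⟩ : ∃ j : Fin 5, j ≠ 0 ∧ ((∀ k, dihPerm (Fin.castAdd 5 j) k = dihPerm m k) ∨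
      ∀ k, dihPerm (Fin.castAdd 5 j) k = dihPerm 9 (dihPerm m k)) := by
    clear * - hne
    revert m
    decide +kernel
  apply hcone
  have hrot : ∀ k, (confMap v k : UnitAddCircle) = confMap v (dihPerm (Fin.castAdd 5 j) k) := by
    intro k
    rw [← modInt_iff_coe]
    rcases hjd with hjd | hjd
    · exact hjd k ▸ h k
    · rw [hjd k, ← h9]
      exact h k
  have hconst := eq_of_comp_rotation (d := fun k => (confMap v k : UnitAddCircle)) hj hrot
  simp only [← modInt_iff_coe] at hconst
  choose n hn using hconst
  have hsum := confMap_sum v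
  rw [Fin.sum_univ_five, hn 1, hn 2, hn 3, hn 4] at hsum
  -- Five congruent entries with sum zero are all congruent to `-N / 5`, so the point is the cone
  -- point with index `N` modulo 5.
  set N := n 1 + n 2 + n 3 + n 4 with hN
  have hd0 : confMap v 0 = -N / 5 := by
    rw [hN]; push_cast; linarith
  refine ⟨⟨(N % 5).toNat, by omega⟩, ?_⟩
  rw [conePoint_eq, proj_eq_iff_dihEquiv, confMap_coneVec]
  refine ⟨0, fun k => ?_⟩
  rw [dihPerm_zero]
  refine ModInt.trans ⟨n k, hn k⟩ (ModInt.trans ⟨-(N / 5), ?_⟩ (modInt_coneConf _ _).symm)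
  have h1 : (((N % 5).toNat : ℕ) : ℤ) = N % 5 := Int.toNat_of_nonneg (by omega)
  have h2 : (((N % 5).toNat : ℕ) : ℝ) = ((N % 5 : ℤ) : ℝ) := by exact_mod_cast h1
  have h3 : (N : ℝ) = 5 * ((N / 5 : ℤ) : ℝ) + ((N % 5 : ℤ) : ℝ) := by
    exact_mod_cast (Int.mul_ediv_add_emod N 5).symm
  simp only [h2, hd0]
  push_cast
  linarith

/-- A piecewise linear map whose fibres are the orbits of the reflection. -/
noncomputable def foldMap (w : ℂ × ℂ) : Fin 4 → ℝ :=
  ![w.1.im, w.2.im, |w.1.re| - |w.2.re|, (|w.1.re + w.2.re| - |w.1.re - w.2.re|) / 2]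

theorem isPL_foldMap : IsPL foldMap := by
  let re₁ : (ℂ × ℂ) →ₗ[ℝ] ℝ := Complex.reLm ∘ₗ LinearMap.fst ℝ ℂ ℂ
  let re₂ : (ℂ × ℂ) →ₗ[ℝ] ℝ := Complex.reLm ∘ₗ LinearMap.snd ℝ ℂ ℂ
  let im₁ : (ℂ × ℂ) →ₗ[ℝ] ℝ := Complex.imLm ∘ₗ LinearMap.fst ℝ ℂ ℂ
  let im₂ : (ℂ × ℂ) →ₗ[ℝ] ℝ := Complex.imLm ∘ₗ LinearMap.snd ℝ ℂ ℂ
  have h := isPL_abs (F := Fin 4 → ℝ) (im₁.smulRight ![1, 0, 0, 0] + im₂.smulRight ![0, 1, 0, 0])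
    ![re₁, re₂, re₁ + re₂, re₁ - re₂]
    ![![0, 0, 1, 0], ![0, 0, -1, 0], ![0, 0, 0, 1 / 2], ![0, 0, 0, -1 / 2]]
  refine (congrArg IsPL ?_).mpr h
  funext w i
  fin_cases i <;> simp [foldMap, Fin.sum_univ_four, re₁, re₂, im₁, im₂] <;> ring

theorem continuous_foldMap : Continuous foldMap := by
  rw [continuous_iff_continuousAt]
  exact fun x => (isPL_foldMap.plNear x).continuousAt

/-- The quantity `(|a + b| - |a - b|) / 2` is the product of the signs of `a` and `b` times the
smaller of `|a|` and `|b|`. With `|a| - |b|` it determines the pair up to a common sign. -/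
theorem abs_fold (a b : ℝ) :
    |a| = |(|a + b| - |a - b|) / 2| + max (|a| - |b|) 0 ∧
    |b| = |(|a + b| - |a - b|) / 2| + max (-(|a| - |b|)) 0 := by
  constructor <;>
  · rcases abs_cases (a + b) with ⟨h1, h1'⟩ | ⟨h1, h1'⟩ <;>
    rcases abs_cases (a - b) with ⟨h2, h2'⟩ | ⟨h2, h2'⟩ <;>
    rw [h1, h2] <;>
    rcases abs_cases a with ⟨h3, h3'⟩ | ⟨h3, h3'⟩ <;>
    rcases abs_cases b with ⟨h4, h4'⟩ | ⟨h4, h4'⟩ <;>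
    rw [h3, h4] <;> grind

theorem fold_fibre {a b c d : ℝ} (h1 : |a| - |b| = |c| - |d|)
    (h2 : (|a + b| - |a - b|) / 2 = (|c + d| - |c - d|) / 2) :
    (a = c ∧ b = d) ∨ (a = -c ∧ b = -d) := by
  obtain ⟨ha, hb⟩ := abs_fold a b
  obtain ⟨hc, hd⟩ := abs_fold c d
  rw [h1, h2, ← hc] at ha
  rw [h1, h2, ← hd] at hb
  rcases abs_eq_abs.1 ha with rfl | rfl <;> rcases abs_eq_abs.1 hb with rfl | rfl
  · exact Or.inl ⟨rfl, rfl⟩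
  · grind
  · grind
  · exact Or.inr ⟨rfl, rfl⟩

theorem foldMap_eq_iff {w w' : ℂ × ℂ} : foldMap w = foldMap w' ↔ w' = w ∨ w' = refl w := by
  constructor
  · intro h
    have h0 : w.1.im = w'.1.im := congrFun h 0
    have h1 : w.2.im = w'.2.im := congrFun h 1
    rcases fold_fibre (congrFun h 2) (congrFun h 3) with ⟨ha, hb⟩ | ⟨ha, hb⟩
    · exact Or.inl (Prod.ext (Complex.ext ha.symm h0.symm) (Complex.ext hb.symm h1.symm))
    · refine Or.inr (Prod.ext (Complex.ext ?_ ?_) (Complex.ext ?_ ?_)) <;>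
        simp [refl, ha, hb, h0, h1]
  · rintro (rfl | rfl)
    · rfl
    · have e1 : |-w.1.re + -w.2.re| = |w.1.re + w.2.re| := by rw [← neg_add, abs_neg]
      have e2 : |-w.1.re + w.2.re| = |w.1.re - w.2.re| := by rw [neg_add_eq_sub, abs_sub_comm]
      simp [foldMap, refl, e1, e2]

/-- The size of `u 3` is the smaller absolute value, the sign of `u 2` says which coordinate is
larger, and the sign of `u 3` is put on one coordinate. -/
theorem foldMap_surjective : Function.Surjective foldMap := by
  intro u
  rcases le_total 0 (u 3) with h3 | h3 <;> rcases le_total 0 (u 2) with h2 | h2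
  · refine ⟨(⟨u 3 + u 2, u 0⟩, ⟨u 3, u 1⟩), ?_⟩
    funext i
    fin_cases i <;> simp [foldMap] <;> grind
  · refine ⟨(⟨u 3, u 0⟩, ⟨u 3 - u 2, u 1⟩), ?_⟩
    funext i
    fin_cases i <;> simp [foldMap] <;> grind
  · refine ⟨(⟨-u 3 + u 2, u 0⟩, ⟨u 3, u 1⟩), ?_⟩
    funext i
    fin_cases i <;> simp [foldMap] <;> grind
  · refine ⟨(⟨-u 3, u 0⟩, ⟨u 3 + u 2, u 1⟩), ?_⟩
    funext i
    fin_cases i <;> simp [foldMap] <;> grind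

theorem norm_le_foldMap (w : ℂ × ℂ) : ‖w‖ ≤ 3 * ‖foldMap w‖ := by
  have hi : ∀ i, |foldMap w i| ≤ ‖foldMap w‖ := fun i =>
    norm_le_pi_norm (foldMap w) i
  have h0 : |w.1.im| ≤ _ := hi 0
  have h1 : |w.2.im| ≤ _ := hi 1
  have h2 : |(|w.1.re| - |w.2.re|)| ≤ _ := hi 2
  have h3 : |(|w.1.re + w.2.re| - |w.1.re - w.2.re|) / 2| ≤ _ := hi 3
  obtain ⟨ha, hb⟩ := abs_fold w.1.re w.2.re
  have h4 : max (|w.1.re| - |w.2.re|) 0 ≤ |(|w.1.re| - |w.2.re|)| :=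
    max_le (le_abs_self _) (abs_nonneg _)
  have h5 : max (-(|w.1.re| - |w.2.re|)) 0 ≤ |(|w.1.re| - |w.2.re|)| :=
    max_le (neg_le_abs _) (abs_nonneg _)
  refine max_le ((Complex.norm_le_abs_re_add_abs_im _).trans ?_)
    ((Complex.norm_le_abs_re_add_abs_im _).trans ?_) <;> linarith

theorem isClosedMap_foldMap : IsClosedMap foldMap := by
  refine IsProperMap.isClosedMap ?_
  rw [isProperMap_iff_tendsto_cocompact]
  refine ⟨continuous_foldMap, ?_⟩
  rw [← Metric.cobounded_eq_cocompact, ← Metric.cobounded_eq_cocompact, ← comap_norm_atTop,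
    ← comap_norm_atTop, Filter.tendsto_comap_iff]
  have h : Filter.Tendsto (fun w : ℂ × ℂ => ‖w‖ / 3) (Filter.comap norm Filter.atTop)
      Filter.atTop := Filter.tendsto_comap.atTop_div_const (by norm_num)
  refine Filter.tendsto_atTop_mono (fun w => ?_) h
  have := norm_le_foldMap w
  simp only [Function.comp_apply]
  linarith

theorem continuous_refl : Continuous refl := by
  have h := continuous_permMap (dihPerm 9)
  rwa [permMap_refl] at h

/-- A closed continuous surjection is a quotient map, and the saturation of an open set `U` is the
open set consisting of `U` and its mirror image. -/
theorem isOpenMap_foldMap : IsOpenMap foldMap := by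
  have hq : Topology.IsQuotientMap foldMap :=
    isClosedMap_foldMap.isQuotientMap continuous_foldMap foldMap_surjective
  intro U hU
  rw [← hq.isOpen_preimage]
  have : foldMap ⁻¹' (foldMap '' U) = U ∪ refl ⁻¹' U := by
    ext w
    simp only [Set.mem_preimage, Set.mem_image, Set.mem_union]
    constructor
    · rintro ⟨w', hw', h⟩
      rcases foldMap_eq_iff.1 h.symm with rfl | rfl
      · exact Or.inl hw'
      · exact Or.inr hw'
    · rintro (h | h)
      · exact ⟨w, h, rfl⟩
      · exact ⟨_, h, (foldMap_eq_iff.2 (Or.inr rfl)).symm⟩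
  rw [this]
  exact hU.union (hU.preimage continuous_refl)

theorem foldMap_mem_coordPlane {w : ℂ × ℂ} :
    foldMap w ∈ coordPlane ↔ w.1.re = 0 ∧ w.2.re = 0 := by
  constructor
  · rintro ⟨h2, h3⟩
    have h2 : |w.1.re| - |w.2.re| = 0 := h2
    have h3 : (|w.1.re + w.2.re| - |w.1.re - w.2.re|) / 2 = 0 := h3
    obtain ⟨ha, hb⟩ := abs_fold w.1.re w.2.re
    rw [h2, h3] at ha hb
    simp only [abs_zero, max_self, add_zero, neg_zero, abs_eq_zero] at ha hb
    exact ⟨ha, hb⟩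
  · rintro ⟨h1, h2⟩
    constructor <;> simp [foldMap, h1, h2]

theorem refl_eq_self_iff (w : ℂ × ℂ) : refl w = w ↔ w.1.re = 0 ∧ w.2.re = 0 := by
  rw [← permMap_dihPerm_nine_eq_self, permMap_refl]

/-- The singular set is locally flat away from the cone points. -/
theorem isPLLocallyModelledOn_coordPlane {x : Orb} (hx : x ∈ singularSet)
    (hcone : x ∉ Set.range conePoint) : IsPLLocallyModelledOn singularSet x coordPlane := by
  rw [singularSet_eq_lagrangianTorus] at hx
  obtain ⟨v, hv, rfl⟩ := hx
  have hv : v.1.re = 0 ∧ v.2.re = 0 := hv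
  have hfix := (permMap_dihPerm_nine_eq_self v).2 hv
  obtain ⟨W₁, hW₁, W₂, hW₂, hW⟩ := Filter.eventually_prod_iff.1
    (nhds_prod_eq (x := v) (y := v) ▸ eventually_sub_mem_lattice v)
  obtain ⟨W, hWs, hWo, hvW⟩ := mem_nhds_iff.1 (Filter.inter_mem hW₁ hW₂)
  have hrefl : ∀ w, refl (w - v) = refl w - v := fun w => by
    rw [map_sub, (refl_eq_self_iff v).2 hv]
  -- Within `W` the only identifications are those by the isotropy of `v`, namely the identity and
  -- one reflection.
  have key : ∀ w ∈ W, ∀ w' ∈ W, ∀ m : Fin 10, permMap (dihPerm m) w - w' ∈ lattice →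
      (m = 0 ∧ w' = w) ∨ (m = 9 ∧ w' = refl w) := by
    intro w hw w' hw' m hm
    obtain ⟨h1, h2⟩ := hW (hWs hw).1 (hWs hw').2 m hm
    simp only at h2
    rcases eq_of_not_conePoint hfix hcone h1 with rfl | rfl
    · rw [dihPerm_zero, permMap_one, sub_left_inj] at h2
      exact Or.inl ⟨rfl, h2⟩
    · rw [permMap_refl] at h2
      change w' - v = refl (w - v) at h2
      rw [hrefl, sub_left_inj] at h2
      exact Or.inr ⟨rfl, h2⟩
  have hproj : ∀ w, proj (refl w) = proj w := fun w => by
    rw [eq_comm, proj_eq_iff]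
    exact ⟨9, by rw [permMap_refl, sub_self]; exact lattice.zero_mem⟩
  have hEc : Continuous fun w : ℂ × ℂ => foldMap (w - v) :=
    continuous_foldMap.comp (continuous_id.sub continuous_const)
  have hEo : IsOpenMap fun w : ℂ × ℂ => foldMap (w - v) :=
    isOpenMap_foldMap.comp (Homeomorph.subRight v).isOpenMap
  obtain ⟨e, hes, he⟩ := exists_openPartialHomeomorph continuous_proj isOpenMap_proj hEc hEo hWo
    fun w hw w' hw' => by
      rw [foldMap_eq_iff, hrefl, sub_left_inj, sub_left_inj]
      constructor
      · intro h
        obtain ⟨m, hm⟩ := (proj_eq_iff _ _).1 h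
        rcases key w hw w' hw' m hm with ⟨-, h⟩ | ⟨-, h⟩
        · exact Or.inl h
        · exact Or.inr h
      · rintro (rfl | rfl)
        · rfl
        · exact (hproj w).symm
  refine ⟨e, isPLOn_of_plNear (e.open_source.preimage continuous_proj) fun w₀ hw₀ => ?_,
    hes ▸ ⟨v, hvW, rfl⟩, ?_, ?_⟩
  -- A lift of a source point may lie outside `W`. A group element moves it into `W`, so near it the
  -- chart is `foldMap` after an affine map.
  · rw [Set.mem_preimage, hes] at hw₀
    obtain ⟨w₁, hw₁, h⟩ := hw₀
    obtain ⟨m, hm⟩ := (proj_eq_iff _ _).1 h.symm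
    set u := permMap (dihPerm m) w₀ - w₁ with hu
    let A : (ℂ × ℂ) →ᵃ[ℝ] (ℂ × ℂ) := (permMap (dihPerm m)).toAffineMap -
      AffineMap.const ℝ _ (u + v)
    have hA : ∀ w, A w = (permMap (dihPerm m) w - u) - v := fun w => by
      change permMap (dihPerm m) w - (u + v) = _
      rw [sub_sub]
    have hAc : Continuous A := AffineMap.continuous_of_finiteDimensional A
    have hAw : Continuous fun w => permMap (dihPerm m) w - u :=
      (continuous_permMap _).sub continuous_const
    refine ((isPL_foldMap.plNear (A w₀)).comp_affineEquiv A hAc.continuousAt).congr ?_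
    have h0 : permMap (dihPerm m) w₀ - u ∈ W := by rw [hu, sub_sub_cancel]; exact hw₁
    filter_upwards [hAw.continuousAt.eventually (hWo.mem_nhds h0)] with w hw
    rw [Function.comp_apply, hA, ← he _ hw]
    congr 1
    rw [eq_comm, proj_eq_iff]
    exact ⟨m, by rwa [sub_sub_cancel]⟩
  · rw [he v hvW, sub_self]
    funext i
    fin_cases i <;> simp [foldMap]
  · intro y hy
    rw [hes] at hy
    obtain ⟨w, hw, rfl⟩ := hy
    rw [he w hw, foldMap_mem_coordPlane, ← refl_eq_self_iff, hrefl, sub_left_inj]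
    constructor
    · intro h
      rw [proj_mem_singularSet_iff] at h
      obtain ⟨m, hm0, hm⟩ := h
      have : permMap (dihPerm m) w - w ∈ lattice := by
        rw [← torus_eq_iff_sub, torus_eq_iff]
        simpa only [confMap_permMap] using fun k => (hm k).symm
      rcases key w hw w hw m this with ⟨h, -⟩ | ⟨-, h⟩
      · exact absurd h hm0
      · exact h.symm
    · intro h
      rw [singularSet_eq_lagrangianTorus]
      exact ⟨w, (refl_eq_self_iff w).1 h, rfl⟩

/-! ### The fan -/

/-- The vector in `ℤ⁴` with the given label. -/
def fanInt (j : ℕ) : Fin 4 → ℤ := (fanVectors.lookup j).getD 0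

/-- The vector in `ℝ⁴` with the given label. -/
def fanVec (j : ℕ) : Fin 4 → ℝ := fun i => fanInt j i

/-- The linear map to `ℝ⁴` determined by the vectors which span the fan. -/
noncomputable def fanMap : (ℕ → ℝ) →ₗ[ℝ] (Fin 4 → ℝ) :=
  ∑ j ∈ Finset.range 104, (LinearMap.proj j).smulRight (fanVec j)

theorem fanMap_apply (x : ℕ → ℝ) : fanMap x = ∑ j ∈ Finset.range 104, x j • fanVec j := by
  simp [fanMap]

theorem fanMap_single {j : ℕ} (hj : j < 104) (c : ℝ) :
    fanMap (Pi.single j c) = c • fanVec j := by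
  rw [fanMap_apply, Finset.sum_eq_single j]
  · simp
  · intro l _ hl; simp [hl]
  · intro h; exact absurd (Finset.mem_range.2 hj) h

theorem fanMap_wvec {s : List (ℕ × ℕ)} (hs : ∀ p ∈ s, p.1 < 104) (i : Fin 4) :
    fanMap (wvec s) i = ((s.map fun p => (p.2 : ℤ) * fanInt p.1 i).sum : ℤ) := by
  induction s with
  | nil => simp [wvec]
  | cons p l ih =>
    have ih := ih fun q hq => hs q (List.mem_cons_of_mem _ hq)
    have h3 : wvec (p :: l) = Pi.single p.1 (p.2 : ℝ) + wvec l := by simp [wvec]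
    rw [h3, map_add, Pi.add_apply, ih, fanMap_single (hs p List.mem_cons_self)]
    simp [fanVec]

theorem fanMap_fanFlips : ∀ m ∈ fanFlips, fanMap (wvec m.1) = fanMap (wvec m.2) := by
  have h1 : ∀ m ∈ fanFlips, (∀ p ∈ m.1 ++ m.2, p.1 < 104) ∧ ∀ i : Fin 4,
      (m.1.map fun p => (p.2 : ℤ) * fanInt p.1 i).sum =
      (m.2.map fun p => (p.2 : ℤ) * fanInt p.1 i).sum := by decide +kernel
  intro m hm
  obtain ⟨h2, h3⟩ := h1 m hm
  funext i
  rw [fanMap_wvec fun p hp => h2 p (List.mem_append_left _ hp),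
    fanMap_wvec fun p hp => h2 p (List.mem_append_right _ hp), h3]

/-- The weights of a positive linear relation. -/
def fanRelation : List (ℕ × ℕ) := [(10, 1), (33, 3), (6, 2), (25, 1), (101, 1)]

/-- Five vectors spanning `ℝ⁴` with a positive relation give a complete fan: the cones over the
boundary of a simplex around the origin. -/
theorem fanMap_fanRelation : fanMap (wvec fanRelation) = 0 := by
  funext i
  rw [fanMap_wvec (by decide)]
  have : ∀ i : Fin 4, (fanRelation.map fun p => (p.2 : ℤ) * fanInt p.1 i).sum = 0 := by
    decide +kernel
  rw [this]
  simp

theorem fanMap_of_support {y : ℕ → ℝ} (hy : ∀ j, y j ≠ 0 → j ∈ fanSimplex) (i : Fin 4) :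
    fanMap y i = y 10 * fanInt 10 i + y 33 * fanInt 33 i + y 6 * fanInt 6 i +
      y 25 * fanInt 25 i + y 101 * fanInt 101 i := by
  have h : fanMap y = ∑ j ∈ ({10, 33, 6, 25, 101} : Finset ℕ), y j • fanVec j := by
    rw [fanMap_apply]
    refine (Finset.sum_subset (by decide) fun j _ hj => ?_).symm
    have : y j = 0 := by
      by_contra h
      have := hy j h
      simp only [fanSimplex, List.mem_cons, List.not_mem_nil, or_false] at this
      simp only [Finset.mem_insert, Finset.mem_singleton] at hj
      exact hj this
    rw [this, zero_smul]
  rw [h]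
  simp [fanVec]
  ring

/-- Coordinates with respect to a basis of `ℝ⁴` consisting of four of the vectors. -/
noncomputable def basisCoord : (Fin 4 → ℝ) →ₗ[ℝ] (ℕ → ℝ) where
  toFun w :=
    Pi.single 10 (-5 / 18 * w 0 - 1 / 6 * w 1 - 2 / 9 * w 2 + 2 / 3 * w 3) +
    Pi.single 33 (-1 / 18 * w 0 + 1 / 6 * w 1 + 5 / 9 * w 2 + 1 / 3 * w 3) +
    Pi.single 6 (2 / 9 * w 0 + 1 / 3 * w 1 - 2 / 9 * w 2 - 1 / 3 * w 3) +
    Pi.single 25 (1 / 9 * w 0 - 1 / 3 * w 1 - 1 / 9 * w 2 + 1 / 3 * w 3)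
  map_add' w w' := by
    funext j
    simp only [Pi.add_apply, Pi.single_apply]
    split_ifs <;> ring
  map_smul' c w := by
    funext j
    simp only [Pi.add_apply, Pi.smul_apply, Pi.single_apply, smul_eq_mul, RingHom.id_apply]
    split_ifs <;> ring

theorem fanInt_values : fanInt 10 = ![-1, 1, -1, 1] ∧ fanInt 33 = ![1, 1, 1, 1] ∧
    fanInt 6 = ![2, 2, -1, 1] ∧ fanInt 25 = ![3, -1, 0, 1] ∧ fanInt 101 = ![-9, -7, 0, -7] := by
  decide +kernel

theorem basisCoord_support (w : Fin 4 → ℝ) (j : ℕ) (hj : basisCoord w j ≠ 0) :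
    j ∈ fanSimplex := by
  by_contra h
  simp only [fanSimplex, List.mem_cons, List.not_mem_nil, or_false, not_or] at h
  apply hj
  simp [basisCoord, h]

theorem fanMap_basisCoord (w : Fin 4 → ℝ) : fanMap (basisCoord w) = w := by
  obtain ⟨h10, h33, h6, h25, h101⟩ := fanInt_values
  funext i
  rw [fanMap_of_support (basisCoord_support w), h10, h33, h6, h25, h101]
  fin_cases i <;> simp [basisCoord] <;> ring

theorem wvec_fanRelation_support (j : ℕ) (hj : wvec fanRelation j ≠ 0) : j ∈ fanSimplex := by
  by_contra h
  exact hj (wvec_apply_of_notMem h)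

theorem basisCoord_fanMap {y : ℕ → ℝ} (hy : ∀ j, y j ≠ 0 → j ∈ fanSimplex) :
    basisCoord (fanMap y) = y - y 101 • wvec fanRelation := by
  obtain ⟨h10, h33, h6, h25, h101⟩ := fanInt_values
  funext j
  by_cases hj : j ∈ fanSimplex
  · simp only [fanSimplex, List.mem_cons, List.not_mem_nil, or_false] at hj
    simp only [basisCoord, LinearMap.coe_mk, AddHom.coe_mk, fanMap_of_support hy, h10, h33, h6, h25,
      h101, Matrix.cons_val]
    rcases hj with rfl | rfl | rfl | rfl | rfl <;> simp [wvec, fanRelation] <;> ring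
  · have h1 := not_imp_comm.1 (basisCoord_support (fanMap y) j) hj
    have h2 := not_imp_comm.1 (hy j) hj
    have h3 := not_imp_comm.1 (wvec_fanRelation_support j) hj
    simp [h1, h2, h3]

/-- The point over a given vector in the cone over the boundary of a simplex. -/
noncomputable def fanBase (w : Fin 4 → ℝ) : ℕ → ℝ :=
  basisCoord w - wmin fanRelation (basisCoord w) • wvec fanRelation

theorem continuous_basisCoord : Continuous basisCoord := by
  refine continuous_pi fun j => ?_
  exact LinearMap.continuous_of_finiteDimensional (LinearMap.proj j ∘ₗ basisCoord)

theorem continuous_fanBase : Continuous fanBase :=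
  continuous_basisCoord.sub (((continuous_wmin _).comp continuous_basisCoord).smul continuous_const)

theorem fanMap_fanBase (w : Fin 4 → ℝ) : fanMap (fanBase w) = w := by
  rw [fanBase, map_sub, map_smul, fanMap_fanRelation, fanMap_basisCoord, smul_zero, sub_zero]

theorem fanRelation_nodup : (fanRelation.map Prod.fst).Nodup := by decide

theorem fanRelation_pos : ∀ p ∈ fanRelation, 0 < p.2 := by decide

theorem wmin_add_smul_wvec (x : ℕ → ℝ) (c : ℝ) :
    wmin fanRelation (x + c • wvec fanRelation) = wmin fanRelation x + c := by
  have key : ∀ p ∈ fanRelation, (x + c • wvec fanRelation) p.1 / p.2 = x p.1 / p.2 + c := by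
    intro p hp
    have hp2 : (0 : ℝ) < p.2 := Nat.cast_pos.2 (fanRelation_pos p hp)
    rw [Pi.add_apply, Pi.smul_apply, wvec_apply_of_mem fanRelation_nodup hp, smul_eq_mul]
    field_simp
  have hne : fanRelation ≠ [] := by decide
  obtain ⟨p, hp, h⟩ := exists_wmin hne x
  refine wmin_eq hne ⟨p, hp, by rw [key p hp, h]⟩ fun q hq => ?_
  rw [key q hq]
  linarith [wmin_le hq x]

theorem mem_fanSimplex {j : ℕ} : j ∈ fanSimplex ↔ ∃ p ∈ fanRelation, p.1 = j := by
  simp [fanSimplex, fanRelation, eq_comm]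

/-- Subtracting the largest possible multiple of the positive relation makes all coordinates
nonnegative and at least one of them zero. -/
theorem fanBase_mem (w : Fin 4 → ℝ) : fanBase w ∈ simplicialCone (simplexBoundary fanSimplex) := by
  have hval : ∀ p ∈ fanRelation, fanBase w p.1 =
      (basisCoord w p.1 / p.2 - wmin fanRelation (basisCoord w)) * p.2 := by
    intro p hp
    have hp2 : (0 : ℝ) < p.2 := Nat.cast_pos.2 (fanRelation_pos p hp)
    rw [fanBase, Pi.sub_apply, Pi.smul_apply, wvec_apply_of_mem fanRelation_nodup hp, smul_eq_mul]
    field_simp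
  have hsupp : ∀ j, fanBase w j ≠ 0 → j ∈ fanSimplex := fun j hj => by
    by_contra h
    apply hj
    have h1 := not_imp_comm.1 (basisCoord_support w j) h
    have h3 := not_imp_comm.1 (wvec_fanRelation_support j) h
    simp [fanBase, h1, h3]
  rw [mem_simplexBoundary_cone]
  refine ⟨fun j => ?_, hsupp, ?_⟩
  · rcases eq_or_ne (fanBase w j) 0 with h | h
    · exact h.ge
    · obtain ⟨p, hp, rfl⟩ := mem_fanSimplex.1 (hsupp j h)
      rw [hval p hp]
      exact mul_nonneg (sub_nonneg.2 (wmin_le hp _)) (Nat.cast_nonneg _)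
  · obtain ⟨p, hp, h⟩ := exists_wmin (s := fanRelation) (by decide) (basisCoord w)
    exact ⟨p.1, mem_fanSimplex.2 ⟨p, hp, rfl⟩, by rw [hval p hp, h, sub_self, zero_mul]⟩

/-- Coordinates over a given vector are unique up to multiples of the relation, and the vanishing
minimum fixes the multiple. -/
theorem fanBase_fanMap {y : ℕ → ℝ} (hy : y ∈ simplicialCone (simplexBoundary fanSimplex)) :
    fanBase (fanMap y) = y := by
  obtain ⟨h0, hs, j, hj, hyj⟩ := mem_simplexBoundary_cone.1 hy
  have hmin : wmin fanRelation y = 0 := by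
    obtain ⟨p, hp, rfl⟩ := mem_fanSimplex.1 hj
    refine wmin_eq (by decide) ⟨p, hp, by rw [hyj, zero_div]⟩ fun q _ =>
      div_nonneg (h0 _) (Nat.cast_nonneg _)
  rw [fanBase, basisCoord_fanMap hs, sub_eq_add_neg y, ← neg_smul, wmin_add_smul_wvec, hmin]
  module

/-- The point of the cone over the subdivided fan over a given vector. -/
noncomputable def fanLift (w : Fin 4 → ℝ) : ℕ → ℝ := flipSeq fanFlips (fanBase w)

theorem continuous_fanLift : Continuous fanLift :=
  (continuous_flipSeq _).comp continuous_fanBase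

theorem fanLift_mem (w : Fin 4 → ℝ) : fanLift w ∈ simplicialCone fanFacets :=
  (flipSeq_mem admissible_fanFlips transforms_fanFlips (fanBase_mem w)).1

theorem fanMap_fanLift (w : Fin 4 → ℝ) : fanMap (fanLift w) = w := by
  rw [fanLift, map_flipSeq fanMap fanMap_fanFlips, fanMap_fanBase]

theorem fanLift_fanMap {u : ℕ → ℝ} (hu : u ∈ simplicialCone fanFacets) :
    fanLift (fanMap u) = u := by
  obtain ⟨h1, h2⟩ := unflipSeq_mem admissible_fanFlips transforms_fanFlips hu
  rw [fanLift, ← map_unflipSeq fanMap fanMap_fanFlips u, fanBase_fanMap h1, h2]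

/-! ### The cone over the figure-eight knot -/

/-- The cone spanned by two vectors. -/
def planeCone (P Q : Fin 4 → ℝ) : Set (Fin 4 → ℝ) :=
  {w | ∃ a b : ℝ, 0 ≤ a ∧ 0 ≤ b ∧ w = a • P + b • Q}

theorem planeCone_comm (P Q : Fin 4 → ℝ) : planeCone P Q = planeCone Q P := by
  ext w
  constructor <;> rintro ⟨a, b, ha, hb, rfl⟩ <;> exact ⟨b, a, hb, ha, add_comm _ _⟩

/-- `R` spans a ray inside the cone, and comparing `b / a` with `β / α` tells on which side of that
ray a point lies. -/
theorem planeCone_split {P Q R : Fin 4 → ℝ} {α β γ : ℝ} (hα : 0 < α) (hβ : 0 < β) (hγ : 0 < γ)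
    (h : γ • R = α • P + β • Q) : planeCone P Q = planeCone P R ∪ planeCone R Q := by
  have hR : R = (α / γ) • P + (β / γ) • Q := by
    rw [← inv_smul_smul₀ hγ.ne' R, h, smul_add, smul_smul, smul_smul]
    congr 2 <;> field_simp
  ext w
  constructor
  · rintro ⟨a, b, ha, hb, rfl⟩
    rcases le_total (b * α) (a * β) with hle | hle
    · refine Or.inl ⟨a - b * α / β, b * γ / β, ?_, by positivity, ?_⟩
      · rw [sub_nonneg, div_le_iff₀ hβ]; exact hle
      · rw [hR]
        match_scalars <;> field_simp
        ring
    · refine Or.inr ⟨a * γ / α, b - a * β / α, by positivity, ?_, ?_⟩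
      · rw [sub_nonneg, div_le_iff₀ hα]; exact hle
      · rw [hR]
        match_scalars <;> field_simp
        ring
  · rintro (⟨a, b, ha, hb, rfl⟩ | ⟨a, b, ha, hb, rfl⟩)
    · refine ⟨a + b * (α / γ), b * (β / γ), by positivity, by positivity, ?_⟩
      rw [hR]
      module
    · refine ⟨a * (α / γ), a * (β / γ) + b, by positivity, by positivity, ?_⟩
      rw [hR]
      module

theorem fanMap_image_edges (l : List (ℕ × ℕ)) (hl : ∀ e ∈ l, e.1 < 104 ∧ e.2 < 104 ∧ e.1 ≠ e.2) :
    fanMap '' simplicialCone (l.map edgeFace) = ⋃ e ∈ l, planeCone (fanVec e.1) (fanVec e.2) := by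
  have hbit : ∀ (e : ℕ × ℕ) (j : ℕ), (edgeFace e).testBit j = true ↔ j = e.1 ∨ j = e.2 := by
    intro e j
    rw [edgeFace, testBit_mask]
    simp [eq_comm]
  ext w
  simp only [Set.mem_iUnion, Set.mem_image]
  constructor
  · rintro ⟨x, ⟨hx0, F, hF, hxF⟩, rfl⟩
    obtain ⟨e, he, rfl⟩ := List.mem_map.1 hF
    obtain ⟨h1, h2, h3⟩ := hl e he
    refine ⟨e, he, x e.1, x e.2, hx0 _, hx0 _, ?_⟩
    have : x = Pi.single e.1 (x e.1) + Pi.single e.2 (x e.2) := by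
      funext j
      rw [Pi.add_apply]
      by_cases h4 : j = e.1
      · subst h4; simp [h3]
      by_cases h5 : j = e.2
      · subst h5; simp [h3.symm]
      have : x j = 0 := by
        by_contra h
        rcases (hbit e j).1 (hxF j h) with h | h
        · exact h4 h
        · exact h5 h
      simp [h4, h5, this]
    rw [this, map_add, fanMap_single h1, fanMap_single h2, ← this]
  · rintro ⟨e, he, a, b, ha, hb, rfl⟩
    obtain ⟨h1, h2, h3⟩ := hl e he
    refine ⟨Pi.single e.1 a + Pi.single e.2 b, ⟨fun j => ?_, edgeFace e, List.mem_map_of_mem he,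
      fun j hj => ?_⟩, ?_⟩
    · simp only [Pi.add_apply, Pi.single_apply]
      split_ifs <;> positivity
    · rw [hbit]
      by_contra h
      push Not at h
      exact hj (by simp [h])
    · rw [map_add, fanMap_single h1, fanMap_single h2]

/-- The label of a vertex of the heptagon. -/
def heptagonLabel : Fin 7 → ℕ := ![35, 10, 33, 6, 9, 25, 100]

theorem fanVec_heptagonLabel (i : Fin 7) : fanVec (heptagonLabel i) =
    ![figureEightVertex i 0, figureEightVertex i 1, figureEightVertex i 2, 1] := by
  have h : ∀ i : Fin 7, fanInt (heptagonLabel i) =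
      ![![-1, -2, 0, 1], ![-1, 1, -1, 1], ![1, 1, 1, 1], ![2, 2, -1, 1], ![-2, 1, 0, 1],
        ![3, -1, 0, 1], ![2, 3, 1, 1]] i := by decide +kernel
  funext k
  rw [fanVec, h]
  fin_cases i <;> fin_cases k <;> simp [figureEightVertex]

theorem coneOver_figureEight : coneOver figureEight =
    ⋃ i : Fin 7, planeCone (fanVec (heptagonLabel i)) (fanVec (heptagonLabel (i + 1))) := by
  ext w
  simp only [figureEight, coneOver, Set.mem_iUnion, Set.mem_ofPred_eq, fanVec_heptagonLabel]
  constructor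
  · rintro ⟨t, ht, p, ⟨i, a, b, ha, hb, hab, rfl⟩, rfl⟩
    refine ⟨i, t * a, t * b, mul_nonneg ht ha, mul_nonneg ht hb, ?_⟩
    funext k
    fin_cases k
    · simp; ring
    · simp; ring
    · simp; ring
    · simp; linear_combination -t * hab
  · rintro ⟨i, a, b, ha, hb, rfl⟩
    rcases (add_nonneg ha hb).eq_or_lt with h | h
    · obtain rfl : a = 0 := by linarith
      obtain rfl : b = 0 := by linarith
      refine ⟨0, le_rfl, _, ⟨i, left_mem_segment _ _ _⟩, ?_⟩
      funext k
      fin_cases k <;> simp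
    · refine ⟨a + b, h.le, _, ⟨i, a / (a + b), b / (a + b), by positivity, by positivity,
        by field_simp, rfl⟩, ?_⟩
      funext k
      fin_cases k <;> simp <;> field_simp

theorem fanVec_relation {i j k : ℕ} {a b c : ℕ}
    (h : ∀ l, (c : ℤ) * fanInt k l = a * fanInt i l + b * fanInt j l) :
    (c : ℝ) • fanVec k = (a : ℝ) • fanVec i + (b : ℝ) • fanVec j := by
  funext l
  simp only [Pi.add_apply, Pi.smul_apply, smul_eq_mul, fanVec]
  exact_mod_cast h l

/-- The edge from `100` to `35` is the one side of the heptagon that is subdivided further. Each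
relation places the next vertex between the previous one and `35`. -/
theorem planeCone_subdivision : planeCone (fanVec 100) (fanVec 35) =
    planeCone (fanVec 100) (fanVec 5) ∪ (planeCone (fanVec 5) (fanVec 8) ∪
    (planeCone (fanVec 8) (fanVec 7) ∪ (planeCone (fanVec 7) (fanVec 102) ∪
    (planeCone (fanVec 102) (fanVec 103) ∪ planeCone (fanVec 103) (fanVec 35))))) := by
  have h1 := fanVec_relation (i := 100) (j := 35) (k := 5) (a := 7) (b := 1) (c := 1)
    (by decide +kernel)
  have h2 := fanVec_relation (i := 5) (j := 35) (k := 8) (a := 22) (b := 69) (c := 7)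
    (by decide +kernel)
  have h3 := fanVec_relation (i := 8) (j := 35) (k := 7) (a := 4) (b := 3) (c := 11)
    (by decide +kernel)
  have h4 := fanVec_relation (i := 7) (j := 35) (k := 102) (a := 11) (b := 9) (c := 8)
    (by decide +kernel)
  have h5 := fanVec_relation (i := 102) (j := 35) (k := 103) (a := 13) (b := 28) (c := 11)
    (by decide +kernel)
  rw [planeCone_split (by norm_num) (by norm_num) (by norm_num) h1,
    planeCone_split (by norm_num) (by norm_num) (by norm_num) h2,
    planeCone_split (by norm_num) (by norm_num) (by norm_num) h3,
    planeCone_split (by norm_num) (by norm_num) (by norm_num) h4,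
    planeCone_split (by norm_num) (by norm_num) (by norm_num) h5]

theorem fanKnot_lt : ∀ e ∈ fanKnot, e.1 < 104 ∧ e.2 < 104 ∧ e.1 ≠ e.2 := by decide

theorem mem_fanKnot_cones (w : Fin 4 → ℝ) :
    (w ∈ ⋃ e ∈ fanKnot, planeCone (fanVec e.1) (fanVec e.2)) ↔
      w ∈ planeCone (fanVec 6) (fanVec 33) ∨
      w ∈ planeCone (fanVec 25) (fanVec 100) ∨
        w ∈ planeCone (fanVec 35) (fanVec 10) ∨
          w ∈ planeCone (fanVec 10) (fanVec 33) ∨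
            w ∈ planeCone (fanVec 25) (fanVec 9) ∨
              w ∈ planeCone (fanVec 6) (fanVec 9) ∨ w ∈ planeCone (fanVec 100) (fanVec 35) := by
  have h := Set.ext_iff.1 planeCone_subdivision w
  simp only [Set.mem_union] at h
  rw [h]
  simp only [fanKnot, Set.mem_iUnion, List.mem_cons, List.not_mem_nil, or_false, exists_prop,
    or_and_right, exists_or, exists_eq_left]

theorem mem_heptagon_cones (w : Fin 4 → ℝ) :
    (w ∈ ⋃ i : Fin 7, planeCone (fanVec (heptagonLabel i)) (fanVec (heptagonLabel (i + 1)))) ↔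
      w ∈ planeCone (fanVec 6) (fanVec 33) ∨
      w ∈ planeCone (fanVec 25) (fanVec 100) ∨
        w ∈ planeCone (fanVec 35) (fanVec 10) ∨
          w ∈ planeCone (fanVec 10) (fanVec 33) ∨
            w ∈ planeCone (fanVec 25) (fanVec 9) ∨
              w ∈ planeCone (fanVec 6) (fanVec 9) ∨ w ∈ planeCone (fanVec 100) (fanVec 35) := by
  have e : ∀ P : Fin 7 → Prop, (∃ i, P i) ↔ P 2 ∨ P 5 ∨ P 0 ∨ P 1 ∨ P 4 ∨ P 3 ∨ P 6 := by
    intro P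
    simp only [Fin.exists_fin_succ, IsEmpty.exists_iff, or_false]
    change P 0 ∨ P 1 ∨ P 2 ∨ P 3 ∨ P 4 ∨ P 5 ∨ P 6 ↔ _
    tauto
  rw [Set.mem_iUnion, e, planeCone_comm (fanVec 6) (fanVec 33), planeCone_comm (fanVec 25) (fanVec 9)]
  exact Iff.rfl

theorem fanMap_image_fanKnot :
    fanMap '' simplicialCone (fanKnot.map edgeFace) = coneOver figureEight := by
  rw [coneOver_figureEight, fanMap_image_edges _ fanKnot_lt]
  ext w
  rw [mem_fanKnot_cones, mem_heptagon_cones]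

/-! ### The local model at the cone points -/

/-- Set the coordinate with label `0` to zero. -/
noncomputable def dropZero : (ℕ → ℝ) →ₗ[ℝ] (ℕ → ℝ) :=
  LinearMap.id - (LinearMap.proj 0).smulRight (Pi.single 0 1)

theorem dropZero_apply (y : ℕ → ℝ) (j : ℕ) : dropZero y j = if j = 0 then 0 else y j := by
  by_cases h : j = 0
  · subst h; simp [dropZero]
  · simp [dropZero, h]

theorem flipMap_zero (s t : List (ℕ × ℕ)) : flipMap s t 0 = 0 := by
  have : wmin s 0 = 0 := by
    rcases eq_or_ne s [] with rfl | hs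
    · rfl
    · obtain ⟨p, -, h⟩ := exists_wmin hs 0
      simpa using h
  simp [flipMap, this]

theorem flipSeq_zero (l : List (List (ℕ × ℕ) × List (ℕ × ℕ))) : flipSeq l 0 = 0 := by
  induction l with
  | nil => rfl
  | cons m l ih => rw [flipSeq, flipMap_zero, ih]

theorem unflipSeq_zero (l : List (List (ℕ × ℕ) × List (ℕ × ℕ))) : unflipSeq l 0 = 0 := by
  induction l with
  | nil => rfl
  | cons m l ih => rw [unflipSeq, ih, flipMap_zero]

/-- If the same flips are legal for the complex and for a second one, the inverse map carries the
image of the second back into it. -/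
theorem flipSeq_mem_iff {l : List (List (ℕ × ℕ) × List (ℕ × ℕ))}
    (ha : (l.all fun m => admissible m.1 m.2) = true) {K K' L L' : List ℕ}
    (hK : transforms l K K' = true) (hL : transforms l L L' = true) {x : ℕ → ℝ}
    (hx : x ∈ simplicialCone K) :
    flipSeq l x ∈ simplicialCone L' ↔ x ∈ simplicialCone L := by
  constructor
  · intro h
    have := (unflipSeq_mem ha hL h).1
    rwa [(flipSeq_mem ha hK hx).2] at this
  · exact fun h => (flipSeq_mem ha hL h).1

theorem unflipSeq_mem_iff {l : List (List (ℕ × ℕ) × List (ℕ × ℕ))}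
    (ha : (l.all fun m => admissible m.1 m.2) = true) {K K' L L' : List ℕ}
    (hK : transforms l K K' = true) (hL : transforms l L L' = true) {y : ℕ → ℝ}
    (hy : y ∈ simplicialCone K') :
    unflipSeq l y ∈ simplicialCone L ↔ y ∈ simplicialCone L' := by
  constructor
  · intro h
    have := (flipSeq_mem ha hL h).1
    rwa [(unflipSeq_mem ha hK hy).2] at this
  · exact fun h => (unflipSeq_mem ha hL h).1

/-- The open star of the vertex `0` is described by its link: dropping the apex coordinate loses
nothing, since the coordinates sum to 1. -/
theorem mem_linkFacets {y : ℕ → ℝ} (hy : y ∈ simplicialCone orbFacets) (h0 : 0 < y 0) :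
    dropZero y ∈ simplicialCone linkFacets := by
  obtain ⟨hy0, F, hF, hyF⟩ := hy
  have hF0 := hyF 0 h0.ne'
  refine ⟨fun j => ?_, delVertex F 0,
    List.mem_map.2 ⟨F, List.mem_filter.2 ⟨hF, hF0⟩, rfl⟩, fun j hj => ?_⟩
  · rw [dropZero_apply]
    split_ifs
    · exact le_rfl
    · exact hy0 j
  · rw [dropZero_apply] at hj
    split_ifs at hj with h
    · exact absurd rfl hj
    · exact (testBit_delVertex hF0).2 ⟨hyF j hj, h⟩

theorem add_single_mem {z : ℕ → ℝ} (hz : z ∈ simplicialCone linkFacets) {c : ℝ} (hc : 0 ≤ c) :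
    z + Pi.single 0 c ∈ simplicialCone orbFacets ∧ z 0 = 0 := by
  obtain ⟨hz0, G, hG, hzG⟩ := hz
  obtain ⟨F, hF, rfl⟩ := List.mem_map.1 hG
  rw [List.mem_filter] at hF
  have h0 : z 0 = 0 := by
    by_contra h
    exact ((testBit_delVertex hF.2).1 (hzG 0 h)).2 rfl
  refine ⟨⟨fun j => ?_, F, hF.1, fun j hj => ?_⟩, h0⟩
  · have := hz0 j
    simp only [Pi.add_apply, Pi.single_apply]
    split_ifs <;> linarith
  · by_cases h : j = 0
    · exact h ▸ hF.2
    · have : z j ≠ 0 := by simpa [h] using hj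
      exact ((testBit_delVertex hF.2).1 (hzG j this)).1

theorem mem_linkSingular {z : ℕ → ℝ} (hz : z ∈ simplicialCone linkFacets) :
    z ∈ simplicialCone linkSingular ↔ ∀ j, z j ≠ 0 → j ∈ singularVertices := by
  have hbit : ∀ F j : ℕ, (Nat.land F (mask (singularVertices.map fun i => (i, 1)))).testBit j = true ↔
      F.testBit j = true ∧ j ∈ singularVertices := by
    intro F j
    have : ∀ a b : ℕ, Nat.land a b = a &&& b := fun _ _ => rfl
    rw [this, Nat.testBit_and, Bool.and_eq_true, testBit_mask]
    simp
  obtain ⟨hz0, G, hG, hzG⟩ := hz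
  constructor
  · rintro ⟨-, H, hH, hzH⟩ j hj
    obtain ⟨F, -, rfl⟩ := List.mem_map.1 hH
    exact ((hbit F j).1 (hzH j hj)).2
  · intro h
    exact ⟨hz0, _, List.mem_map_of_mem hG, fun j hj => (hbit G j).2 ⟨hzG j hj, h j hj⟩⟩

/-- The local chart at the first cone point, in barycentric coordinates. -/
@[irreducible]
noncomputable def coneChart (y : ℕ → ℝ) : Fin 4 → ℝ :=
  fanMap (unflipSeq (sphereFlips.map unitMove) (flipSeq (linkFlips.map unitMove) (dropZero y)))

theorem isPL_coneChart : IsPL coneChart := by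
  have h : coneChart = fanMap ∘ unflipSeq (sphereFlips.map unitMove) ∘
      flipSeq (linkFlips.map unitMove) ∘ dropZero := by
    funext y
    simp only [coneChart, Function.comp_apply]
  rw [h]
  exact (isPL_linear fanMap).comp ((isPL_unflipSeq _).comp ((isPL_flipSeq _).comp
    (isPL_linear dropZero)))

/-- The inverse of the local chart, up to the coordinate with label `0`. -/
noncomputable def coneLift (w : Fin 4 → ℝ) : ℕ → ℝ :=
  unflipSeq (linkFlips.map unitMove) (flipSeq (sphereFlips.map unitMove) (fanLift w))

theorem continuous_coneLift : Continuous coneLift :=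
  (continuous_unflipSeq _).comp ((continuous_flipSeq _).comp continuous_fanLift)

theorem coneLift_mem (w : Fin 4 → ℝ) : coneLift w ∈ simplicialCone linkFacets :=
  (unflipSeq_mem admissible_linkFlips transforms_linkFlips
    (flipSeq_mem admissible_sphereFlips transforms_sphereFlips (fanLift_mem w)).1).1

theorem coneLift_coneChart {y : ℕ → ℝ} (hy : y ∈ simplicialCone orbFacets) (h0 : 0 < y 0) :
    coneLift (coneChart y) = dropZero y := by
  obtain ⟨h1, h2⟩ := flipSeq_mem admissible_linkFlips transforms_linkFlips (mem_linkFacets hy h0)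
  obtain ⟨h3, h4⟩ := unflipSeq_mem admissible_sphereFlips transforms_sphereFlips h1
  rw [coneLift, coneChart, fanLift_fanMap h3, h4, h2]

theorem coneChart_coneLift_add (w : Fin 4 → ℝ) (c : ℝ) :
    coneChart (coneLift w + Pi.single 0 c) = w := by
  obtain ⟨h1, h2⟩ := flipSeq_mem admissible_sphereFlips transforms_sphereFlips (fanLift_mem w)
  obtain ⟨h3, h4⟩ := unflipSeq_mem admissible_linkFlips transforms_linkFlips h1
  have h5 : dropZero (coneLift w + Pi.single 0 c) = coneLift w := by
    funext j
    rw [dropZero_apply]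
    split_ifs with h
    · rw [h, (add_single_mem (coneLift_mem w) le_rfl).2]
    · simp [h]
  rw [coneChart, h5, coneLift, h4, h2, fanMap_fanLift]

/-- In the star of `0`, being singular is a condition on the link part alone, the apex being
singular itself. The knot is then followed through the link flips, the inverse fan flips and the
projection to `ℝ⁴`. -/
theorem coneChart_mem_coneOver {y : ℕ → ℝ} (hy : y ∈ simplicialCone orbFacets) (h0 : 0 < y 0) :
    coneChart y ∈ coneOver figureEight ↔ ∀ j, y j ≠ 0 → j ∈ singularVertices := by
  have hz := mem_linkFacets hy h0
  have h1 := (flipSeq_mem admissible_linkFlips transforms_linkFlips hz).1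
  have h3 := (unflipSeq_mem admissible_sphereFlips transforms_sphereFlips h1).1
  have hknot := linkSingular_linkKnot
  rw [Bool.and_eq_true] at hknot
  have hsing : (∀ j, y j ≠ 0 → j ∈ singularVertices) ↔
      dropZero y ∈ simplicialCone (linkKnot.map edgeFace) := by
    have h4 : dropZero y ∈ simplicialCone linkSingular ↔
        dropZero y ∈ simplicialCone (linkKnot.map edgeFace) :=
      ⟨fun h => simplicialCone_mono hknot.1 h, fun h => simplicialCone_mono hknot.2 h⟩
    rw [← h4, mem_linkSingular hz]
    refine forall_congr' fun j => ?_
    rw [dropZero_apply]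
    split_ifs with h
    · subst h
      simp [singularVertices]
    · rfl
  rw [hsing, ← flipSeq_mem_iff admissible_linkFlips transforms_linkFlips transforms_linkKnot hz,
    ← unflipSeq_mem_iff admissible_sphereFlips transforms_sphereFlips transforms_fanKnot h1,
    ← fanMap_image_fanKnot]
  constructor
  · rintro ⟨u, hu, h⟩
    have h5 := fanLift_fanMap (simplicialCone_mono fanKnot_subcomplex hu)
    rw [h, coneChart, fanLift_fanMap h3] at h5
    exact h5 ▸ hu
  · exact fun h => ⟨_, h, by rw [coneChart]⟩

theorem orbCoord_mem (x : Orb) : orbCoord x ∈ simplicialCone orbFacets ∧ coordSum (orbCoord x) = 1 := by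
  have h : orbCoord x ∈ {y | y ∈ simplicialCone orbFacets ∧ coordSum y = 1} :=
    range_orbCoord ▸ ⟨x, rfl⟩
  exact h

theorem isEmbedding_orbCoord : Topology.IsEmbedding orbCoord :=
  (continuous_orbCoord.isClosedEmbedding orbCoord_injective).isEmbedding

theorem coordSum_dropZero (y : ℕ → ℝ) : coordSum (dropZero y) = coordSum y - y 0 := by
  simp [dropZero, coordSum_single]

theorem continuous_coordSum : Continuous coordSum := by
  have : (coordSum : (ℕ → ℝ) → ℝ) = fun y => ∑ j ∈ Finset.range 92, y j := by
    funext y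
    simp [coordSum]
  rw [this]
  fun_prop

/-- The barycentric coordinates of the point with a given image under the chart. -/
noncomputable def coneLiftCoord (w : Fin 4 → ℝ) : ℕ → ℝ :=
  coneLift w + Pi.single 0 (1 - coordSum (coneLift w))

theorem continuous_coneLiftCoord : Continuous coneLiftCoord := by
  refine continuous_coneLift.add (continuous_pi fun j => ?_)
  by_cases h : j = 0
  · subst h
    simp only [Pi.single_eq_same]
    exact continuous_const.sub (continuous_coordSum.comp continuous_coneLift)
  · simpa [h] using continuous_const

theorem exists_orbCoord_eq {w : Fin 4 → ℝ} (hw : coordSum (coneLift w) < 1) :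
    ∃ x, orbCoord x = coneLiftCoord w := by
  have h : coneLiftCoord w ∈ Set.range orbCoord := by
    rw [range_orbCoord]
    refine ⟨(add_single_mem (coneLift_mem w) (sub_nonneg.2 hw.le)).1, ?_⟩
    have : (Pi.single 0 (1 - coordSum (coneLift w)) : ℕ → ℝ) =
        (1 - coordSum (coneLift w)) • Pi.single 0 1 := by
      rw [← Pi.single_smul]; simp
    rw [coneLiftCoord, map_add, this, map_smul, coordSum_single (by norm_num)]
    simp
  exact h

/-- The local chart at the first cone point. -/
noncomputable def orbChart : OpenPartialHomeomorph Orb (Fin 4 → ℝ) where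
  toFun x := coneChart (orbCoord x)
  invFun w := Function.invFun orbCoord (coneLiftCoord w)
  source := {x | 0 < orbCoord x 0}
  target := {w | coordSum (coneLift w) < 1}
  map_source' x hx := by
    have h := orbCoord_mem x
    change coordSum (coneLift (coneChart (orbCoord x))) < 1
    rw [coneLift_coneChart h.1 hx, coordSum_dropZero, h.2]
    exact sub_lt_self _ hx
  map_target' w hw := by
    have h := Function.invFun_eq (exists_orbCoord_eq hw)
    change 0 < orbCoord (Function.invFun orbCoord (coneLiftCoord w)) 0
    rw [h, coneLiftCoord, Pi.add_apply, (add_single_mem (coneLift_mem w) le_rfl).2, zero_add,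
      Pi.single_eq_same]
    exact sub_pos.2 hw
  left_inv' x hx := by
    have h := orbCoord_mem x
    have : coneLiftCoord (coneChart (orbCoord x)) = orbCoord x := by
      rw [coneLiftCoord, coneLift_coneChart h.1 hx, coordSum_dropZero, h.2, sub_sub_cancel]
      funext j
      rw [Pi.add_apply, dropZero_apply]
      split_ifs with h
      · subst h; simp
      · simp [h]
    rw [this]
    exact Function.leftInverse_invFun orbCoord_injective x
  right_inv' w hw := by
    rw [Function.invFun_eq (exists_orbCoord_eq hw), coneLiftCoord, coneChart_coneLift_add]
  open_source := isOpen_lt continuous_const ((continuous_apply 0).comp continuous_orbCoord)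
  open_target := isOpen_lt (continuous_coordSum.comp continuous_coneLift) continuous_const
  continuousOn_toFun := by
    refine Continuous.continuousOn ?_
    rw [isQuotientMap_proj.continuous_iff, continuous_iff_continuousAt]
    exact fun v => (isPL_coneChart.comp_plNear (plNear_orbCoord v)).continuousAt
  continuousOn_invFun := by
    rw [isEmbedding_orbCoord.isInducing.continuousOn_iff]
    exact continuous_coneLiftCoord.continuousOn.congr fun w hw =>
      Function.invFun_eq (exists_orbCoord_eq hw)

theorem orbCoord_proj_zero : orbCoord (proj 0) = Pi.single 0 1 := by
  have h := hasCoord_orbCoord 0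
  refine h.eq ?_ ⟨0, fun k => by rw [dihPerm_zero]; exact ModInt.refl _⟩
  have hg : gap 0 = Pi.single 0 1 := by
    funext i
    simp [gap, Pi.single_apply]
  -- The zero configuration has gaps `(1, 0, 0, 0, 0)`, the 1 being the wrap-around term; this is
  -- the alcove vertex with label `0`.
  refine ⟨1, 0, 1, ⟨fun i => ?_, by simp, fun k => by rw [map_zero]; exact ModInt.refl _⟩, ?_, ?_⟩
  · rw [hg, Pi.single_apply]
    split_ifs <;> norm_num
  · rw [hg]
    intro i j hij
    simp only [Function.comp_apply, Equiv.Perm.one_apply, Pi.single_apply]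
    split_ifs with h1 h2 <;> norm_num
    subst h1
    exact h2 (Fin.le_zero_iff.1 hij)
  · have hl : flagLabel 1 1 0 = 0 := by decide +kernel
    rw [hg, flagVector, Finset.sum_eq_single 0]
    · simp [hl, descent]
    · intro k _ hk
      have : descent (Pi.single 0 1) 1 k = 0 := by
        fin_cases k <;> simp [descent] at hk ⊢
      rw [this]
      simp
    · simp

/-! ### Translations between cone points -/

/-- A point of the torus is fixed, up to the lattice, by all isometries. -/
def IsFixedVec (c : ℂ × ℂ) : Prop := ∀ m, permMap (dihPerm m) c - c ∈ lattice

theorem isFixedVec_coneVec (t : Fin 5) : IsFixedVec (coneVec t) := fun m => by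
  rw [← torus_eq_iff_sub, torus_eq_iff]
  simp only [confMap_permMap, confMap_coneVec]
  exact fun k => (modInt_coneConf t _).trans (modInt_coneConf t k).symm

theorem IsFixedVec.neg {c : ℂ × ℂ} (hc : IsFixedVec c) : IsFixedVec (-c) := fun m => by
  rw [map_neg, ← neg_sub']
  exact lattice.neg_mem (hc m)

/-- Translation by a vector that is invariant modulo `Λ` commutes with the dihedral action on the
torus, so it descends to the orbifold. -/
theorem IsFixedVec.proj_add {c v w : ℂ × ℂ} (hc : IsFixedVec c) (h : proj v = proj w) :
    proj (v + c) = proj (w + c) := by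
  rw [proj_eq_iff] at h ⊢
  obtain ⟨m, hm⟩ := h
  refine ⟨m, ?_⟩
  rw [map_add, add_sub_add_comm]
  exact lattice.add_mem hm (hc m)

/-- Translation by a fixed point. -/
noncomputable def orbTranslate (c : ℂ × ℂ) (x : Orb) : Orb :=
  proj (Function.surjInv proj_surjective x + c)

theorem orbTranslate_proj {c : ℂ × ℂ} (hc : IsFixedVec c) (v : ℂ × ℂ) :
    orbTranslate c (proj v) = proj (v + c) :=
  hc.proj_add (Function.surjInv_eq _ _)

theorem continuous_orbTranslate {c : ℂ × ℂ} (hc : IsFixedVec c) : Continuous (orbTranslate c) := by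
  rw [isQuotientMap_proj.continuous_iff]
  exact (continuous_proj.comp (continuous_id.add continuous_const)).congr fun v =>
    (orbTranslate_proj hc v).symm

/-- Translation by a fixed point, as a homeomorphism. -/
noncomputable def orbTranslateHomeomorph {c : ℂ × ℂ} (hc : IsFixedVec c) : Orb ≃ₜ Orb where
  toFun := orbTranslate c
  invFun := orbTranslate (-c)
  left_inv x := by
    obtain ⟨v, rfl⟩ := proj_surjective x
    rw [orbTranslate_proj hc, orbTranslate_proj hc.neg, add_neg_cancel_right]
  right_inv x := by
    obtain ⟨v, rfl⟩ := proj_surjective x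
    rw [orbTranslate_proj hc.neg, orbTranslate_proj hc, neg_add_cancel_right]
  continuous_toFun := continuous_orbTranslate hc
  continuous_invFun := continuous_orbTranslate hc.neg

theorem proj_mem_singularSet_iff_lattice (v : ℂ × ℂ) :
    proj v ∈ singularSet ↔ ∃ m : Fin 10, m ≠ 0 ∧ permMap (dihPerm m) v - v ∈ lattice := by
  rw [proj_mem_singularSet_iff]
  refine exists_congr fun m => and_congr_right fun _ => ?_
  rw [← torus_eq_iff_sub, torus_eq_iff]
  simp only [confMap_permMap]
  exact forall_congr' fun k => ⟨ModInt.symm, ModInt.symm⟩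

theorem orbTranslate_mem_singularSet {c : ℂ × ℂ} (hc : IsFixedVec c) (x : Orb) :
    orbTranslate c x ∈ singularSet ↔ x ∈ singularSet := by
  obtain ⟨v, rfl⟩ := proj_surjective x
  rw [orbTranslate_proj hc, proj_mem_singularSet_iff_lattice, proj_mem_singularSet_iff_lattice]
  refine exists_congr fun m => and_congr_right fun _ => ?_
  rw [map_add, add_sub_add_comm, add_comm]
  exact ⟨fun h => (AddSubgroup.add_mem_cancel_left _ (hc m)).1 h,
    fun h => (AddSubgroup.add_mem_cancel_left _ (hc m)).2 h⟩

theorem orbTranslate_neg_conePoint (t : Fin 5) : orbTranslate (-coneVec t) (conePoint t) = proj 0 := by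
  rw [conePoint_eq, orbTranslate_proj (isFixedVec_coneVec t).neg, add_neg_cancel]

/-- At the cone points the singular set is a cone over the figure-eight knot. -/
theorem isPLLocallyModelledOn_figureEight (t : Fin 5) :
    IsPLLocallyModelledOn singularSet (conePoint t) (coneOver figureEight) := by
  have hc := (isFixedVec_coneVec t).neg
  refine ⟨(orbTranslateHomeomorph hc).toOpenPartialHomeomorph.trans orbChart,
    isPLOn_of_plNear ((OpenPartialHomeomorph.open_source _).preimage continuous_proj)
      fun v _ => ?_, ?_, ?_, ?_⟩
  · let A : (ℂ × ℂ) →ᵃ[ℝ] (ℂ × ℂ) := AffineMap.id ℝ _ + AffineMap.const ℝ _ (-coneVec t)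
    have hA : Continuous A := AffineMap.continuous_of_finiteDimensional A
    have h := (isPL_coneChart.comp_plNear (plNear_orbCoord (A v))).comp_affineEquiv A
      hA.continuousAt
    refine (congrArg (PLNear · v) ?_).mp h
    funext w
    change coneChart (orbCoord (proj (w + -coneVec t))) =
      coneChart (orbCoord (orbTranslate (-coneVec t) (proj w)))
    rw [orbTranslate_proj hc]
  · rw [OpenPartialHomeomorph.trans_source]
    refine ⟨trivial, ?_⟩
    change 0 < orbCoord (orbTranslate (-coneVec t) (conePoint t)) 0
    rw [orbTranslate_neg_conePoint, orbCoord_proj_zero]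
    simp
  · change coneChart (orbCoord (orbTranslate (-coneVec t) (conePoint t))) = 0
    have : dropZero (Pi.single 0 1) = 0 := by
      funext j
      rw [dropZero_apply]
      split_ifs with h <;> simp [h]
    rw [orbTranslate_neg_conePoint, orbCoord_proj_zero, coneChart, this, flipSeq_zero,
      unflipSeq_zero, map_zero]
  · intro x hx
    rw [OpenPartialHomeomorph.trans_source] at hx
    have hx : 0 < orbCoord (orbTranslate (-coneVec t) x) 0 := hx.2
    change _ ↔ coneChart (orbCoord (orbTranslate (-coneVec t) x)) ∈ _
    rw [coneChart_mem_coneOver (orbCoord_mem _).1 hx, ← proj_mem_singularSet_iff_coord,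
      orbTranslate_mem_singularSet hc]

/-! ### The covering of the complement of the singular set -/

theorem exists_smul_disjoint (p : Torus4) :
    ∃ U ∈ 𝓝 p, ∀ g : D10, ((g • ·) '' U ∩ U).Nonempty → g • p = p := by
  obtain ⟨v, rfl⟩ := QuotientAddGroup.mk_surjective p
  obtain ⟨W₁, hW₁, W₂, hW₂, hW⟩ := Filter.eventually_prod_iff.1
    (nhds_prod_eq (x := v) (y := v) ▸ eventually_sub_mem_lattice v)
  refine ⟨QuotientAddGroup.mk '' ({w | W₁ w} ∩ {w | W₂ w}),
    QuotientAddGroup.isOpenMap_coe.image_mem_nhds (Filter.inter_mem hW₁ hW₂), ?_⟩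
  rintro ⟨g, hg⟩ ⟨_, ⟨_, ⟨w, hw, rfl⟩, rfl⟩, w', hw', h⟩
  obtain ⟨m, hm⟩ := exists_actsBy hg
  have h : QuotientAddGroup.mk w' = g (QuotientAddGroup.mk w) := h
  change g _ = _
  rw [hm, eq_comm, torus_eq_iff_sub] at h
  rw [hm, torus_eq_iff_sub]
  exact (hW hw.1 hw'.2 m h).1

theorem torusProj_image_stabilizer :
    torusProj '' {p | MulAction.stabilizer D10 p = ⊥} = singularSetᶜ := by
  ext x
  constructor
  · rintro ⟨p, hp, rfl⟩
    obtain ⟨v, rfl⟩ := QuotientAddGroup.mk_surjective p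
    change ¬ proj v ∈ singularSet
    rw [proj_mem_singularSet_iff, ← stabilizer_ne_bot_iff]
    exact not_not.2 hp
  · intro hx
    obtain ⟨p, rfl⟩ := Quotient.exists_rep x
    refine ⟨p, ?_, rfl⟩
    by_contra h
    exact hx ⟨p, rfl, h⟩

theorem isCoveringMapOn_torusProj : IsCoveringMapOn torusProj singularSetᶜ := by
  have h : Topology.IsQuotientMap torusProj := isQuotientMap_quotient_mk'
  have := h.isCoveringMapOn_of_smul_disjoint (G := D10) Quotient.eq exists_smul_disjoint
  rwa [torusProj_image_stabilizer] at this

theorem torusProj_smul (g : D10) (p : Torus4) : torusProj (g • p) = torusProj p :=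
  ((torusProj_eq_iff p (g • p)).2 ⟨g.1, g.2, rfl⟩).symm

theorem exists_smul_eq {p q : Torus4} (h : torusProj p = torusProj q) : ∃ g : D10, g • p = q := by
  obtain ⟨g, hg, h⟩ := (torusProj_eq_iff p q).1 h
  exact ⟨⟨g, hg⟩, h⟩

theorem smul_right_cancel_of_notMem {p : Torus4} (hp : torusProj p ∉ singularSet) {g h : D10}
    (hgh : g • p = h • p) : g = h := by
  have h1 : MulAction.stabilizer D10 p = ⊥ := by
    by_contra h
    exact hp ⟨p, rfl, h⟩
  have h2 : h⁻¹ * g ∈ MulAction.stabilizer D10 p := by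
    rw [MulAction.mem_stabilizer_iff, mul_smul, hgh, inv_smul_smul]
  rw [h1, Subgroup.mem_bot, inv_mul_eq_one] at h2
  exact h2.symm

theorem exists_not_commute : ∃ g h : D10, g * h ≠ h * g := by
  refine ⟨⟨rotT, Subgroup.subset_closure (by simp)⟩, ⟨reflT, Subgroup.subset_closure (by simp)⟩,
    fun h => ?_⟩
  have h : rotT * reflT = reflT * rotT := congrArg Subtype.val h
  -- The commutator of `r` and `s` is the rotation with index `2`, which would have to act
  -- trivially.
  have h1 : ActsBy 1 (dihPerm 2) := by
    have := (actsBy_reflT.mul actsBy_rotT).inv.mul (actsBy_rotT.mul actsBy_reflT)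
    rw [← h, inv_mul_cancel, show dihPerm 9 * dihPerm 4 * (dihPerm 4 * dihPerm 9)⁻¹ = dihPerm 2 by
      decide +kernel] at this
    exact this
  exact not_actsBy_one (by decide) h1

/-! ### The complement of the fixed planes -/

/-- A nonvanishing 2 × 2 minor of the difference between a symmetry and the identity, evaluated on
sum-zero vectors: fixed spaces have codimension at least two. -/
theorem exists_minor_ne_zero : ∀ m : Fin 10, m ≠ 0 → ∃ a b k l : Fin 5,
    let f : Fin 5 → Fin 5 → ℤ := fun a k =>
      ((if dihPerm m k = a then 1 else 0) - if dihPerm m k = 2 then 1 else 0) -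
        ((if k = a then 1 else 0) - if k = 2 then 1 else 0)
    f a k * f b l - f a l * f b k ≠ 0 := by
  decide +kernel

/-- Otherwise the difference from the identity would have rank at most one, contradicting the
nonzero minor. -/
theorem ker_sup_span_ne_top {m : Fin 10} (hm : m ≠ 0) (v : ℂ × ℂ) :
    LinearMap.ker (permMap (dihPerm m) - LinearMap.id) ⊔ Submodule.span ℝ {v} ≠ ⊤ := by
  intro htop
  set T := permMap (dihPerm m) - LinearMap.id with hT
  have hTv : ∀ u, ∃ c : ℝ, T u = c • T v := by
    intro u
    have hu : u ∈ LinearMap.ker T ⊔ Submodule.span ℝ {v} := htop ▸ Submodule.mem_top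
    obtain ⟨x, hx, y, hy, rfl⟩ := Submodule.mem_sup.1 hu
    obtain ⟨c, rfl⟩ := Submodule.mem_span_singleton.1 hy
    exact ⟨c, by rw [map_add, LinearMap.mem_ker.1 hx, zero_add, map_smul]⟩
  obtain ⟨a, b, k, l, h⟩ := exists_minor_ne_zero m hm
  let d : Fin 5 → Fin 5 → ℝ := fun a k => (if k = a then 1 else 0) - if k = 2 then 1 else 0
  have hd : ∀ a, ∑ k, d a k = 0 := fun a => by simp [d]
  have hval : ∀ a k, confMap (T (confInv (d a))) k = d a (dihPerm m k) - d a k := by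
    intro a k
    rw [hT, LinearMap.sub_apply, map_sub, Pi.sub_apply, confMap_permMap, LinearMap.id_apply,
      confMap_confInv (hd a)]
  obtain ⟨c, hc⟩ := hTv (confInv (d a))
  obtain ⟨c', hc'⟩ := hTv (confInv (d b))
  have e1 := hval a k
  have e2 := hval a l
  have e3 := hval b k
  have e4 := hval b l
  rw [hc, map_smul, Pi.smul_apply, smul_eq_mul] at e1 e2
  rw [hc', map_smul, Pi.smul_apply, smul_eq_mul] at e3 e4
  apply h
  have h5 : (d a (dihPerm m k) - d a k) * (d b (dihPerm m l) - d b l) -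
      (d a (dihPerm m l) - d a l) * (d b (dihPerm m k) - d b k) = 0 := by
    rw [← e1, ← e2, ← e3, ← e4]
    ring
  simp only [d] at h5
  exact_mod_cast h5

/-- The points of `N` which are not fixed by a nontrivial isometry in the dihedral group. -/
def freePart (N : Set (ℂ × ℂ)) : Set (ℂ × ℂ) :=
  {v | v ∈ N ∧ ∀ m : Fin 10, m ≠ 0 → permMap (dihPerm m) v ≠ v}

/-- A real vector space is not a finite union of proper subspaces, and these subspaces are stable
under the scaling that brings `u` into `N`. -/
theorem exists_mem_avoiding {N : Set (ℂ × ℂ)} (hN : N ∈ 𝓝 0) (v w : ℂ × ℂ) :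
    ∃ u ∈ N, ∀ m : Fin 10, m ≠ 0 →
      u ∉ LinearMap.ker (permMap (dihPerm m) - LinearMap.id) ⊔ Submodule.span ℝ {v} ∧
      u ∉ LinearMap.ker (permMap (dihPerm m) - LinearMap.id) ⊔ Submodule.span ℝ {w} := by
  let p : {m : Fin 10 // m ≠ 0} × Bool → Submodule ℝ (ℂ × ℂ) := fun q =>
    LinearMap.ker (permMap (dihPerm q.1.1) - LinearMap.id) ⊔
      Submodule.span ℝ {if q.2 then v else w}
  have hp : ⋃ q, (p q : Set (ℂ × ℂ)) ≠ Set.univ := fun h => by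
    obtain ⟨q, hq⟩ := Subspace.exists_eq_top_of_iUnion_eq_univ h
    exact ker_sup_span_ne_top q.1.2 _ hq
  obtain ⟨u, hu⟩ := (Set.ne_univ_iff_exists_notMem _).1 hp
  rw [Set.mem_iUnion, not_exists] at hu
  have hlim : Filter.Tendsto (fun c : ℝ => c • u) (𝓝[>] 0) (𝓝 0) := by
    have : Continuous fun c : ℝ => c • u := by fun_prop
    simpa using (this.tendsto 0).mono_left nhdsWithin_le_nhds
  obtain ⟨c, hcN, hc⟩ := ((hlim.eventually_mem hN).and self_mem_nhdsWithin).exists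
  have hc : (0 : ℝ) < c := hc
  refine ⟨c • u, hcN, fun m hm => ⟨?_, ?_⟩⟩
  · rw [Submodule.smul_mem_iff _ hc.ne']
    exact hu ⟨⟨m, hm⟩, true⟩
  · rw [Submodule.smul_mem_iff _ hc.ne']
    exact hu ⟨⟨m, hm⟩, false⟩

/-- A fixed point on the segment other than `v` would express `u` as a fixed vector plus a multiple
of `v`. -/
theorem segment_subset_freePart {N : Set (ℂ × ℂ)} (hN : Convex ℝ N) {v u : ℂ × ℂ}
    (hv : v ∈ freePart N) (huN : u ∈ N) (hu : ∀ m : Fin 10, m ≠ 0 →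
      u ∉ LinearMap.ker (permMap (dihPerm m) - LinearMap.id) ⊔ Submodule.span ℝ {v}) :
    segment ℝ v u ⊆ freePart N := by
  rintro x ⟨a, b, ha, hb, hab, rfl⟩
  refine ⟨hN hv.1 huN ha hb hab, fun m hm hx => ?_⟩
  rcases hb.eq_or_lt with rfl | hb
  · obtain rfl : a = 1 := by linarith
    rw [zero_smul, add_zero, one_smul] at hx
    exact hv.2 m hm hx
  · apply hu m hm
    have h1 : a • v + b • u ∈ LinearMap.ker (permMap (dihPerm m) - LinearMap.id) := by
      rw [LinearMap.mem_ker, LinearMap.sub_apply, hx, LinearMap.id_apply, sub_self]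
    have h2 : b • u = (a • v + b • u) + (-a) • v := by module
    rw [← Submodule.smul_mem_iff _ hb.ne', h2]
    exact Submodule.add_mem_sup h1 (Submodule.smul_mem _ _ (Submodule.mem_span_singleton_self v))

/-- Any two free points are joined through one generic point `u` by two segments; this is general
position for subspaces of codimension two. -/
theorem isPreconnected_freePart {N : Set (ℂ × ℂ)} (hN : Convex ℝ N) (h0 : N ∈ 𝓝 0) :
    IsPreconnected (freePart N) := by
  refine isPreconnected_of_forall_pair fun v hv w hw => ?_
  obtain ⟨u, huN, hu⟩ := exists_mem_avoiding h0 v w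
  refine ⟨segment ℝ v u ∪ segment ℝ w u, ?_, Or.inl (left_mem_segment _ _ _),
    Or.inr (left_mem_segment _ _ _), ?_⟩
  · exact Set.union_subset (segment_subset_freePart hN hv huN fun m hm => (hu m hm).1)
      (segment_subset_freePart hN hw huN fun m hm => (hu m hm).2)
  · exact IsPreconnected.union u (right_mem_segment _ _ _) (right_mem_segment _ _ _)
      (convex_segment _ _).isPreconnected (convex_segment _ _).isPreconnected

theorem freePart_nonempty {N : Set (ℂ × ℂ)} (h0 : N ∈ 𝓝 0) : (freePart N).Nonempty := by
  obtain ⟨u, huN, hu⟩ := exists_mem_avoiding h0 0 0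
  refine ⟨u, huN, fun m hm h => (hu m hm).1 (Submodule.mem_sup_left ?_)⟩
  rw [LinearMap.mem_ker, LinearMap.sub_apply, h, LinearMap.id_apply, sub_self]

theorem exists_dihPerm_conj : ∀ n m : Fin 10, m ≠ 0 → ∃ m' : Fin 10, m' ≠ 0 ∧
    dihPerm n * dihPerm m = dihPerm m' * dihPerm n := by
  decide +kernel

theorem permMap_mem_freePart {N : Set (ℂ × ℂ)}
    (hN : ∀ v ∈ N, ∀ m, permMap (dihPerm m) v ∈ N) {v : ℂ × ℂ} (hv : v ∈ freePart N) (n : Fin 10) :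
    permMap (dihPerm n) v ∈ freePart N := by
  refine ⟨hN v hv.1 n, fun m hm h => ?_⟩
  obtain ⟨m', hm', h'⟩ := exists_dihPerm_conj n m hm
  rw [permMap_permMap, h', ← permMap_permMap] at h
  refine hv.2 m' hm' ?_
  have := congrArg (permMap (dihPerm n)⁻¹) h
  simpa only [permMap_permMap, mul_inv_cancel_right, mul_inv_cancel, permMap_one] using this

/-- Arbitrarily small invariant convex neighbourhoods of the origin. -/
theorem exists_invariant_nhds {U : Set (ℂ × ℂ)} (hU : U ∈ 𝓝 0) : ∃ N ∈ 𝓝 (0 : ℂ × ℂ), N ⊆ U ∧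
    Convex ℝ N ∧ ∀ v ∈ N, ∀ m, permMap (dihPerm m) v ∈ N := by
  obtain ⟨ε, hε, hεU⟩ := Metric.mem_nhds_iff.1 hU
  refine ⟨⋂ m : Fin 10, permMap (dihPerm m) ⁻¹' Metric.ball 0 ε, ?_, ?_, ?_, ?_⟩
  · refine Filter.iInter_mem.2 fun m => ?_
    have := (continuous_permMap (dihPerm m)).tendsto 0
    rw [map_zero] at this
    exact this (Metric.ball_mem_nhds 0 hε)
  · intro v hv
    have := Set.mem_iInter.1 hv 0
    rw [Set.mem_preimage, dihPerm_zero, permMap_one] at this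
    exact hεU this
  · exact convex_iInter fun m => (convex_ball 0 ε).linear_preimage _
  · intro v hv m
    refine Set.mem_iInter.2 fun n => ?_
    obtain ⟨q, hq⟩ := exists_dihPerm_mul m n
    rw [Set.mem_preimage, permMap_permMap, ← hq]
    exact Set.mem_iInter.1 hv q

theorem eventually_mem_singularSet_iff : ∀ᶠ v in 𝓝 (0 : ℂ × ℂ),
    proj v ∈ singularSet → ∃ m : Fin 10, m ≠ 0 ∧ permMap (dihPerm m) v = v := by
  have h : Filter.Tendsto (fun v : ℂ × ℂ => (v, v)) (𝓝 0) (𝓝 (0, 0)) :=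
    (continuous_id.prodMk continuous_id).tendsto 0
  filter_upwards [h.eventually (eventually_sub_mem_lattice 0)] with v hv hs
  obtain ⟨m, hm, hl⟩ := (proj_mem_singularSet_iff_lattice v).1 hs
  have := (hv m hl).2
  rw [sub_zero] at this
  exact ⟨m, hm, this.symm⟩

/-! ### Failure of local flatness -/

/-- A point near `F a` over the image of a small open set is a translate of some nearby `F b`. Only
elements fixing `F a` relate nearby points, and at a regular point these are trivial. -/
theorem isOpenMap_of_torusProj_comp {A : Type*} [TopologicalSpace A] {F : A → Torus4}
    (hF : Continuous F) (ho : IsOpenMap (torusProj ∘ F)) (hs : ∀ a, torusProj (F a) ∉ singularSet) :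
    IsOpenMap F := by
  refine isOpenMap_iff_nhds_le.2 fun a V hV => ?_
  obtain ⟨U, hU, hd⟩ := exists_smul_disjoint (F a)
  have h1 : torusProj ⁻¹' ((torusProj ∘ F) '' (F ⁻¹' V ∩ F ⁻¹' U)) ∈ 𝓝 (F a) :=
    continuous_quotient_mk'.continuousAt.preimage_mem_nhds
      (ho.image_mem_nhds (Filter.inter_mem hV (hF.continuousAt.preimage_mem_nhds hU)))
  filter_upwards [h1, hU] with q ⟨b, hb, hbq⟩ hq
  obtain ⟨g, rfl⟩ := exists_smul_eq hbq
  have h2 : g • F a = F a := hd g ⟨_, ⟨_, hb.2, rfl⟩, hq⟩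
  have h3 : g = 1 := smul_right_cancel_of_notMem (hs a) (h2.trans (one_smul _ _).symm)
  rw [h3, one_smul]
  exact hb.1

/-- The lift to the torus of a map on the regular set whose deck transformations commute. -/
theorem exists_lift_range {A ι : Type*} [TopologicalSpace A] [SimplyConnectedSpace A]
    [LocallyPathConnectedSpace A] (f : C(A, Orb)) (ho : IsOpenMap f) (hs : ∀ a, f a ∉ singularSet)
    (τ : ι → C(A, A)) (hτ : ∀ n m a, τ n (τ m a) = τ m (τ n a)) (hf : ∀ n a, f (τ n a) = f a)
    (hfib : ∀ a b, f a = f b → ∃ n, b = τ n a) :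
    ∃ Y : Set Torus4, IsOpen Y ∧ torusProj '' Y = Set.range f ∧
      (∀ g : D10, ∀ p ∈ Y, g • p ∈ Y → ∀ q ∈ Y, g • q ∈ Y) ∧
      ∀ g h : D10, (∀ q ∈ Y, g • q ∈ Y) → (∀ q ∈ Y, h • q ∈ Y) → g * h = h * g := by
  obtain ⟨a₀⟩ : Nonempty A := inferInstance
  obtain ⟨p₀, hp₀⟩ := Quotient.exists_rep (f a₀)
  obtain ⟨F, ⟨-, hF⟩, -⟩ := isCoveringMapOn_torusProj.existsUnique_continuousMap_lifts f hp₀ hs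
  have hFa : ∀ a, torusProj (F a) = f a := congrFun hF
  have hreg : ∀ a, torusProj (F a) ∉ singularSet := fun a => hFa a ▸ hs a
  -- Both `F ∘ τ n` and a translate of `F` lift `f`; choosing the translate to agree at `a₀` makes
  -- them equal by uniqueness of lifts.
  have hdeck : ∀ n, ∃ g : D10, ∀ a, F (τ n a) = g • F a := by
    intro n
    obtain ⟨g, hg⟩ := exists_smul_eq (((hFa a₀).trans (hf n a₀).symm).trans (hFa (τ n a₀)).symm)
    have huniq := isCoveringMapOn_torusProj.existsUnique_continuousMap_lifts f
      (a₀ := a₀) (e₀ := F (τ n a₀)) ((hFa _).trans (hf n a₀)) hs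
    have := huniq.unique (y₁ := F.comp (τ n)) (y₂ := ⟨fun a => g • F a, F.continuous.const_smul g⟩)
      ⟨rfl, funext fun a => (hFa _).trans (hf n a)⟩
      ⟨hg, funext fun a => (torusProj_smul _ _).trans (hFa a)⟩
    exact ⟨g, DFunLike.congr_fun this⟩
  choose d hd using hdeck
  have hdeck' : ∀ g : D10, ∀ a b, g • F a = F b → ∃ n, g = d n := by
    intro g a b h
    obtain ⟨n, rfl⟩ := hfib a b (by rw [← hFa a, ← hFa b, ← h, torusProj_smul])
    exact ⟨n, smul_right_cancel_of_notMem (hreg a) (h.trans (hd n a))⟩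
  refine ⟨Set.range F, (isOpenMap_of_torusProj_comp F.continuous (hF ▸ ho) hreg).isOpen_range,
    ?_, ?_, ?_⟩
  · rw [← Set.range_comp, hF]
  · rintro g _ ⟨a, rfl⟩ ⟨b, h⟩ _ ⟨c, rfl⟩
    obtain ⟨n, rfl⟩ := hdeck' g a b h.symm
    exact ⟨τ n c, hd n c⟩
  · intro g h hg hh
    obtain ⟨b, hb⟩ := hg _ ⟨a₀, rfl⟩
    obtain ⟨c, hc⟩ := hh _ ⟨a₀, rfl⟩
    obtain ⟨n, rfl⟩ := hdeck' g a₀ b hb.symm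
    obtain ⟨m, rfl⟩ := hdeck' h a₀ c hc.symm
    apply smul_right_cancel_of_notMem (hreg a₀)
    rw [mul_smul, mul_smul, ← hd, ← hd, ← hd, ← hd, hτ]

/-- A connected invariant set of regular points is not covered by an open set whose set-wise
stabilizer is commutative. -/
theorem false_of_isPreconnected {C Y : Set Torus4} (hC : IsPreconnected C) (hne : C.Nonempty)
    (hinv : ∀ g : D10, ∀ c ∈ C, g • c ∈ C) (hY : IsOpen Y)
    (hCY : torusProj '' C ⊆ torusProj '' Y)
    (hstab : ∀ g : D10, ∀ p ∈ Y, g • p ∈ Y → ∀ q ∈ Y, g • q ∈ Y)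
    (hcomm : ∀ g h : D10, (∀ q ∈ Y, g • q ∈ Y) → (∀ q ∈ Y, h • q ∈ Y) → g * h = h * g) :
    False := by
  have hmem : ∀ c ∈ C, ∃ g : D10, ∃ y ∈ Y, g • y = c := by
    intro c hc
    obtain ⟨y, hy, h⟩ := hCY ⟨c, hc, rfl⟩
    obtain ⟨g, hg⟩ := exists_smul_eq h
    exact ⟨g, y, hy, hg⟩
  have hsub : C ⊆ Y := by
    -- The translates of `Y` that miss `Y` form an open set disjoint from `Y`. Every point of `C`
    -- lies in `Y` or in `Z`, and by invariance `C` meets `Y`, so connectedness puts `C` inside `Y`.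
    let Z : Set Torus4 := ⋃ g ∈ {g : D10 | ∀ p ∈ Y, g • p ∉ Y}, (g • ·) '' Y
    have hZ : IsOpen Z := isOpen_biUnion fun g _ => isOpenMap_smul g _ hY
    have hd : Disjoint Y Z := by
      rw [Set.disjoint_left]
      intro p hp hpZ
      obtain ⟨g, hg, y, hy, rfl⟩ := Set.mem_iUnion₂.1 hpZ
      exact hg y hy hp
    refine hC.subset_left_of_subset_union hY hZ hd (fun c hc => ?_) ?_
    · obtain ⟨g, y, hy, rfl⟩ := hmem c hc
      by_cases hg : ∃ p ∈ Y, g • p ∈ Y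
      · obtain ⟨p, hp, hgp⟩ := hg
        exact Or.inl (hstab g p hp hgp y hy)
      · push Not at hg
        exact Or.inr (Set.mem_iUnion₂.2 ⟨g, hg, y, hy, rfl⟩)
    · obtain ⟨c, hc⟩ := hne
      obtain ⟨g, y, hy, rfl⟩ := hmem c hc
      refine ⟨y, ?_, hy⟩
      simpa using hinv g⁻¹ _ hc
  obtain ⟨c, hc⟩ := hne
  obtain ⟨g, h, hgh⟩ := exists_not_commute
  exact hgh (hcomm g h (hstab g c (hsub hc) (hsub (hinv g c hc)))
    (hstab h c (hsub hc) (hsub (hinv h c hc))))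

/-! ### The exponential covering of the complement of a flat plane -/

/-- The splitting `ℝ⁴ = ℝ × ℝ × ℂ`. -/
def splitHomeomorph : ℝ × ℝ × ℂ ≃ₜ (Fin 4 → ℝ) where
  toFun x := ![x.1, x.2.1, x.2.2.re, x.2.2.im]
  invFun u := (u 0, u 1, ⟨u 2, u 3⟩)
  left_inv _ := rfl
  right_inv u := by
    funext k
    fin_cases k <;> rfl
  continuous_toFun := by
    refine continuous_pi fun k => ?_
    fin_cases k
    · exact continuous_fst
    · exact continuous_snd.fst
    · exact Complex.continuous_re.comp continuous_snd.snd
    · exact Complex.continuous_im.comp continuous_snd.snd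
  continuous_invFun := by
    refine (continuous_apply 0).prodMk ((continuous_apply 1).prodMk ?_)
    have h : Continuous fun u : Fin 4 → ℝ => (u 2, u 3) := by fun_prop
    exact Complex.equivRealProdCLM.symm.continuous.comp h

theorem splitHomeomorph_mem_coordPlane (x : ℝ × ℝ × ℂ) :
    splitHomeomorph x ∈ coordPlane ↔ x.2.2 = 0 :=
  (Complex.ext_iff (z := x.2.2) (w := 0)).symm

/-- The product of two discs of radius `r`. -/
def bidisc (r : ℝ) : Set (ℝ × ℝ × ℂ) :=
  Metric.ball 0 r ×ˢ Metric.ball 0 r ×ˢ Metric.ball 0 r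

/-- The universal cover of `bidisc r` minus the plane `ℝ × ℝ × {0}`. -/
def bidiscCover (r : ℝ) : Set (ℝ × ℝ × ℂ) :=
  Metric.ball 0 r ×ˢ Metric.ball 0 r ×ˢ {z | z.re < Real.log r}

/-- The covering map of `bidisc r` minus the plane `ℝ × ℝ × {0}`. -/
noncomputable def expMap : ℝ × ℝ × ℂ → ℝ × ℝ × ℂ := Prod.map id (Prod.map id Complex.exp)

theorem isOpenMap_expMap : IsOpenMap expMap :=
  IsOpenMap.id.prodMap (IsOpenMap.id.prodMap Complex.isOpenMap_exp)

theorem continuous_expMap : Continuous expMap :=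
  continuous_id.prodMap (continuous_id.prodMap Complex.continuous_exp)

theorem mem_bidiscCover_iff {r : ℝ} (hr : 0 < r) (x : ℝ × ℝ × ℂ) :
    x ∈ bidiscCover r ↔ expMap x ∈ bidisc r := by
  have h : x.2.2.re < Real.log r ↔ Complex.exp x.2.2 ∈ Metric.ball (0 : ℂ) r := by
    rw [mem_ball_zero_iff, Complex.norm_exp, Real.lt_log_iff_exp_lt hr]
  simp only [bidiscCover, bidisc, expMap, Set.mem_prod, Prod.map_fst, Prod.map_snd, id_eq, ← h,
    Set.mem_ofPred_eq]

theorem convex_bidiscCover (r : ℝ) : Convex ℝ (bidiscCover r) :=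
  (convex_ball 0 r).prod ((convex_ball 0 r).prod (convex_halfSpace_re_lt _))

theorem isOpen_bidiscCover (r : ℝ) : IsOpen (bidiscCover r) :=
  Metric.isOpen_ball.prod (Metric.isOpen_ball.prod (isOpen_lt Complex.continuous_re continuous_const))

theorem bidiscCover_nonempty {r : ℝ} (hr : 0 < r) : (bidiscCover r).Nonempty :=
  ⟨(0, 0, (Real.log r - 1 : ℝ)), Metric.mem_ball_self hr, Metric.mem_ball_self hr, by
    rw [Set.mem_ofPred_eq, Complex.ofReal_re]; linarith⟩

/-- The deck transformations of `bidiscCover r`. -/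
noncomputable def bidiscDeck (r : ℝ) (n : ℤ) : C(bidiscCover r, bidiscCover r) where
  toFun x := ⟨(x.1.1, x.1.2.1, x.1.2.2 + n * (2 * Real.pi * Complex.I)), x.2.1, x.2.2.1, by
    simpa using x.2.2.2⟩
  continuous_toFun := by fun_prop

theorem expMap_bidiscDeck {r : ℝ} (n : ℤ) (x : bidiscCover r) :
    expMap (bidiscDeck r n x) = expMap x := by
  refine Prod.ext rfl (Prod.ext rfl ?_)
  exact Complex.exp_eq_exp_iff_exists_int.2 ⟨n, rfl⟩

theorem exists_bidiscDeck_eq {r : ℝ} {x y : bidiscCover r} (h : expMap x = expMap y) :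
    ∃ n, y = bidiscDeck r n x := by
  obtain ⟨n, hn⟩ := Complex.exp_eq_exp_iff_exists_int.1
    (congrArg (fun z : ℝ × ℝ × ℂ => z.2.2) h).symm
  exact ⟨n, Subtype.ext (Prod.ext (congrArg Prod.fst h).symm
    (Prod.ext (congrArg (fun z : ℝ × ℝ × ℂ => z.2.1) h).symm hn))⟩

/-- The singular set is not locally flat at the image of the origin: the complement of a flat plane
has a commutative local fundamental group, and the dihedral group is not commutative. -/
theorem not_isLocallyModelledOn_coordPlane_zero :
    ¬ IsLocallyModelledOn singularSet (proj 0) coordPlane := by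
  rintro ⟨e, hsrc, h0, hmod⟩
  obtain ⟨r, hr, hball⟩ : ∃ r > 0, bidisc r ⊆ splitHomeomorph ⁻¹' e.target := by
    have h1 : splitHomeomorph ⁻¹' e.target ∈ 𝓝 (0 : ℝ × ℝ × ℂ) := by
      refine splitHomeomorph.continuous.continuousAt.preimage_mem_nhds (e.open_target.mem_nhds ?_)
      have : splitHomeomorph 0 = 0 := by
        funext k
        fin_cases k <;> rfl
      rw [this, ← h0]
      exact e.map_source hsrc
    obtain ⟨r, hr, h⟩ := Metric.mem_nhds_iff.1 h1
    refine ⟨r, hr, subset_trans ?_ h⟩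
    rw [bidisc, ball_prod_same, ball_prod_same]
    rfl
  have htar : ∀ x ∈ bidisc r, splitHomeomorph x ∈ e.target := hball
  have hsing : ∀ x ∈ bidisc r, e.symm (splitHomeomorph x) ∈ singularSet ↔ x.2.2 = 0 := by
    intro x hx
    rw [hmod _ (e.map_target (htar x hx)), e.right_inv (htar x hx), splitHomeomorph_mem_coordPlane]
  have hmem : ∀ x : bidiscCover r, expMap x ∈ bidisc r := fun x => (mem_bidiscCover_iff hr _).1 x.2
  have : ContractibleSpace (bidiscCover r) :=
    (convex_bidiscCover r).contractibleSpace (bidiscCover_nonempty hr)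
  have : LocallyPathConnectedSpace (bidiscCover r) := (isOpen_bidiscCover r).locallyPathConnectedSpace
  let f : C(bidiscCover r, Orb) :=
    ⟨fun x => e.symm (splitHomeomorph (expMap x)), e.continuousOn_symm.comp_continuous
      (splitHomeomorph.continuous.comp (continuous_expMap.comp continuous_subtype_val))
      fun x => htar _ (hmem x)⟩
  have ho : IsOpenMap f := by
    intro W hW
    have h1 : IsOpen ((fun x : bidiscCover r => splitHomeomorph (expMap x)) '' W) :=
      (splitHomeomorph.isOpenMap.comp (isOpenMap_expMap.comp
        (isOpen_bidiscCover r).isOpenMap_subtype_val)) W hW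
    have h2 := e.symm.isOpen_image_of_subset_source h1 (by
      rintro _ ⟨x, -, rfl⟩
      exact htar _ (hmem x))
    rwa [Set.image_image] at h2
  -- The deck transformations are translations by multiples of `2πi`, hence commute, and the image
  -- avoids the singular set because the exponential never vanishes.
  obtain ⟨Y, hY, hYf, hstab, hcomm⟩ := exists_lift_range f ho
    (fun x hx => Complex.exp_ne_zero _ ((hsing _ (hmem x)).1 hx)) (bidiscDeck r)
    (fun n m x => Subtype.ext (Prod.ext rfl (Prod.ext rfl (add_right_comm _ _ _))))
    (fun n x => by
      change e.symm (splitHomeomorph (expMap (bidiscDeck r n x))) = _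
      rw [expMap_bidiscDeck]
      rfl)
    fun x y h => exists_bidiscDeck_eq (splitHomeomorph.injective
      (e.symm.injOn (htar _ (hmem x)) (htar _ (hmem y)) h))
  have hD : e.source ∩ e ⁻¹' (splitHomeomorph '' bidisc r) ∈ 𝓝 (proj 0) := by
    refine (e.isOpen_inter_preimage (splitHomeomorph.isOpenMap _
      (Metric.isOpen_ball.prod (Metric.isOpen_ball.prod Metric.isOpen_ball)))).mem_nhds
      ⟨hsrc, 0, ⟨Metric.mem_ball_self hr, Metric.mem_ball_self hr, Metric.mem_ball_self hr⟩, ?_⟩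
    rw [h0]
    funext k
    fin_cases k <;> rfl
  -- Choose `N` inside the chart and so small that its singular points are exactly accounted for by
  -- fixed vectors; its free part then maps into the punctured bidisc.
  obtain ⟨N, hN, hNsub, hNc, hNinv⟩ := exists_invariant_nhds (Filter.inter_mem
    (continuous_proj.continuousAt.preimage_mem_nhds hD) eventually_mem_singularSet_iff)
  refine false_of_isPreconnected (C := QuotientAddGroup.mk '' freePart N)
    ((isPreconnected_freePart hNc hN).image _ QuotientAddGroup.continuous_mk.continuousOn)
    ((freePart_nonempty hN).image _) ?_ hY ?_ hstab hcomm
  · rintro ⟨g, hg⟩ _ ⟨v, hv, rfl⟩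
    obtain ⟨m, hm⟩ := exists_actsBy hg
    exact ⟨_, permMap_mem_freePart hNinv hv m, (hm v).symm⟩
  · rintro _ ⟨_, ⟨v, hv, rfl⟩, rfl⟩
    rw [hYf]
    obtain ⟨⟨hs, x, hx, hxe⟩, hreg⟩ := hNsub hv.1
    have hxv : e.symm (splitHomeomorph x) = proj v := by rw [hxe, e.left_inv hs]
    have hx0 : x.2.2 ≠ 0 := by
      rw [Ne, ← hsing x hx, hxv]
      intro h
      obtain ⟨m, hm, h⟩ := hreg h
      exact hv.2 m hm h
    have hexp : expMap (x.1, x.2.1, Complex.log x.2.2) = x :=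
      Prod.ext rfl (Prod.ext rfl (Complex.exp_log hx0))
    refine ⟨⟨(x.1, x.2.1, Complex.log x.2.2), (mem_bidiscCover_iff hr _).2 (hexp.symm ▸ hx)⟩, ?_⟩
    change e.symm (splitHomeomorph (expMap (x.1, x.2.1, Complex.log x.2.2))) = _
    rw [hexp, hxv]
    rfl

/-- At the cone points the singular set is not locally flat. -/
theorem not_isLocallyModelledOn_coordPlane (t : Fin 5) :
    ¬ IsLocallyModelledOn singularSet (conePoint t) coordPlane := by
  rintro ⟨e, hsrc, h0, hmod⟩
  have hc := isFixedVec_coneVec t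
  have ht : orbTranslate (coneVec t) (proj 0) = conePoint t := by
    rw [orbTranslate_proj hc, zero_add, conePoint_eq]
  refine not_isLocallyModelledOn_coordPlane_zero
    ⟨(orbTranslateHomeomorph hc).toOpenPartialHomeomorph.trans e, ?_, ?_, ?_⟩
  · rw [OpenPartialHomeomorph.trans_source]
    refine ⟨trivial, ?_⟩
    change orbTranslate (coneVec t) (proj 0) ∈ e.source
    rwa [ht]
  · change e (orbTranslate (coneVec t) (proj 0)) = 0
    rw [ht, h0]
  · intro y hy
    rw [OpenPartialHomeomorph.trans_source] at hy
    have := hmod _ hy.2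
    exact (orbTranslate_mem_singularSet hc y).symm.trans this

end FlatOrbifold

theorem mainTheorem10 :
    -- the underlying space of the orbifold is PL-homeomorphic to the 4-sphere
    (∃ h : FlatOrbifold.Orb ≃ₜ FlatOrbifold.plSphere4,
      FlatOrbifold.IsPLOnOrb (fun x => (h x : Fin 6 → ℝ)) Set.univ) ∧
    -- the singular set is the image of the Lagrangian torus, and it is a torus
    FlatOrbifold.singularSet = FlatOrbifold.lagrangianTorus ∧
    Nonempty (FlatOrbifold.singularSet ≃ₜ UnitAddCircle × UnitAddCircle) ∧
    -- the five points are distinct points of the singular set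
    Function.Injective FlatOrbifold.conePoint ∧
    Set.range FlatOrbifold.conePoint ⊆ FlatOrbifold.singularSet ∧
    -- away from them, the singular set is locally flat (in the PL sense)
    (∀ x ∈ FlatOrbifold.singularSet, x ∉ Set.range FlatOrbifold.conePoint →
      FlatOrbifold.IsPLLocallyModelledOn FlatOrbifold.singularSet x FlatOrbifold.coordPlane) ∧
    -- at each of them it is locally a cone over the figure-eight knot, and it is not locally flat
    (∀ t : Fin 5,
      FlatOrbifold.IsPLLocallyModelledOn FlatOrbifold.singularSet (FlatOrbifold.conePoint t)
        (FlatOrbifold.coneOver FlatOrbifold.figureEight) ∧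
      ¬ FlatOrbifold.IsLocallyModelledOn FlatOrbifold.singularSet (FlatOrbifold.conePoint t)
        FlatOrbifold.coordPlane) :=
  ⟨FlatOrbifold.exists_homeomorph_sphere, FlatOrbifold.singularSet_eq_lagrangianTorus,
    FlatOrbifold.nonempty_homeomorph_torus, FlatOrbifold.conePoint_injective,
    Set.range_subset_iff.2 FlatOrbifold.conePoint_mem,
    fun _ hx hc => FlatOrbifold.isPLLocallyModelledOn_coordPlane hx hc,
    fun t => ⟨FlatOrbifold.isPLLocallyModelledOn_figureEight t,
      FlatOrbifold.not_isLocallyModelledOn_coordPlane t⟩⟩
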